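/- Let $n\ge 2$ be an integer, let $K$ be a field of characteristic $0$, and let $q\in K^\times$ be not a root of unity (for example $K=\mathbf C$ with $q$ generic, or $K=\mathbf C(q)$ with $q$ a formal parameter). **The algebra.** $U'_q(\widehat{\mathfrak{sl}}_n)$ is the $K$-algebra generated by $E_i,F_i,K_i^{\pm1}$ ($i\in\mathbf Z/n$) with relations $K_iK_i^{-1}=K_i^{-1}K_i=1$, $K_iK_j=K_jK_i$, $K_iE_j=q^{a_{ij}}E_jK_i$, $K_iF_j=q^{-a_{ij}}F_jK_i$, $E_iF_j-F_jE_i=\delta_{ij}\frac{K_i-K_i^{-1}}{q-q^{-1}}$, $E_iE_j=E_jE_i$ and $F_iF_j=F_jF_i$ for $i\ne j\pm1$, and the $q$-Serre relations for $X=E$ and $X=F$: $X_i^2X_{i\pm1}-(q+q^{-1})X_iX_{i\pm1}X_i+X_{i\pm1}X_i^2=0$ if $n>2$, and $X_i^3X_{i\pm1}-[3]X_i^2X_{i\pm1}X_i+[3]X_iX_{i\pm1}X_i^2-X_{i\pm1}X_i^3=0$ if $n=2$, where $[3]=q^2+1+q^{-2}$. Here $a_{ii}=2$; $a_{ij}=-1$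 if $i=j\pm1$ and $n>2$; $a_{ij}=-2$ if $i\ne j$ and $n=2$; $a_{ij}=0$ otherwise. **The spaces.** Let $V(z)=\bigoplus_{j=1}^n K[z,z^{-1}]\,v_j$ have the basis $u_{j-an}=z^av_j$ ($1\le j\le n$, $a\in\mathbf Z$). Put $$E_iu_p=\delta(p-1\equiv i)\,u_{p-1},\qquad F_iu_p=\delta(p\equiv i)\,u_{p+1},\qquad K_iu_p=q^{\delta(p\equiv i)-\delta(p\equiv i+1)}u_p ,$$ congruences being modulo $n$. For $m\in\mathbf Z$ let $U_{(m)}$ be the vector space with basis the pure tensors $u_{m_1}\otimes u_{m_2}\otimes\cdots$ with $m_k=m-k+1$ for all but finitely many $k$. The operator $y_k$ on $U_{(m)}$ multiplies the $k$-th tensor factor by $z^{-1}$. The operator $T_i$ ($i\ge1$) acts in the factors $i,i+1$ by $$(v_j\otimes v_k)\,f\cdot T=\begin{cases}-q\,(v_k\otimes v_j)f^\sigma-(q^2-1)(v_j\otimes v_k)\dfrac{z_2f^\sigma-z_1f}{z_1-z_2}&j<k,\\[2mm]-(v_j\otimes v_k)f^\sigma-(q^2-1)(v_j\otimes v_k)\dfrac{z_1(f^\sigma-f)}{z_1-z_2}&j=k,\\[2mm]-q\,(v_k\otimes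 v_j)f^\sigma-(q^2-1)(v_j\otimes v_k)\dfrac{z_1(f^\sigma-f)}{z_1-z_2}&j>k,\end{cases}$$ where $f=z_1^az_2^b$ and $f^\sigma=z_1^bz_2^a$. The $q$-deformed Fock space is $F_{(m)}=U_{(m)}\big/\sum_{i\ge1}\operatorname{Ker}(T_i+1)$. Write $[w]$ for the class of $w\in U_{(m)}$, $|m\rangle$ for the class of $u_m\otimes u_{m-1}\otimes\cdots$, and $v\wedge[w]=[v\otimes w]\in F_{(m+1)}$ for $v\in V(z)$, $w\in U_{(m)}$. **Proposition.** (1) There is exactly one family of actions of $U'_q(\widehat{\mathfrak{sl}}_n)$ on the spaces $F_{(m)}$, $m\in\mathbf Z$, such that for all $m$, all $i$, all $v\in V(z)$ and all $w\in F_{(m)}$: * $E_i|m\rangle=0$; $F_i|m\rangle=u_{m+1}\wedge|m-1\rangle$ if $i\equiv m$ and $F_i|m\rangle=0$ otherwise; $K_i|m\rangle=q|m\rangle$ if $i\equiv m$ and $K_i|m\rangle=|m\rangle$ otherwise; * $E_i(v\wedge w)=E_iv\wedge K_iw+v\wedge E_iw$, $\;F_i(v\wedge w)=F_iv\wedge w+K_i^{-1}v\wedge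 F_iw$, $\;K_i(v\wedge w)=K_iv\wedge K_iw$. (2) Let $a\in\mathbf Z\setminus\{0\}$ and $m\in\mathbf Z$. For every $w\in U_{(m)}$ only finitely many of the vectors $[y_k^{-a}w]\in F_{(m)}$, $k\ge1$, are non-zero, and the formal operator $B_a=\sum_{k\ge1}y_k^{-a}$ induces a well-defined linear operator on $F_{(m)}$: there is a linear map $B_a:F_{(m)}\to F_{(m)}$ with $$B_a[w]=\sum_{k\ge1}[y_k^{-a}w]\qquad\text{for all }w\in U_{(m)} .$$ This operator commutes with the action (1) of every element of $U'_q(\widehat{\mathfrak{sl}}_n)$ on $F_{(m)}$. -/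

import Mathlib

noncomputable section

namespace QFock

/-! ### The quantum affine algebra without degree operator -/

/-- The generators `E_i`, `F_i`, `K_i`, `K_i⁻¹`, with `i` read modulo `n`. -/
inductive Gen (n : ℕ) : Type
  | E (i : ZMod n)
  | F (i : ZMod n)
  | K (i : ZMod n)
  | Kinv (i : ZMod n)

/-- The Cartan matrix of affine `sl_n` for `n ≥ 2`. -/
def cartan (n : ℕ) (i j : ZMod n) : ℤ :=
  if i = j then 2
  else if i = j + 1 ∨ i = j - 1 then (if n = 2 then -2 else -1)
  else 0

/-- The `q`-integer `[k] = (q^k - q^{-k}) / (q - q^{-1})`. -/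
def qInt {K : Type*} [Field K] (q : K) (k : ℕ) : K :=
  (q ^ k - (q⁻¹) ^ k) / (q - q⁻¹)

section Relations

variable (K : Type*) [Field K] (n : ℕ)

/-- The free generator `E_i`. -/
abbrev fE (i : ZMod n) : FreeAlgebra K (Gen n) := FreeAlgebra.ι K (Gen.E i)
/-- The free generator `F_i`. -/
abbrev fF (i : ZMod n) : FreeAlgebra K (Gen n) := FreeAlgebra.ι K (Gen.F i)
/-- The free generator `K_i`. -/
abbrev fK (i : ZMod n) : FreeAlgebra K (Gen n) := FreeAlgebra.ι K (Gen.K i)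
/-- The free generator `K_i⁻¹`. -/
abbrev fKinv (i : ZMod n) : FreeAlgebra K (Gen n) := FreeAlgebra.ι K (Gen.Kinv i)

end Relations

/-- The defining relations of `U'_q(sl_n^)`, `n ≥ 2`. -/
inductive Rel {K : Type*} [Field K] (q : K) (n : ℕ) :
    FreeAlgebra K (Gen n) → FreeAlgebra K (Gen n) → Prop
  | K_mul_Kinv (i : ZMod n) : Rel q n (fK K n i * fKinv K n i) 1
  | Kinv_mul_K (i : ZMod n) : Rel q n (fKinv K n i * fK K n i) 1
  | K_comm (i j : ZMod n) : Rel q n (fK K n i * fK K n j) (fK K n j * fK K n i)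
  | K_E (i j : ZMod n) :
      Rel q n (fK K n i * fE K n j) (q ^ cartan n i j • (fE K n j * fK K n i))
  | K_F (i j : ZMod n) :
      Rel q n (fK K n i * fF K n j) (q ^ (-cartan n i j) • (fF K n j * fK K n i))
  | E_F_same (i : ZMod n) :
      Rel q n (fE K n i * fF K n i - fF K n i * fE K n i)
        ((q - q⁻¹)⁻¹ • (fK K n i - fKinv K n i))
  | E_F_ne (i j : ZMod n) (h : i ≠ j) :
      Rel q n (fE K n i * fF K n j - fF K n j * fE K n i) 0
  | E_E (i j : ZMod n) (h₁ : i ≠ j + 1) (h₂ : i ≠ j - 1) :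
      Rel q n (fE K n i * fE K n j) (fE K n j * fE K n i)
  | F_F (i j : ZMod n) (h₁ : i ≠ j + 1) (h₂ : i ≠ j - 1) :
      Rel q n (fF K n i * fF K n j) (fF K n j * fF K n i)
  | serre_E (hn : n ≠ 2) (i j : ZMod n) (h : j = i + 1 ∨ j = i - 1) :
      Rel q n (fE K n i ^ 2 * fE K n j - (q + q⁻¹) • (fE K n i * fE K n j * fE K n i)
        + fE K n j * fE K n i ^ 2) 0
  | serre_F (hn : n ≠ 2) (i j : ZMod n) (h : j = i + 1 ∨ j = i - 1) :
      Rel q n (fF K n i ^ 2 * fF K n j - (q + q⁻¹) • (fF K n i * fF K n j * fF K n i)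
        + fF K n j * fF K n i ^ 2) 0
  | serre_E_two (hn : n = 2) (i j : ZMod n) (h : j = i + 1 ∨ j = i - 1) :
      Rel q n (fE K n i ^ 3 * fE K n j - qInt q 3 • (fE K n i ^ 2 * fE K n j * fE K n i)
        + qInt q 3 • (fE K n i * fE K n j * fE K n i ^ 2) - fE K n j * fE K n i ^ 3) 0
  | serre_F_two (hn : n = 2) (i j : ZMod n) (h : j = i + 1 ∨ j = i - 1) :
      Rel q n (fF K n i ^ 3 * fF K n j - qInt q 3 • (fF K n i ^ 2 * fF K n j * fF K n i)
        + qInt q 3 • (fF K n i * fF K n j * fF K n i ^ 2) - fF K n j * fF K n i ^ 3) 0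

/-- The algebra `U'_q(sl_n^)`. -/
abbrev Uq {K : Type*} [Field K] (q : K) (n : ℕ) : Type _ := RingQuot (Rel q n)

/-- The class of a generator in `U'_q(sl_n^)`. -/
def Uq.gen {K : Type*} [Field K] (q : K) (n : ℕ) (g : Gen n) : Uq q n :=
  RingQuot.mkAlgHom K (Rel q n) (FreeAlgebra.ι K g)

/-! ### The evaluation module

`V(z) = V ⊗ K[z, z⁻¹]` has the basis `z^a v_j` (`1 ≤ j ≤ n`, `a ∈ ℤ`), relabelled
`u_{j - a n} = z^a v_j`; thus `V(z)` is the free vector space on `ℤ`. -/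

/-- `V(z)`, with basis `u_p`, `p ∈ ℤ`. -/
abbrev Vz (K : Type*) [Field K] : Type _ := ℤ →₀ K

/-- The basis vector `u_p` of `V(z)`. -/
def u (K : Type*) [Field K] (p : ℤ) : Vz K := Finsupp.single p 1

/-- The exponent `δ(p ≡ i) - δ(p ≡ i + 1)` of the eigenvalue of `K_i` on `u_p`. -/
def wt (n : ℕ) (i : ZMod n) (p : ℤ) : ℤ :=
  (if (p : ZMod n) = i then 1 else 0) - (if (p : ZMod n) = i + 1 then 1 else 0)

section Evaluation

variable {K : Type*} [Field K] (q : K) (n : ℕ)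

/-- `E_i u_p = δ(p - 1 ≡ i) u_{p-1}`. -/
def evE (K : Type*) [Field K] (n : ℕ) (i : ZMod n) : Vz K →ₗ[K] Vz K :=
  Finsupp.linearCombination K fun p : ℤ => if ((p - 1 : ℤ) : ZMod n) = i then u K (p - 1) else 0

/-- `F_i u_p = δ(p ≡ i) u_{p+1}`. -/
def evF (K : Type*) [Field K] (n : ℕ) (i : ZMod n) : Vz K →ₗ[K] Vz K :=
  Finsupp.linearCombination K fun p : ℤ => if (p : ZMod n) = i then u K (p + 1) else 0

/-- `K_i u_p = q^{δ(p ≡ i) - δ(p ≡ i + 1)} u_p`. -/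
def evK (i : ZMod n) : Vz K →ₗ[K] Vz K :=
  Finsupp.linearCombination K fun p : ℤ => q ^ wt n i p • u K p

/-- The inverse of `K_i` on `V(z)`. -/
def evKinv (i : ZMod n) : Vz K →ₗ[K] Vz K :=
  Finsupp.linearCombination K fun p : ℤ => q ^ (-wt n i p) • u K p

end Evaluation

/-! ### The Hecke operator on two adjacent tensor factors

A basis vector `z₁^a z₂^b` or `u_p ⊗ u_r` is recorded by the pair of its indices. -/

/-- The index `j - 1 ∈ {0, …, n-1}` in `u_p = z^a v_j`. -/
def color (n : ℕ) (p : ℤ) : ℤ := (p - 1) % n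

/-- The exponent `a` in `u_p = z^a v_j`. -/
def zexp (n : ℕ) (p : ℤ) : ℤ := -((p - 1) / n)

/-- The index of `z^a v_j`, where `c = j - 1`. -/
def idx (n : ℕ) (c a : ℤ) : ℤ := c + 1 - a * n

theorem idx_color_zexp (n : ℕ) (p : ℤ) : idx n (color n p) (zexp n p) = p := by
  have h := Int.emod_add_mul_ediv (p - 1) (n : ℤ)
  unfold idx color zexp
  linarith

/-- The Laurent polynomial `(z₁^x z₂^y - z₁^y z₂^x) / (z₁ - z₂)`; see `divDiff_spec`. -/
def divDiff (K : Type*) [Field K] (x y : ℤ) : ℤ × ℤ →₀ K :=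
  ∑ c ∈ Finset.Ico y x, Finsupp.single (c, x + y - 1 - c) 1
    - ∑ c ∈ Finset.Ico x y, Finsupp.single (c, x + y - 1 - c) 1

theorem divDiff_spec_of_le (K : Type*) [Field K] (y : ℤ) (d : ℕ) (s : ℤ) :
    ∑ c ∈ Finset.Ico y (y + d), (Finsupp.single (c + 1, s - 1 - c) (1 : K)
      - Finsupp.single (c, s - 1 - c + 1) 1)
      = Finsupp.single (y + d, s - (y + d)) 1 - Finsupp.single (y, s - y) 1 := by
  induction d with
  | zero => simp
  | succ d ih =>
    have h : Finset.Ico y (y + ((d + 1 : ℕ) : ℤ))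
        = insert (y + (d : ℤ)) (Finset.Ico y (y + d)) := by
      ext c
      simp only [Finset.mem_Ico, Finset.mem_insert]
      push_cast
      omega
    rw [h, Finset.sum_insert (by simp), ih]
    have e1 : y + (d : ℤ) + 1 = y + ((d + 1 : ℕ) : ℤ) := by push_cast; ring
    have e2 : s - 1 - (y + (d : ℤ)) = s - (y + ((d + 1 : ℕ) : ℤ)) := by push_cast; ring
    have e3 : s - 1 - (y + (d : ℤ)) + 1 = s - (y + d) := by ring
    rw [e1, e3, e2]
    abel

/-- `z₁ D - z₂ D = z₁^x z₂^y - z₁^y z₂^x` for `D = divDiff K x y`. -/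
theorem divDiff_spec (K : Type*) [Field K] (x y : ℤ) :
    Finsupp.mapDomain (fun e : ℤ × ℤ => (e.1 + 1, e.2)) (divDiff K x y)
      - Finsupp.mapDomain (fun e : ℤ × ℤ => (e.1, e.2 + 1)) (divDiff K x y)
      = Finsupp.single (x, y) 1 - Finsupp.single (y, x) 1 := by
  have hm : ∀ (f : ℤ × ℤ → ℤ × ℤ) (a b : ℤ × ℤ →₀ K),
      Finsupp.mapDomain f (a - b) = Finsupp.mapDomain f a - Finsupp.mapDomain f b :=
    fun f a b => (Finsupp.lmapDomain K K f).map_sub a b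
  have key := divDiff_spec_of_le K
  unfold divDiff
  simp only [hm, Finsupp.mapDomain_finsetSum, Finsupp.mapDomain_single]
  rcases le_total y x with h | h
  · obtain ⟨d, rfl⟩ := Int.le.dest h
    have := key y d (y + d + y)
    rw [Finset.Ico_eq_empty_of_le h]
    rw [Finset.sum_sub_distrib] at this
    simpa using this
  · obtain ⟨d, rfl⟩ := Int.le.dest h
    have := key x d (x + (x + d))
    rw [Finset.Ico_eq_empty_of_le h]
    rw [Finset.sum_sub_distrib] at this
    simp only [Finset.sum_empty, zero_sub, sub_neg_eq_add]
    rw [neg_add_eq_sub, ← neg_sub, this, neg_sub]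
    congr 3 <;> ring

/-- `(v_{c₁+1} ⊗ v_{c₂+1}) · f(z₁, z₂)` as an element of `V(z) ⊗ V(z)`. -/
def colored {K : Type*} [Field K] (n : ℕ) (c₁ c₂ : ℤ) (f : ℤ × ℤ →₀ K) : ℤ × ℤ →₀ K :=
  Finsupp.mapDomain (fun e : ℤ × ℤ => (idx n c₁ e.1, idx n c₂ e.2)) f

/-- The image of `u_p ⊗ u_r` under the (right) action of the Hecke generator on `V(z) ⊗ V(z)`.
With `u_p = z^a v_j`, `u_r = z^b v_k` and `σ` the flip, it equals
`-q (v_j ⊗ v_k)^σ (z₁^a z₂^b)^σ - (q² - 1) (v_j ⊗ v_k) (z₂ z₁^b z₂^a - z₁ z₁^a z₂^b)/(z₁ - z₂)`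
if `j < k`;
`-(v_j ⊗ v_k) (z₁^a z₂^b)^σ - (q² - 1) (v_j ⊗ v_k) z₁ (z₁^b z₂^a - z₁^a z₂^b)/(z₁ - z₂)`
if `j = k`;
`-q (v_j ⊗ v_k)^σ (z₁^a z₂^b)^σ - (q² - 1) (v_j ⊗ v_k) z₁ (z₁^b z₂^a - z₁^a z₂^b)/(z₁ - z₂)`
if `j > k`. -/
def hecke₂ {K : Type*} [Field K] (q : K) (n : ℕ) (x : ℤ × ℤ) : ℤ × ℤ →₀ K :=
  let j := color n x.1
  let k := color n x.2
  let a := zexp n x.1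
  let b := zexp n x.2
  if j < k then
    -q • Finsupp.single (x.2, x.1) 1 - (q ^ 2 - 1) • colored n j k (divDiff K b (a + 1))
  else if j = k then
    -Finsupp.single (x.2, x.1) 1 - (q ^ 2 - 1) • colored n j k
      (Finsupp.mapDomain (fun e : ℤ × ℤ => (e.1 + 1, e.2)) (divDiff K b a))
  else
    -q • Finsupp.single (x.2, x.1) 1 - (q ^ 2 - 1) • colored n j k
      (Finsupp.mapDomain (fun e : ℤ × ℤ => (e.1 + 1, e.2)) (divDiff K b a))

/-! ### The semi-infinite tensor space `U_(m)`

Tensor factors are numbered `0, 1, 2, …`. -/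

/-- The sequences `(m_k)` indexing the pure tensors `u_{m_0} ⊗ u_{m_1} ⊗ ⋯` that agree with
`u_m ⊗ u_{m-1} ⊗ u_{m-2} ⊗ ⋯` in all but finitely many factors. -/
def State (m : ℤ) : Type := {s : ℕ → ℤ // ∀ᶠ k : ℕ in Filter.atTop, s k = m - k}

/-- Replace the `i`-th entry. -/
def State.set {m : ℤ} (s : State m) (i : ℕ) (p : ℤ) : State m :=
  ⟨Function.update s.1 i p, by
    filter_upwards [s.2, Filter.eventually_gt_atTop i] with k hk hik
    rw [Function.update_of_ne hik.ne', hk]⟩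

/-- Put `p` in front of a sequence. -/
def State.cons {m : ℤ} (p : ℤ) (s : State m) : State (m + 1) :=
  ⟨fun k => Nat.casesOn k p s.1, by
    have h := s.2
    rw [Filter.eventually_atTop] at h ⊢
    obtain ⟨N, hN⟩ := h
    refine ⟨N + 1, fun k hk => ?_⟩
    cases k with
    | zero => omega
    | succ k =>
      have := hN k (by omega)
      simp only [this]
      push_cast
      ring⟩

/-- The sequence `m, m - 1, m - 2, …`. -/
def State.vac (m : ℤ) : State m := ⟨fun k => m - k, Filter.Eventually.of_forall fun _ => rfl⟩

/-- The space `U_(m)`. -/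
abbrev U (K : Type*) [Field K] (m : ℤ) : Type _ := State m →₀ K

/-- The Hecke generator acting in the adjacent factors `i`, `i + 1` of `U_(m)`. -/
def heckeT {K : Type*} [Field K] (q : K) (n : ℕ) (m : ℤ) (i : ℕ) : U K m →ₗ[K] U K m :=
  Finsupp.linearCombination K fun s : State m =>
    Finsupp.mapDomain (fun x : ℤ × ℤ => (s.set i x.1).set (i + 1) x.2)
      (hecke₂ q n (s.1 i, s.1 (i + 1)))

/-- Multiplication of the `k`-th factor by `z⁻¹`, on sequences: `z⁻¹ u_p = u_{p + n}`. -/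
def yPerm (n : ℕ) (m : ℤ) (k : ℕ) : Equiv.Perm (State m) where
  toFun s := s.set k (s.1 k + n)
  invFun s := s.set k (s.1 k - n)
  left_inv s := by
    apply Subtype.ext
    simp [State.set]
  right_inv s := by
    apply Subtype.ext
    simp [State.set]

/-- The action of `y_k` on `U_(m)`: multiplication by `z_k⁻¹`. -/
def y (K : Type*) [Field K] (n : ℕ) (m : ℤ) (k : ℕ) : U K m ≃ₗ[K] U K m :=
  Finsupp.domLCongr (yPerm n m k)

/-- `v ⊗ w` for `v ∈ V(z)`, `w ∈ U_(m)`. -/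
def tensor {K : Type*} [Field K] {m : ℤ} : Vz K →ₗ[K] U K m →ₗ[K] U K (m + 1) :=
  Finsupp.linearCombination K fun p : ℤ => Finsupp.lmapDomain K K (State.cons (m := m) p)

/-! ### The q-deformed Fock space -/

/-- The sum of the kernels of the operators `T_i + 1`. -/
def kerSum {K : Type*} [Field K] (q : K) (n : ℕ) (m : ℤ) : Submodule K (U K m) :=
  ⨆ i : ℕ, LinearMap.ker (heckeT q n m i + LinearMap.id)

/-- The `q`-deformed Fock space `F_(m)`. -/
abbrev Fock {K : Type*} [Field K] (q : K) (n : ℕ) (m : ℤ) : Type _ := U K m ⧸ kerSum q n m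

/-- The quotient map `U_(m) → F_(m)`. -/
def toFock {K : Type*} [Field K] (q : K) (n : ℕ) (m : ℤ) : U K m →ₗ[K] Fock q n m :=
  (kerSum q n m).mkQ

/-- The vacuum `|m⟩ = u_m ∧ u_{m-1} ∧ ⋯`. -/
def vac {K : Type*} [Field K] (q : K) (n : ℕ) (m : ℤ) : Fock q n m :=
  toFock q n m (Finsupp.single (State.vac m) 1)

theorem State.cons_set_set {m : ℤ} (p : ℤ) (s : State m) (i : ℕ) (a b : ℤ) :
    ((State.cons p s).set (i + 1) a).set (i + 1 + 1) b
      = State.cons p ((s.set i a).set (i + 1) b) := by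
  apply Subtype.ext
  funext k
  cases k with
  | zero => simp [State.set, State.cons, Function.update_apply]
  | succ k => simp [State.set, State.cons, Function.update_apply]

theorem heckeT_tensor {K : Type*} [Field K] (q : K) (n : ℕ) (m : ℤ) (i : ℕ) (v : Vz K)
    (w : U K m) :
    heckeT q n (m + 1) (i + 1) (tensor v w) = tensor v (heckeT q n m i w) := by
  induction v using Finsupp.induction_linear with
  | zero => simp
  | add a b ha hb => simp [ha, hb]
  | single p c =>
    induction w using Finsupp.induction_linear with
    | zero => simp
    | add a b ha hb => simp only [map_add, ha, hb]
    | single s d =>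
      simp only [tensor, heckeT, Finsupp.linearCombination_single, LinearMap.smul_apply,
        Finsupp.lmapDomain_apply, Finsupp.mapDomain_single, map_smul]
      rw [← Finsupp.mapDomain_comp]
      rw [smul_comm]
      congr 3
      funext x
      exact State.cons_set_set p s i x.1 x.2

theorem kerSum_le_comap {K : Type*} [Field K] (q : K) (n : ℕ) (m : ℤ) (v : Vz K) :
    kerSum q n m ≤ (kerSum q n (m + 1)).comap (tensor v) := by
  refine iSup_le fun i w hw => ?_
  refine (le_iSup (fun i : ℕ => LinearMap.ker (heckeT q n (m + 1) i + LinearMap.id)) (i + 1)) ?_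
  rw [LinearMap.mem_ker] at hw ⊢
  rw [LinearMap.add_apply, LinearMap.id_apply] at hw ⊢
  rw [heckeT_tensor, ← map_add, hw, map_zero]

/-- The `q`-wedging operator `w ↦ v ∧ w` from `F_(m)` to `F_(m+1)`. -/
def wedge {K : Type*} [Field K] (q : K) (n : ℕ) (m : ℤ) (v : Vz K) :
    Fock q n m →ₗ[K] Fock q n (m + 1) :=
  Submodule.mapQ _ _ (tensor v) (kerSum_le_comap q n m v)

/-- `ρ` is the action of `U'_q(sl_n^)` on the Fock spaces `F_(m)`, `m ∈ ℤ`: it is given on the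
vacua by the highest weight formulas, and on `v ∧ w` by the coproduct
`Δ(E_i) = E_i ⊗ K_i + 1 ⊗ E_i`, `Δ(F_i) = F_i ⊗ 1 + K_i⁻¹ ⊗ F_i`, `Δ(K_i) = K_i ⊗ K_i`. -/
structure IsFockAction {K : Type*} [Field K] (q : K) (n : ℕ)
    (ρ : ∀ m : ℤ, Uq q n →ₐ[K] Module.End K (Fock q n m)) : Prop where
  E_vac : ∀ (i : ZMod n) (m : ℤ), ρ m (Uq.gen q n (Gen.E i)) (vac q n m) = 0
  F_vac : ∀ (i : ZMod n) (m : ℤ), ρ (m + 1) (Uq.gen q n (Gen.F i)) (vac q n (m + 1)) =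
    if ((m + 1 : ℤ) : ZMod n) = i then wedge q n m (u K (m + 2)) (vac q n m) else 0
  K_vac : ∀ (i : ZMod n) (m : ℤ), ρ m (Uq.gen q n (Gen.K i)) (vac q n m) =
    if (m : ZMod n) = i then q • vac q n m else vac q n m
  E_wedge : ∀ (i : ZMod n) (m : ℤ) (v : Vz K) (w : Fock q n m),
    ρ (m + 1) (Uq.gen q n (Gen.E i)) (wedge q n m v w) =
      wedge q n m (evE K n i v) (ρ m (Uq.gen q n (Gen.K i)) w)
        + wedge q n m v (ρ m (Uq.gen q n (Gen.E i)) w)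
  F_wedge : ∀ (i : ZMod n) (m : ℤ) (v : Vz K) (w : Fock q n m),
    ρ (m + 1) (Uq.gen q n (Gen.F i)) (wedge q n m v w) =
      wedge q n m (evF K n i v) w
        + wedge q n m (evKinv q n i v) (ρ m (Uq.gen q n (Gen.F i)) w)
  K_wedge : ∀ (i : ZMod n) (m : ℤ) (v : Vz K) (w : Fock q n m),
    ρ (m + 1) (Uq.gen q n (Gen.K i)) (wedge q n m v w) =
      wedge q n m (evK q n i v) (ρ m (Uq.gen q n (Gen.K i)) w)

end QFock

end

/-!
The kernels of the `T_i + 1` are first described explicitly. In two factors the kernel of `T + 1` is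
spanned by the combinations
`u_{P+c} ⊗ u_R + u_{R+c} ⊗ u_P + q⁻¹ (u_P ⊗ u_{R+c} + u_R ⊗ u_{P+c})` with `0 ≤ c < n` and `P ≡ R`:
they lie in the kernel (`hecke₂_rel`), they allow one to write every tensor through decreasing ones
(`IsQAlt.mem_span`), and a combination of decreasing tensors in the kernel is zero, because `T`
sends `u_p ⊗ u_r` with `p > r` to a nonzero multiple of `u_r ⊗ u_p` plus higher terms
(`hecke₂_leading`). Hence a linear map on `U_(m)` descends to `F_(m)` as soon as it kills these
combinations (`kerSum_le_ker`). Straightening also shows that a wedge vanishes if, far out, a single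
entry is changed (`ket_eq_zero_of_pos`, `ket_eq_zero_of_neg`). Therefore infinite sums
`∑ k, L ⊗ ⋯ ⊗ L ⊗ A ⊗ R ⊗ R ⊗ ⋯` make sense on `F_(m)`, and they are well defined if `A ⊗ R + L ⊗ A`
respects the four-term relations (`op_toFock`, `op_wedge`). This gives the `E_i`, `F_i` and `B_a`;
the `K_i` act diagonally, with eigenvalues normalized on the vacuum.

The vectors of the Fock spaces are obtained from vacua by wedging with vectors of `V(z)`, so an
operator is determined by its values on the vacua and a rule for `v ∧ w` (`fock_ext`). This gives
uniqueness. It also gives the defining relations: for each of them, the difference of the two sides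
acts on `v ∧ w` through one term `A ⊗ X`, since it holds on `V(z)` and the coproduct respects it, so
only the vacuum has to be checked. For the Serre relations the mixed terms cancel by
`q`-commutation (`serre_add`, `serre₃_add`).

Finally, the commutator `D` of `B_a` with a generator commutes with `u_p ∧ ·` up to scalars. Writing
the vacuum as `u_m ∧ ⋯ ∧ u_{m-L+1} ∧ |m - L⟩` shows that `D|m⟩` is a combination of wedges that
differ from the vacuum by moving two factors behind the `L`-th one, by `-a n` and by at most `1`.
For large `L` all of these vanish (`ket_vac_move_move_eq_zero`), so `D = 0` (`commute_heis`).
-/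

noncomputable section

namespace QFock

/-! ### The kernel of the Hecke operator on two factors -/

section TwoFactors

variable {K : Type*} [Field K] {q : K} {n : ℕ}

theorem divDiff_antisymm (x y : ℤ) : divDiff K y x = -divDiff K x y := by
  unfold divDiff
  rw [neg_sub, add_comm y x]

/-- The identity `(z₂ f - z₁ f) / (z₁ - z₂) = -f` for the symmetric polynomial
`f = z₁^a z₂^b + z₁^b z₂^a`. -/
theorem divDiff_succ_add (a b : ℤ) :
    divDiff K b (a + 1) + divDiff K a (b + 1)
      = -(Finsupp.single (a, b) 1 + Finsupp.single (b, a) 1) := by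
  wlog h : a ≤ b generalizing a b
  · rw [add_comm, this b a (by omega), add_comm]
  have e1 : ∀ c : ℤ, b + (a + 1) - 1 - c = a + b - c := fun c => by ring
  have e2 : ∀ c : ℤ, a + (b + 1) - 1 - c = a + b - c := fun c => by ring
  unfold divDiff
  simp only [e1, e2]
  rcases h.eq_or_lt with rfl | h
  · have : Finset.Ico a (a + 1) = {a} := by ext; simp; omega
    simp [this]
  · have h1 : Finset.Ico a (b + 1) = insert a (insert b (Finset.Ico (a + 1) b)) := by
      ext; simp; omega
    rw [h1, Finset.sum_insert (by simp; omega), Finset.sum_insert (by simp),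
      Finset.Ico_eq_empty_of_le (show a + 1 ≤ b by omega),
      Finset.Ico_eq_empty_of_le (show a ≤ b + 1 by omega)]
    simp
    abel

theorem colored_add (j k : ℤ) (f g : ℤ × ℤ →₀ K) :
    colored n j k (f + g) = colored n j k f + colored n j k g := Finsupp.mapDomain_add

theorem colored_neg (j k : ℤ) (f : ℤ × ℤ →₀ K) :
    colored n j k (-f) = -colored n j k f :=
  (Finsupp.lmapDomain K K fun e : ℤ × ℤ => (idx n j e.1, idx n k e.2)).map_neg f

theorem colored_single (j k a b : ℤ) :
    colored n j k (Finsupp.single (a, b) (1 : K))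
      = Finsupp.single (idx n j a, idx n k b) 1 := Finsupp.mapDomain_single

theorem color_idx {j : ℤ} (h0 : 0 ≤ j) (h1 : j < n) (a : ℤ) : color n (idx n j a) = j := by
  unfold color idx
  rw [show j + 1 - a * n - 1 = j + n * (-a) by ring, Int.add_mul_emod_self_left,
    Int.emod_eq_of_lt h0 h1]

theorem zexp_idx {j : ℤ} (h0 : 0 ≤ j) (h1 : j < n) (a : ℤ) : zexp n (idx n j a) = a := by
  unfold zexp idx
  rw [show j + 1 - a * n - 1 = j + n * (-a) by ring, Int.add_mul_ediv_left _ _ (by omega),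
    Int.ediv_eq_zero_of_lt h0 h1]
  ring

/-- Every index is that of some `z^a v_{j+1}`. -/
theorem exists_idx (hn : 0 < n) (p : ℤ) : ∃ j a : ℤ, 0 ≤ j ∧ j < n ∧ p = idx n j a :=
  ⟨color n p, zexp n p, Int.emod_nonneg _ (by omega), Int.emod_lt_of_pos _ (by omega),
    (idx_color_zexp n p).symm⟩

theorem hecke₂_of_lt {j k : ℤ} (hj : 0 ≤ j) (hjk : j < k) (hk : k < n) (a b : ℤ) :
    hecke₂ q n (idx n j a, idx n k b) = -q • Finsupp.single (idx n k b, idx n j a) 1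
      - (q ^ 2 - 1) • colored n j k (divDiff K b (a + 1)) := by
  simp only [hecke₂, color_idx hj (hjk.trans hk), color_idx (hj.trans hjk.le) hk,
    zexp_idx hj (hjk.trans hk), zexp_idx (hj.trans hjk.le) hk, if_pos hjk]

theorem hecke₂_of_eq {j : ℤ} (hj : 0 ≤ j) (hk : j < n) (a b : ℤ) :
    hecke₂ q n (idx n j a, idx n j b) = -Finsupp.single (idx n j b, idx n j a) 1
      - (q ^ 2 - 1) • colored n j j
        (Finsupp.mapDomain (fun e : ℤ × ℤ => (e.1 + 1, e.2)) (divDiff K b a)) := by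
  simp only [hecke₂, color_idx hj hk, zexp_idx hj hk, lt_irrefl, if_false, if_true]

theorem hecke₂_of_gt {j k : ℤ} (hk : 0 ≤ k) (hkj : k < j) (hj : j < n) (a b : ℤ) :
    hecke₂ q n (idx n j a, idx n k b) = -q • Finsupp.single (idx n k b, idx n j a) 1
      - (q ^ 2 - 1) • colored n j k
        (Finsupp.mapDomain (fun e : ℤ × ℤ => (e.1 + 1, e.2)) (divDiff K b a)) := by
  simp only [hecke₂, color_idx hk (hkj.trans hj), color_idx (hk.trans hkj.le) hj,
    zexp_idx hk (hkj.trans hj), zexp_idx (hk.trans hkj.le) hj, if_neg hkj.not_gt, if_neg hkj.ne']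

/-- The map `φ`, thought of as `u_p ⊗ u_r ↦ φ p r` on `V(z) ⊗ V(z)`, vanishes on the kernel of
`T + 1`. The four-term combinations in the definition span this kernel, by
`isQAlt_heckeT_add_id` and `eq_zero_of_forall_lt`. -/
def IsQAlt {M : Type*} [AddCommGroup M] [Module K M] (q : K) (n : ℕ) (φ : ℤ → ℤ → M) : Prop :=
  ∀ c P R : ℤ, 0 ≤ c → c < n → (P : ZMod n) = R →
    φ (P + c) R + φ (R + c) P + q⁻¹ • (φ P (R + c) + φ R (P + c)) = 0

/-- The four-term combinations are eigenvectors of `T` with eigenvalue `-1`. -/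
theorem hecke₂_rel (hq0 : q ≠ 0) (hn : 0 < n) : IsQAlt q n fun p r =>
    hecke₂ q n (p, r) + Finsupp.single (p, r) 1 := by
  intro c P R hc hcn hPR
  obtain ⟨j, a, hj, hjn, rfl⟩ := exists_idx hn P
  obtain ⟨b, rfl⟩ : ∃ b, R = idx n j b := by
    rw [ZMod.intCast_eq_intCast_iff_dvd_sub] at hPR
    obtain ⟨d, hd⟩ := hPR
    refine ⟨a - d, ?_⟩
    unfold idx at *
    linarith
  have hmap : ∀ f : ℤ × ℤ →₀ K, Finsupp.mapDomain (fun e : ℤ × ℤ => (e.1 + 1, e.2)) (-f)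
      = -Finsupp.mapDomain (fun e : ℤ × ℤ => (e.1 + 1, e.2)) f :=
    (Finsupp.lmapDomain K K _).map_neg
  dsimp only
  -- The color of `P + c` is that of `P`, or larger, or smaller; in the last case adding `c` wraps
  -- around and lowers the exponent of `z`.
  rcases hc.eq_or_lt with rfl | hc
  · simp only [add_zero]
    rw [hecke₂_of_eq hj hjn, hecke₂_of_eq hj hjn, divDiff_antisymm b a, hmap, colored_neg]
    module
  rcases lt_or_ge (j + c) n with hk | hk
  · have e : ∀ x, idx n j x + c = idx n (j + c) x := fun x => by unfold idx; ring
    have hjk : j < j + c := by omega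
    have key := congrArg (colored n j (j + c)) (divDiff_succ_add (K := K) a b)
    simp only [colored_add, colored_neg, colored_single] at key
    rw [e, e, hecke₂_of_gt hj hjk hk, hecke₂_of_gt hj hjk hk, hecke₂_of_lt hj hjk hk,
      hecke₂_of_lt hj hjk hk, divDiff_antisymm b a, hmap, colored_neg, eq_sub_of_add_eq key]
    match_scalars <;> field_simp <;> ring
  · have e : ∀ x, idx n j x + c = idx n (j + c - n) (x - 1) := fun x => by unfold idx; ring
    have hjk : j + c - n < j := by omega
    have hk0 : 0 ≤ j + c - n := by omega
    obtain ⟨a, rfl⟩ : ∃ a', a = a' + 1 := ⟨a - 1, by ring⟩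
    obtain ⟨b, rfl⟩ : ∃ b', b = b' + 1 := ⟨b - 1, by ring⟩
    have key := congrArg (fun f => colored n j (j + c - n)
      (Finsupp.mapDomain (fun e : ℤ × ℤ => (e.1 + 1, e.2)) f)) (divDiff_succ_add (K := K) a b)
    simp only [colored_add, colored_neg, colored_single, Finsupp.mapDomain_add, hmap,
      Finsupp.mapDomain_single] at key
    rw [e, e]
    simp only [add_sub_cancel_right]
    rw [hecke₂_of_lt hk0 hjk hjn, hecke₂_of_lt hk0 hjk hjn, hecke₂_of_gt hk0 hjk hjn,
      hecke₂_of_gt hk0 hjk hjn, divDiff_antisymm (b + 1) (a + 1), colored_neg,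
      eq_sub_of_add_eq key]
    match_scalars <;> field_simp <;> ring

/-- For `p > r` the image `T (u_p ⊗ u_r)` has the leading term `u_r ⊗ u_p`: all other terms have
their first index larger than `r`. -/
theorem hecke₂_leading (hq0 : q ≠ 0) (hn : 0 < n) {p r : ℤ} (h : r < p) :
    hecke₂ q n (p, r) (r, p) ≠ 0 ∧
      ∀ x y : ℤ, x ≤ r → (x, y) ≠ (r, p) → hecke₂ q n (p, r) (x, y) = 0 := by
  have hcol : ∀ (j k : ℤ) (f : ℤ × ℤ →₀ K) (x y : ℤ),
      (∀ e ∈ f.support, (idx n j e.1, idx n k e.2) ≠ (x, y)) → colored n j k f (x, y) = 0 := by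
    intro j k f x y hf
    by_contra h0
    obtain ⟨e, he, hxy⟩ := Finset.mem_image.1
      (Finsupp.mapDomain_support (Finsupp.mem_support_iff.2 h0))
    exact hf e he hxy
  have hdd : ∀ {a b : ℤ}, a ≤ b → divDiff K b a
      = ∑ c ∈ Finset.Ico a b, Finsupp.single (c, b + a - 1 - c) (1 : K) := by
    intro a b hab
    unfold divDiff
    rw [Finset.Ico_eq_empty_of_le hab, Finset.sum_empty, sub_zero]
  have hsup : ∀ {a b : ℤ}, a ≤ b → ∀ e ∈ (divDiff K b a).support, a ≤ e.1 ∧ e.1 < b := by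
    intro a b hab e he
    rw [hdd hab] at he
    obtain ⟨c, hc, he⟩ := Finset.mem_biUnion.1 (Finsupp.support_finsetSum he)
    rw [Finsupp.mem_support_single] at he
    rw [he.1]
    simpa using hc
  have hsup1 : ∀ {a b : ℤ}, a ≤ b → ∀ e ∈ (Finsupp.mapDomain
      (fun e : ℤ × ℤ => (e.1 + 1, e.2)) (divDiff K b a)).support, a + 1 ≤ e.1 ∧ e.1 ≤ b := by
    intro a b hab e he
    obtain ⟨e', he', rfl⟩ := Finset.mem_image.1 (Finsupp.mapDomain_support he)
    have := hsup hab e' he'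
    constructor <;> dsimp only <;> omega
  have hn' : (0 : ℤ) < n := by omega
  obtain ⟨j, a, hj, hjn, rfl⟩ := exists_idx hn p
  obtain ⟨k, b, hk, hkn, rfl⟩ := exists_idx hn r
  have hab : k - j < (b - a) * n := by unfold idx at h; linarith
  rcases lt_trichotomy j k with hjk | rfl | hjk
  · have hab' : a + 1 ≤ b := by
      by_contra hc
      nlinarith [show b - a ≤ 0 by omega]
    have hz : ∀ x y : ℤ, x ≤ idx n k b →
        colored n j k (divDiff K b (a + 1)) (x, y) = 0 := by
      refine fun x y hx => hcol _ _ _ _ _ fun e he hxy => ?_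
      have h1 := hsup hab' e he
      rw [Prod.mk.injEq] at hxy
      rw [← hxy.1] at hx
      unfold idx at hx
      nlinarith [show (b - 1 - e.1) ≥ 0 by omega]
    rw [hecke₂_of_lt hj hjk hkn]
    refine ⟨?_, fun x y hx hne => ?_⟩
    · simp [hz _ _ le_rfl, hq0]
    · simp [hz _ _ hx, hne.symm]
  · have hab' : a < b := by
      by_contra hc
      nlinarith [show b - a ≤ 0 by omega]
    rw [hecke₂_of_eq hj hjn]
    have hinj : Function.Injective fun e : ℤ × ℤ => (idx n j e.1, idx n j e.2) := by
      intro e e' hee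
      have h1 := congrArg (zexp n) (Prod.mk.inj hee).1
      have h2 := congrArg (zexp n) (Prod.mk.inj hee).2
      simp only [zexp_idx hj hjn] at h1 h2
      exact Prod.ext h1 h2
    have hinj' : Function.Injective fun e : ℤ × ℤ => (e.1 + 1, e.2) := by
      intro e e' hee
      simp only [Prod.mk.injEq, add_left_inj] at hee
      exact Prod.ext hee.1 hee.2
    refine ⟨?_, fun x y hx hne => ?_⟩
    · -- For equal colors the quotient contributes to the leading term as well; the total
      -- coefficient is `-1 - (q² - 1) = -q²`.
      have h1 : colored n j j (Finsupp.mapDomain (fun e : ℤ × ℤ => (e.1 + 1, e.2))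
          (divDiff K b a)) (idx n j b, idx n j a) = 1 := by
        have e1 := Finsupp.mapDomain_apply hinj (Finsupp.mapDomain
          (fun e : ℤ × ℤ => (e.1 + 1, e.2)) (divDiff K b a)) (b, a)
        have e2 := Finsupp.mapDomain_apply hinj' (divDiff K b a) (b - 1, a)
        simp only [sub_add_cancel] at e2
        dsimp only at e1
        unfold colored
        rw [e1, e2, hdd hab'.le, Finsupp.finsetSum_apply, Finset.sum_eq_single (b - 1)]
        · rw [show b + a - 1 - (b - 1) = a by ring, Finsupp.single_eq_same]
        · intro c _ hc
          rw [Finsupp.single_apply, if_neg]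
          simp [hc]
        · intro hc
          simp at hc
          omega
      simp only [h1, Finsupp.sub_apply, Finsupp.neg_apply, Finsupp.single_eq_same,
        Finsupp.smul_apply, smul_eq_mul, mul_one]
      rw [show (-1 - (q ^ 2 - 1) : K) = -q ^ 2 by ring]
      exact neg_ne_zero.2 (pow_ne_zero 2 hq0)
    · rw [Finsupp.sub_apply, Finsupp.smul_apply, hcol, Finsupp.neg_apply, Finsupp.single_apply,
        if_neg hne.symm]
      · simp
      · intro e he hxy
        obtain ⟨e', he', rfl⟩ := Finset.mem_image.1 (Finsupp.mapDomain_support he)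
        have h1 := hsup hab'.le e' he'
        rw [Prod.mk.injEq] at hxy
        have hx' := hx
        rw [← hxy.1] at hx'
        unfold idx at hx'
        dsimp only at hx'
        have hb : e'.1 = b - 1 := by
          by_contra hc
          nlinarith [show (b - 2 - e'.1) ≥ 0 by omega]
        have h2 : e'.2 = a := by
          rw [hdd hab'.le] at he'
          obtain ⟨c, hc, he'⟩ := Finset.mem_biUnion.1 (Finsupp.support_finsetSum he')
          rw [Finsupp.mem_support_single] at he'
          rw [he'.1] at hb ⊢
          dsimp only at hb ⊢
          omega
        apply hne
        rw [← hxy.1, ← hxy.2]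
        dsimp only
        rw [hb, h2, sub_add_cancel]
  · have hab' : a ≤ b := by
      by_contra hc
      nlinarith [show b - a ≤ -1 by omega]
    have hz : ∀ x y : ℤ, x ≤ idx n k b → colored n j k (Finsupp.mapDomain
        (fun e : ℤ × ℤ => (e.1 + 1, e.2)) (divDiff K b a)) (x, y) = 0 := by
      refine fun x y hx => hcol _ _ _ _ _ fun e he hxy => ?_
      have h1 := hsup1 hab' e he
      rw [Prod.mk.injEq] at hxy
      rw [← hxy.1] at hx
      unfold idx at hx
      nlinarith [show (b - e.1) ≥ 0 by omega]
    rw [hecke₂_of_gt hk hjk hjn]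
    refine ⟨?_, fun x y hx hne => ?_⟩
    · simp [hz _ _ le_rfl, hq0]
    · simp [hz _ _ hx, hne.symm]

end TwoFactors

/-! ### Straightening -/

section Straightening

variable {K : Type*} [Field K] {q : K} {n : ℕ} {M : Type*} [AddCommGroup M] [Module K M]
  {φ : ℤ → ℤ → M}

/-- The case `c = 0` of the relations: factors with congruent indices anticommute. -/
theorem IsQAlt.swap (hφ : IsQAlt q n φ) (hq0 : q ≠ 0) (hq1 : q + 1 ≠ 0) (hn : 0 < n) {P R : ℤ}
    (h : (P : ZMod n) = R) : φ P R = -φ R P := by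
  have key := hφ 0 P R le_rfl (by omega) h
  simp only [add_zero] at key
  have h2 : (1 + q⁻¹) • (φ P R + φ R P) = 0 := by rw [← key]; module
  have h3 : 1 + q⁻¹ ≠ 0 := by
    intro h0
    apply hq1
    field_simp at h0
    linear_combination h0
  exact eq_neg_of_add_eq_zero_left ((smul_eq_zero.1 h2).resolve_left h3)

theorem IsQAlt.self [CharZero K] (hφ : IsQAlt q n φ) (hq0 : q ≠ 0) (hq1 : q + 1 ≠ 0) (hn : 0 < n)
    (P : ℤ) : φ P P = 0 := by
  have h := hφ.swap hq0 hq1 hn (rfl : (P : ZMod n) = P)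
  have h2 : (2 : K) • φ P P = 0 := by
    rw [two_smul]
    exact add_eq_zero_iff_eq_neg.2 h
  exact (smul_eq_zero.1 h2).resolve_left two_ne_zero

/-- Straightening: `u_p ∧ u_r` with `p ≤ r` is a combination of decreasing wedges whose indices
lie between `p` and `r`. -/
theorem IsQAlt.mem_span [CharZero K] (hφ : IsQAlt q n φ) (hq0 : q ≠ 0) (hq1 : q + 1 ≠ 0)
    (hn : 0 < n) (p r : ℤ) (h : p ≤ r) :
    φ p r ∈ Submodule.span K
      {x | ∃ p' r' : ℤ, p ≤ r' ∧ r' < p' ∧ p' ≤ r ∧ x = φ p' r'} := by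
  obtain ⟨N, hN⟩ : ∃ N : ℕ, r - p = N := ⟨(r - p).toNat, by omega⟩
  induction N using Nat.strong_induction_on generalizing p r with
  | _ N ih =>
    obtain ⟨c, d, hc0, hcn, hr⟩ : ∃ c d : ℤ, 0 ≤ c ∧ c < n ∧ r = p + n * d + c :=
      ⟨(r - p) % n, (r - p) / n, Int.emod_nonneg _ (by omega), Int.emod_lt_of_pos _ (by omega), by
        have := Int.emod_add_mul_ediv (r - p) n
        linarith⟩
    have hn' : (0 : ℤ) < n := by omega
    have hd : 0 ≤ d := by
      by_contra hd
      nlinarith [show d ≤ -1 by omega]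
    have hmem : ∀ p' r' : ℤ, p ≤ r' → r' < p' → p' ≤ r → φ p' r' ∈ Submodule.span K
        {x | ∃ p' r' : ℤ, p ≤ r' ∧ r' < p' ∧ p' ≤ r ∧ x = φ p' r'} :=
      fun p' r' h1 h2 h3 => Submodule.subset_span ⟨p', r', h1, h2, h3, rfl⟩
    have hcong : ((p : ℤ) : ZMod n) = ((p + n * d : ℤ) : ZMod n) := by simp
    -- The relation with `P = p`, `R = p + n d` expresses `φ p r` through two decreasing terms and
    -- `φ (p + c) (p + n d)`, whose indices are closer to each other.
    rcases hc0.eq_or_lt with rfl | hc0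
    · rw [add_zero] at hr
      subst hr
      rcases hd.eq_or_lt with rfl | hd
      · rw [mul_zero, add_zero, hφ.self hq0 hq1 hn]
        exact zero_mem _
      · rw [hφ.swap hq0 hq1 hn hcong]
        exact neg_mem (hmem _ _ le_rfl (by nlinarith) le_rfl)
    · have key := hφ c p (p + n * d) hc0.le hcn hcong
      rw [← hr] at key
      rcases hd.eq_or_lt with rfl | hd
      · rw [mul_zero, add_zero] at hr key
        rw [← hr] at key
        have h2 : (2 : K) • (φ r p + q⁻¹ • φ p r) = 0 := by rw [← key]; module
        have h3 := (smul_eq_zero.1 h2).resolve_left two_ne_zero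
        have h4 : φ p r = -q • φ r p := by
          rw [eq_neg_of_add_eq_zero_left h3, smul_neg, smul_smul, neg_mul, mul_inv_cancel₀ hq0]
          module
        rw [h4]
        exact Submodule.smul_mem _ _ (hmem _ _ le_rfl (by omega) le_rfl)
      · have hdn : c < n * d := by nlinarith [show 1 ≤ d by omega]
        have h4 : φ p r = -q • φ (p + c) (p + n * d) - q • φ r p - φ (p + n * d) (p + c) := by
          have h5 : φ p r = -q • φ (p + c) (p + n * d) - q • φ r p - φ (p + n * d) (p + c)
              + q • (φ (p + c) (p + n * d) + φ r p
                + q⁻¹ • (φ p r + φ (p + n * d) (p + c))) := by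
            match_scalars <;> field_simp <;> ring
          rw [key, smul_zero, add_zero] at h5
          exact h5
        rw [h4]
        refine sub_mem (sub_mem (Submodule.smul_mem _ _ ?_) (Submodule.smul_mem _ _ ?_)) ?_
        · refine Submodule.span_mono ?_ (ih (n * d - c).toNat (by omega) (p + c) (p + n * d)
            (by omega) (by omega))
          rintro x ⟨p', r', h1, h2, h3, rfl⟩
          exact ⟨p', r', by omega, h2, by omega, rfl⟩
        · exact hmem _ _ le_rfl (by omega) le_rfl
        · exact hmem _ _ (by omega) (by omega) (by omega)

end Straightening

/-! ### The relations of the Fock space -/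

section Relations

variable {K : Type*} [Field K] {q : K} {n : ℕ} {m : ℤ}

theorem State.ext {s t : State m} (h : ∀ k, s.1 k = t.1 k) : s = t := Subtype.ext (funext h)

theorem State.set_apply (s : State m) (i : ℕ) (p : ℤ) (k : ℕ) :
    (s.set i p).1 k = if k = i then p else s.1 k := by
  simp [State.set, Function.update_apply]

theorem State.set_set_self (s : State m) (i : ℕ) :
    (s.set i (s.1 i)).set (i + 1) (s.1 (i + 1)) = s :=
  State.ext fun k => by simp only [State.set_apply]; split_ifs <;> simp_all

theorem State.set_set_set_set (s : State m) (i : ℕ) (p r x y : ℤ) :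
    (((s.set i p).set (i + 1) r).set i x).set (i + 1) y = (s.set i x).set (i + 1) y :=
  State.ext fun k => by simp only [State.set_apply]; split_ifs <;> simp_all

theorem heckeT_single (i : ℕ) (s : State m) (p r : ℤ) :
    heckeT q n m i (Finsupp.single ((s.set i p).set (i + 1) r) 1)
      = Finsupp.mapDomain (fun x : ℤ × ℤ => (s.set i x.1).set (i + 1) x.2)
        (hecke₂ q n (p, r)) := by
  simp [heckeT, State.set_set_set_set, State.set_apply]

/-- The four-term combinations lie in the kernel of `T_i + 1`. -/
theorem isQAlt_heckeT_add_id (hq0 : q ≠ 0) (hn : 0 < n) (i : ℕ) (s : State m) :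
    IsQAlt q n fun p r => (heckeT q n m i + LinearMap.id : U K m →ₗ[K] U K m)
      (Finsupp.single ((s.set i p).set (i + 1) r) (1 : K)) := by
  intro c P R hc hcn hPR
  have key := congrArg
    (Finsupp.lmapDomain K K fun x : ℤ × ℤ => (s.set i x.1).set (i + 1) x.2)
    (hecke₂_rel hq0 hn c P R hc hcn hPR)
  simpa only [map_add, map_smul, map_zero, Finsupp.lmapDomain_apply, Finsupp.mapDomain_single,
    LinearMap.add_apply, heckeT_single, LinearMap.id_apply] using key

/-- No nonzero combination of decreasing tensors lies in the kernel of `T_i + 1`: by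
`hecke₂_leading`, the coefficient of `T_i w` at the transposition of a term `s` of `w` with least entry `s (i + 1)` is
a nonzero multiple of the coefficient of `w` at `s`. -/
theorem eq_zero_of_forall_lt (hq0 : q ≠ 0) (hn : 0 < n) (i : ℕ) (w : U K m)
    (hw : w ∈ LinearMap.ker (heckeT q n m i + LinearMap.id))
    (hord : ∀ s ∈ w.support, s.1 (i + 1) < s.1 i) : w = 0 := by
  by_contra h0
  obtain ⟨s, hs, hmin⟩ := w.support.exists_min_image (fun s => s.1 (i + 1))
    (Finsupp.support_nonempty_iff.2 h0)
  have hs' := hord s hs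
  set t := (s.set i (s.1 (i + 1))).set (i + 1) (s.1 i) with ht
  rw [LinearMap.mem_ker, LinearMap.add_apply, LinearMap.id_apply] at hw
  have hwt : w t = 0 := by
    by_contra h
    have := hord t (Finsupp.mem_support_iff.2 h)
    simp [ht, State.set_apply] at this
    omega
  have h1 : heckeT q n m i w t = 0 := by
    have := DFunLike.congr_fun hw t
    simpa [hwt] using this
  have hinj : ∀ s' : State m, Function.Injective
      fun x : ℤ × ℤ => (s'.set i x.1).set (i + 1) x.2 := by
    intro s' x y hxy
    have e1 := congrFun (congrArg Subtype.val hxy) i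
    have e2 := congrFun (congrArg Subtype.val hxy) (i + 1)
    simp only [State.set_apply] at e1 e2
    simp at e1 e2
    exact Prod.ext e1 e2
  have hlead := hecke₂_leading (q := q) (n := n) hq0 hn hs'
  have h2 : heckeT q n m i w t = w s * hecke₂ q n (s.1 i, s.1 (i + 1)) (s.1 (i + 1), s.1 i) := by
    rw [heckeT, Finsupp.linearCombination_apply, Finsupp.sum_apply, Finsupp.sum,
      Finset.sum_eq_single s]
    · rw [Finsupp.smul_apply, smul_eq_mul]
      congr 1
      exact Finsupp.mapDomain_apply (hinj s) _ (s.1 (i + 1), s.1 i)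
    · intro s' hs₁ hne
      rw [Finsupp.smul_apply]
      by_cases hrange : ∃ x : ℤ × ℤ, (s'.set i x.1).set (i + 1) x.2 = t
      · obtain ⟨x, hx⟩ := hrange
        have e0 : ∀ k, _ = _ := fun k => congrFun (congrArg Subtype.val hx) k
        simp only [ht, State.set_apply] at e0
        have e1 := e0 i
        have e2 := e0 (i + 1)
        simp at e1 e2
        rw [← hx, Finsupp.mapDomain_apply (hinj s') _ x,
          (hecke₂_leading (q := q) (n := n) hq0 hn (hord s' hs₁)).2 x.1 x.2
            (by rw [e1]; exact hmin s' hs₁), smul_zero]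
        intro hxs
        rw [Prod.mk.injEq, e1, e2] at hxs
        refine hne (State.ext fun k => ?_)
        have := e0 k
        split_ifs at this with hk1 hk2
        · rw [hk1, ← hxs.1]
        · rw [hk2, ← hxs.2]
        · exact this
      · rw [Finsupp.mapDomain_of_notMem_range, smul_zero]
        exact hrange
    · intro h
      rw [Finsupp.notMem_support_iff.1 h, zero_smul, Finsupp.zero_apply]
  rw [h2] at h1
  exact mul_ne_zero (Finsupp.mem_support_iff.1 hs) hlead.1 h1

/-- The kernels of the `T_i + 1` are spanned by the four-term combinations, so a linear map on
`U_(m)` that kills these combinations descends to `F_(m)`. Indeed straightening by four-term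
combinations leaves a remainder in the span of the decreasing tensors, and that remainder is zero
by `eq_zero_of_forall_lt`. -/
theorem kerSum_le_ker [CharZero K] (hq0 : q ≠ 0) (hq1 : q + 1 ≠ 0) (hn : 0 < n)
    {M : Type*} [AddCommGroup M] [Module K M] (f : U K m →ₗ[K] M)
    (hf : ∀ (i : ℕ) (s : State m),
      IsQAlt q n fun p r => f (Finsupp.single ((s.set i p).set (i + 1) r) 1)) :
    kerSum q n m ≤ LinearMap.ker f := by
  refine iSup_le fun i => ?_
  -- `N` contains the four-term combinations; `O` is spanned by the decreasing tensors.
  set N := LinearMap.ker f ⊓ LinearMap.ker (heckeT q n m i + LinearMap.id) with hN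
  set O : Submodule K (U K m) := Submodule.span K
    ((fun s => Finsupp.single s (1 : K)) '' {s : State m | s.1 (i + 1) < s.1 i}) with hO
  have htop : ∀ w : U K m, w ∈ N ⊔ O := by
    intro w
    induction w using Finsupp.induction_linear with
    | zero => exact zero_mem _
    | add a b ha hb => exact add_mem ha hb
    | single s x =>
      rw [← mul_one x, ← smul_eq_mul, ← Finsupp.smul_single]
      refine Submodule.smul_mem _ _ ?_
      rcases lt_or_ge (s.1 (i + 1)) (s.1 i) with h | h
      · exact Submodule.mem_sup_right (Submodule.subset_span ⟨s, h, rfl⟩)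
      · have hφ : IsQAlt q n fun p r =>
            N.mkQ (Finsupp.single ((s.set i p).set (i + 1) r) (1 : K)) := by
          intro c P R hc hcn hPR
          simp only [← map_add, ← map_smul]
          rw [Submodule.mkQ_apply, Submodule.Quotient.mk_eq_zero]
          refine ⟨?_, ?_⟩
          · have := hf i s c P R hc hcn hPR
            refine LinearMap.mem_ker.2 ?_
            simpa only [map_add, map_smul] using this
          · have := isQAlt_heckeT_add_id hq0 hn i s c P R hc hcn hPR
            refine LinearMap.mem_ker.2 ?_
            simpa only [map_add (heckeT q n m i + LinearMap.id : U K m →ₗ[K] U K m),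
              map_smul (heckeT q n m i + LinearMap.id : U K m →ₗ[K] U K m)] using this
        have h1 := hφ.mem_span hq0 hq1 hn _ _ h
        rw [State.set_set_self] at h1
        rw [← Submodule.comap_map_mkQ, Submodule.mem_comap]
        refine Submodule.span_le.2 ?_ h1
        rintro x ⟨p', r', -, hlt, -, rfl⟩
        refine Submodule.mem_map_of_mem (Submodule.subset_span ⟨_, ?_, rfl⟩)
        simpa [State.set_apply] using hlt
  intro w hw
  obtain ⟨a, ha, b, hb, rfl⟩ := Submodule.mem_sup.1 (htop w)
  have hbk : b ∈ LinearMap.ker (heckeT q n m i + LinearMap.id) := by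
    have := sub_mem hw ha.2
    rwa [add_sub_cancel_left] at this
  rw [eq_zero_of_forall_lt hq0 hn i b hbk, add_zero]
  · exact ha.1
  · intro s hs
    rw [hO, ← Finsupp.supported_eq_span_single, Finsupp.mem_supported] at hb
    exact hb hs

/-- The pure wedge `u_{s 0} ∧ u_{s 1} ∧ ⋯` in `F_(m)`. -/
def ket {K : Type*} [Field K] (q : K) (n : ℕ) {m : ℤ} (s : State m) : Fock q n m :=
  toFock q n m (Finsupp.single s 1)

theorem isQAlt_ket (hq0 : q ≠ 0) (hn : 0 < n) (i : ℕ) (s : State m) :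
    IsQAlt q n fun p r => ket q n ((s.set i p).set (i + 1) r) := by
  intro c P R hc hcn hPR
  simp only [ket, ← map_add, ← map_smul]
  rw [toFock, Submodule.mkQ_apply, Submodule.Quotient.mk_eq_zero]
  refine Submodule.mem_iSup_of_mem i ?_
  rw [LinearMap.mem_ker]
  simpa only [map_add (heckeT q n m i + LinearMap.id : U K m →ₗ[K] U K m),
    map_smul (heckeT q n m i + LinearMap.id : U K m →ₗ[K] U K m)] using
      isQAlt_heckeT_add_id hq0 hn i s c P R hc hcn hPR

end Relations

/-! ### Vanishing of pure wedges -/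

section Vanishing

variable {K : Type*} [Field K] {q : K} {n : ℕ} {m : ℤ}

theorem ket_eq_neg_swap (hq0 : q ≠ 0) (hq1 : q + 1 ≠ 0) (hn : 0 < n) (s : State m) (k : ℕ)
    (h : (s.1 k : ZMod n) = s.1 (k + 1)) :
    ket q n s = -ket q n ((s.set k (s.1 (k + 1))).set (k + 1) (s.1 k)) := by
  have := (isQAlt_ket hq0 hn k s).swap hq0 hq1 hn h
  rwa [State.set_set_self] at this

variable [CharZero K]

theorem ket_eq_zero_of_eq (hq0 : q ≠ 0) (hq1 : q + 1 ≠ 0) (hn : 0 < n) (s : State m) (k : ℕ)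
    (h : s.1 k = s.1 (k + 1)) : ket q n s = 0 := by
  have := (isQAlt_ket hq0 hn k s).self hq0 hq1 hn (s.1 k)
  nth_rewrite 2 [h] at this
  rwa [State.set_set_self] at this

/-- Straightening of the factors `k`, `k + 1` of a pure wedge. -/
theorem ket_mem_span (hq0 : q ≠ 0) (hq1 : q + 1 ≠ 0) (hn : 0 < n) (s : State m) (k : ℕ)
    (h : s.1 k ≤ s.1 (k + 1)) :
    ket q n s ∈ Submodule.span K {x | ∃ p r : ℤ, s.1 k ≤ r ∧ r < p ∧ p ≤ s.1 (k + 1) ∧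
      x = ket q n ((s.set k p).set (k + 1) r)} := by
  have := (isQAlt_ket hq0 hn k s).mem_span hq0 hq1 hn _ _ h
  rwa [State.set_set_self] at this

theorem ket_eq_zero_of_forall (hq0 : q ≠ 0) (hq1 : q + 1 ≠ 0) (hn : 0 < n) (s : State m) (k : ℕ)
    (h : s.1 k ≤ s.1 (k + 1)) (h' : ∀ p r : ℤ, s.1 k ≤ r → r < p → p ≤ s.1 (k + 1) →
      ket q n ((s.set k p).set (k + 1) r) = 0) : ket q n s = 0 := by
  have h1 := ket_mem_span hq0 hq1 hn s k h
  rw [← Submodule.mem_bot K]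
  refine Submodule.span_le.2 ?_ h1
  rintro x ⟨p, r, hr, hrp, hp, rfl⟩
  exact h' p r hr hrp hp

/-- `u_p ∧ u_M ∧ u_{M-1} ∧ ⋯ = 0` for `p ≤ M`. -/
theorem ket_eq_zero_of_tail (hq0 : q ≠ 0) (hq1 : q + 1 ≠ 0) (hn : 0 < n) (s : State m) (k : ℕ)
    (M : ℤ) (hk : s.1 k ≤ M) (hs : ∀ j : ℕ, s.1 (k + 1 + j) = M - j) : ket q n s = 0 := by
  obtain ⟨N, hN⟩ : ∃ N : ℕ, M - s.1 k = N := ⟨(M - s.1 k).toNat, by omega⟩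
  induction N using Nat.strong_induction_on generalizing s k M with
  | _ N ih =>
    have h0 := hs 0
    simp only [add_zero, Nat.cast_zero, sub_zero] at h0
    refine ket_eq_zero_of_forall hq0 hq1 hn s k (by omega) fun p r hr hrp hp => ?_
    refine ih (M - 1 - r).toNat (by omega) _ (k + 1) (M - 1) ?_ (fun j => ?_) ?_
    · simp [State.set_apply]; omega
    · have := hs (j + 1)
      rw [State.set_apply, State.set_apply, if_neg (by omega), if_neg (by omega),
        show k + 1 + 1 + j = k + 1 + (j + 1) by omega, this]
      push_cast
      ring
    · simp [State.set_apply]; omega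

/-- `u_r ∧ u_{r-1} ∧ ⋯ ∧ u_{r-e} ∧ u_r = 0`. -/
theorem ket_eq_zero_of_chain (hq0 : q ≠ 0) (hq1 : q + 1 ≠ 0) (hn : 0 < n) (e : ℕ) (s : State m)
    (k : ℕ) (r : ℤ) (hs : ∀ j : ℕ, j ≤ e → s.1 (k + j) = r - j) (hk : s.1 (k + e + 1) = r) :
    ket q n s = 0 := by
  induction e using Nat.strong_induction_on generalizing s k r with
  | _ e ih =>
    rcases Nat.eq_zero_or_pos e with rfl | he
    · have := hs 0 le_rfl
      refine ket_eq_zero_of_eq hq0 hq1 hn s k ?_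
      simp only [add_zero, Nat.cast_zero, sub_zero] at this hk
      rw [this, hk]
    · have h1 := hs e le_rfl
      refine ket_eq_zero_of_forall hq0 hq1 hn s (k + e) (by omega) fun p' r' hr hrp hp => ?_
      rw [hk] at hp
      obtain ⟨f, hf⟩ : ∃ f : ℕ, r - p' = f := ⟨(r - p').toNat, by omega⟩
      refine ih (e - 1 - f) (by omega) _ (k + f) p' (fun j hj => ?_) ?_
      · rw [State.set_apply, State.set_apply, if_neg (by omega), if_neg (by omega),
          show k + f + j = k + (f + j) by omega, hs (f + j) (by omega)]
        push_cast
        omega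
      · rw [State.set_apply, State.set_apply, if_neg (by omega), if_pos (by omega)]

/-- A wedge vanishes if an entry exceeds its vacuum value by `d`, and the `d` entries in front of
it have their vacuum values. -/
theorem ket_eq_zero_of_pos (hq0 : q ≠ 0) (hq1 : q + 1 ≠ 0) (hn : 0 < n) (s : State m) (k : ℕ)
    (d : ℤ) (hd : 0 < d) (hdk : d ≤ k) (hk : s.1 k = m - k + d)
    (hs : ∀ j : ℕ, j < k → k - d ≤ j → s.1 j = m - j) : ket q n s = 0 := by
  obtain ⟨e, rfl⟩ : ∃ e : ℕ, d = e + 1 := ⟨(d - 1).toNat, by omega⟩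
  obtain ⟨l, rfl⟩ : ∃ l : ℕ, k = l + e + 1 := ⟨k - e - 1, by omega⟩
  refine ket_eq_zero_of_chain hq0 hq1 hn e s l (m - l) (fun j hj => ?_) ?_
  · rw [hs _ (by omega) (by push_cast; omega)]
    push_cast
    ring
  · rw [hk]
    push_cast
    ring

/-- A wedge vanishes if an entry is smaller than its vacuum value, and all later entries have
their vacuum values. -/
theorem ket_eq_zero_of_neg (hq0 : q ≠ 0) (hq1 : q + 1 ≠ 0) (hn : 0 < n) (s : State m) (k : ℕ)
    (d : ℤ) (hd : d < 0) (hk : s.1 k = m - k + d)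
    (hs : ∀ j : ℕ, k < j → s.1 j = m - j) : ket q n s = 0 := by
  refine ket_eq_zero_of_tail hq0 hq1 hn s k (m - k - 1) (by omega) fun j => ?_
  rw [hs _ (by omega)]
  push_cast
  ring

end Vanishing

/-! ### Moving one entry, and induction over the Fock spaces -/

section Moves

/-- Add `d` to the `k`-th entry. -/
def State.move {m : ℤ} (k : ℕ) (d : ℤ) (s : State m) : State m := s.set k (s.1 k + d)

/-- The sequence without its first entry. -/
def State.tail {m : ℤ} (s : State (m + 1)) : State m :=
  ⟨fun k => s.1 (k + 1), by
    have h := s.2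
    rw [Filter.eventually_atTop] at h ⊢
    obtain ⟨N, hN⟩ := h
    refine ⟨N, fun k hk => ?_⟩
    have := hN (k + 1) (by omega)
    push_cast at this
    linarith⟩

variable {K : Type*} [Field K] {q : K} {n : ℕ} {m : ℤ}

theorem State.cons_tail (s : State (m + 1)) : State.cons (s.1 0) s.tail = s :=
  State.ext fun k => by cases k <;> rfl

@[simp] theorem State.cons_zero (p : ℤ) (s : State m) : (State.cons p s).1 0 = p := rfl

@[simp] theorem State.cons_succ (p : ℤ) (s : State m) (k : ℕ) :
    (State.cons p s).1 (k + 1) = s.1 k := rfl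

theorem State.vac_apply (k : ℕ) : (State.vac m).1 k = m - k := rfl

theorem State.cons_vac (m : ℤ) : State.cons (m + 1) (State.vac m) = State.vac (m + 1) :=
  State.ext fun k => by
    cases k with
    | zero => simp [State.vac_apply]
    | succ k => simp [State.vac_apply]

theorem State.move_apply (s : State m) (k : ℕ) (d : ℤ) (j : ℕ) :
    (s.move k d).1 j = if j = k then s.1 j + d else s.1 j := by
  rw [State.move, State.set_apply]
  split_ifs with h
  · rw [h]
  · rfl

theorem State.move_comm (s : State m) (k l : ℕ) (d e : ℤ) :
    (s.move k d).move l e = (s.move l e).move k d :=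
  State.ext fun j => by simp only [State.move_apply]; split_ifs <;> ring

theorem State.move_cons_zero (p d : ℤ) (s : State m) :
    (State.cons p s).move 0 d = State.cons (p + d) s :=
  State.ext fun j => by cases j <;> simp [State.move_apply]

theorem State.move_cons_succ (p d : ℤ) (k : ℕ) (s : State m) :
    (State.cons p s).move (k + 1) d = State.cons p (s.move k d) :=
  State.ext fun j => by cases j <;> simp [State.move_apply]

theorem ket_vac (m : ℤ) : ket q n (State.vac m) = vac q n m := rfl

theorem wedge_ket (p : ℤ) (s : State m) :
    wedge q n m (u K p) (ket q n s) = ket q n (State.cons p s) := by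
  simp [wedge, ket, toFock, tensor, u]

theorem wedge_vac (m : ℤ) : wedge q n m (u K (m + 1)) (vac q n m) = vac q n (m + 1) := by
  rw [← ket_vac, wedge_ket, State.cons_vac, ket_vac]

/-- Far out, moving one entry by `d ≠ 0` gives zero. -/
theorem ket_move_finite [CharZero K] (hq0 : q ≠ 0) (hq1 : q + 1 ≠ 0) (hn : 0 < n) (s : State m)
    {d : ℤ} (hd : d ≠ 0) : {k : ℕ | ket q n (s.move k d) ≠ 0}.Finite := by
  obtain ⟨N, hN⟩ := Filter.eventually_atTop.1 s.2
  refine (Set.finite_lt_nat (N + d.natAbs)).subset fun k hk => ?_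
  by_contra hlt
  rw [Set.mem_ofPred_eq, not_lt] at hlt
  refine hk ?_
  have hv : (s.move k d).1 k = m - k + d := by
    rw [State.move_apply, if_pos rfl, hN k (by omega)]
  have hv' : ∀ j, N ≤ j → j ≠ k → (s.move k d).1 j = m - j := fun j hj hjk => by
    rw [State.move_apply, if_neg hjk, hN j hj]
  rcases lt_or_gt_of_ne hd with h | h
  · exact ket_eq_zero_of_neg hq0 hq1 hn _ k d h hv fun j hj => hv' j (by omega) (by omega)
  · exact ket_eq_zero_of_pos hq0 hq1 hn _ k d h (by omega) hv
      fun j hj hj' => hv' j (by omega) (by omega)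

/-- The vectors of the Fock spaces are combinations of wedges
`u_{p_1} ∧ ⋯ ∧ u_{p_N} ∧ |m - N⟩`. -/
theorem fock_induction {P : ∀ m : ℤ, Fock q n m → Prop}
    (add : ∀ m w w', P m w → P m w' → P m (w + w'))
    (smul : ∀ m (c : K) w, P m w → P m (c • w))
    (vac : ∀ m, P m (vac q n m))
    (wedge : ∀ m p w, P m w → P (m + 1) (wedge q n m (u K p) w)) (m : ℤ) (w : Fock q n m) :
    P m w := by
  have hket : ∀ (N : ℕ) (m : ℤ) (s : State m), (∀ k, N ≤ k → s.1 k = m - k) →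
      P m (ket q n s) := by
    intro N
    induction N with
    | zero =>
      intro m s hs
      rw [show s = State.vac m from State.ext fun k => hs k (by omega)]
      exact vac m
    | succ N ih =>
      intro m s hs
      obtain ⟨m, rfl⟩ : ∃ m', m = m' + 1 := ⟨m - 1, by ring⟩
      rw [← State.cons_tail s, ← wedge_ket]
      refine wedge m _ _ (ih m _ fun k hk => ?_)
      have := hs (k + 1) (by omega)
      rw [State.tail]
      dsimp only
      rw [this]
      push_cast
      ring
  have htoFock : ∀ w : U K m, P m (toFock q n m w) := by
    intro w
    induction w using Finsupp.induction_linear with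
    | zero =>
      rw [map_zero, ← zero_smul K (QFock.vac q n m)]
      exact smul m 0 _ (vac m)
    | add a b ha hb => rw [map_add]; exact add m _ _ ha hb
    | single s x =>
      rw [← mul_one x, ← smul_eq_mul, ← Finsupp.smul_single, map_smul]
      obtain ⟨N, hN⟩ := Filter.eventually_atTop.1 s.2
      exact smul m x _ (hket N m s hN)
  obtain ⟨w, rfl⟩ := (kerSum q n m).mkQ_surjective w
  exact htoFock w

/-- Two families of linear maps on the Fock spaces agree if they agree on the vacua, and if
agreement at `w` implies agreement at `u_p ∧ w`. -/
theorem fock_ext {f g : ∀ m : ℤ, Module.End K (Fock q n m)}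
    (vac : ∀ m, f m (vac q n m) = g m (vac q n m))
    (wedge : ∀ m p w, f m w = g m w →
      f (m + 1) (wedge q n m (u K p) w) = g (m + 1) (wedge q n m (u K p) w)) : f = g := by
  funext m
  refine LinearMap.ext fun w => ?_
  refine fock_induction (P := fun m w => f m w = g m w) (fun m w w' h h' => ?_)
    (fun m c w h => ?_) vac wedge m w
  · rw [map_add, map_add, h, h']
  · rw [map_smul, map_smul, h]

theorem linearMap_ext_ket {M : Type*} [AddCommGroup M] [Module K M] {f g : Fock q n m →ₗ[K] M}
    (h : ∀ s : State m, f (ket q n s) = g (ket q n s)) : f = g := by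
  refine Submodule.linearMap_qext _ (Finsupp.lhom_ext' fun s => LinearMap.ext_ring ?_)
  exact h s

end Moves

/-! ### Operators on the Fock spaces given by a coproduct -/

section Operators

theorem finsum_nat_succ {M : Type*} [AddCommMonoid M] (f : ℕ → M)
    (hf : (Function.support f).Finite) : ∑ᶠ k, f k = f 0 + ∑ᶠ k, f (k + 1) := by
  obtain ⟨N, hN⟩ := hf.bddAbove
  have h1 : Function.support f ⊆ (Finset.range (N + 1 + 1) : Set ℕ) := fun k hk => by
    have := hN hk
    simp
    omega
  have h2 : (Function.support fun k => f (k + 1)) ⊆ (Finset.range (N + 1) : Set ℕ) :=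
    fun k hk => by
      have := hN (show k + 1 ∈ Function.support f from hk)
      simp
      omega
  rw [finsum_eq_sum_of_support_subset _ h1, finsum_eq_sum_of_support_subset _ h2,
    Finset.sum_range_succ', add_comm]

/-- A group-like diagonal operator: `u_p` is an eigenvector on `V(z)` with eigenvalue `val p`,
depending on `p` modulo `n` only, and `tot s` is the eigenvalue on the semi-infinite tensor with
entries `s`, a regularization of the infinite product of the `val (s k)`. -/
structure Weight (K : Type*) [Field K] (n : ℕ) where
  /-- The eigenvalue on `u_p`. -/
  val : ℤ → K
  /-- The eigenvalue on a semi-infinite tensor. -/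
  tot : ∀ {m : ℤ}, State m → K
  val_ne_zero : ∀ p, val p ≠ 0
  val_congr : ∀ p r : ℤ, (p : ZMod n) = r → val p = val r
  tot_cons : ∀ {m : ℤ} (p : ℤ) (s : State m), tot (State.cons p s) = val p * tot s

/-- The identity operator. -/
def Weight.one (K : Type*) [Field K] (n : ℕ) : Weight K n where
  val _ := 1
  tot _ := 1
  val_ne_zero _ := one_ne_zero
  val_congr _ _ _ := rfl
  tot_cons _ _ := (one_mul 1).symm

/-- The exponent of the eigenvalue of `K_i` on a semi-infinite tensor: the sum of the exponents of
its factors, each compared with the vacuum, corrected by the exponent `δ(m ≡ i)` of the vacuum. -/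
def totalWt (n : ℕ) (i : ZMod n) {m : ℤ} (s : State m) : ℤ :=
  (if (m : ZMod n) = i then 1 else 0) + ∑ᶠ k : ℕ, (wt n i (s.1 k) - wt n i (m - k))

theorem totalWt_vac (n : ℕ) (i : ZMod n) (m : ℤ) :
    totalWt n i (State.vac m) = if (m : ZMod n) = i then 1 else 0 := by
  simp [totalWt, State.vac_apply]

theorem totalWt_cons {n : ℕ} (i : ZMod n) {m : ℤ} (p : ℤ) (s : State m) :
    totalWt n i (State.cons p s) = wt n i p + totalWt n i s := by
  have hfin : (Function.support fun k : ℕ =>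
      wt n i ((State.cons p s).1 k) - wt n i (m + 1 - k)).Finite := by
    obtain ⟨N, hN⟩ := Filter.eventually_atTop.1 (State.cons p s).2
    refine (Set.finite_lt_nat N).subset fun k hk => ?_
    by_contra hlt
    exact hk (sub_eq_zero.2 (congrArg (wt n i) (hN k (not_lt.1 hlt))))
  unfold totalWt
  rw [finsum_nat_succ _ hfin]
  have e : ∀ k : ℕ, m + 1 - ((k + 1 : ℕ) : ℤ) = m - k := fun k => by push_cast; ring
  simp only [State.cons_zero, State.cons_succ, e, Nat.cast_zero, sub_zero]
  have : wt n i (m + 1) = (if ((m + 1 : ℤ) : ZMod n) = i then 1 else 0)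
      - (if (m : ZMod n) = i then 1 else 0) := by simp [wt]
  rw [this]
  ring

theorem wt_congr {n : ℕ} (i : ZMod n) {p r : ℤ} (h : (p : ZMod n) = r) :
    wt n i p = wt n i r := by
  unfold wt
  rw [h]

/-- The operator `K_i ^ e`. -/
def Weight.kpow {K : Type*} [Field K] {q : K} (hq0 : q ≠ 0) {n : ℕ} (i : ZMod n) (e : ℤ) :
    Weight K n where
  val p := q ^ (e * wt n i p)
  tot s := q ^ (e * totalWt n i s)
  val_ne_zero _ := zpow_ne_zero _ hq0
  val_congr p r h := by rw [wt_congr i h]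
  tot_cons p s := by rw [totalWt_cons, mul_add, zpow_add₀ hq0]

variable {K : Type*} [Field K] {q : K} {n : ℕ} {m : ℤ}

theorem IsQAlt.map {M N : Type*} [AddCommGroup M] [Module K M] [AddCommGroup N] [Module K N]
    {φ : ℤ → ℤ → M} (hφ : IsQAlt q n φ) (f : M →ₗ[K] N) : IsQAlt q n fun p r => f (φ p r) := by
  intro c P R hc hcn h
  simpa using congrArg f (hφ c P R hc hcn h)

theorem IsQAlt.add {M : Type*} [AddCommGroup M] [Module K M] {φ ψ : ℤ → ℤ → M}
    (hφ : IsQAlt q n φ) (hψ : IsQAlt q n ψ) : IsQAlt q n fun p r => φ p r + ψ p r := by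
  intro c P R hc hcn h
  have h1 := congrArg₂ (· + ·) (hφ c P R hc hcn h) (hψ c P R hc hcn h)
  dsimp only at h1 ⊢
  rw [add_zero] at h1
  rw [← h1]
  module

theorem IsQAlt.const_smul {M : Type*} [AddCommGroup M] [Module K M] {φ : ℤ → ℤ → M}
    (hφ : IsQAlt q n φ) (a : K) : IsQAlt q n fun p r => a • φ p r :=
  hφ.map (a • LinearMap.id)

theorem IsQAlt.mul_val {M : Type*} [AddCommGroup M] [Module K M] {φ : ℤ → ℤ → M}
    (hφ : IsQAlt q n φ) (g : Weight K n) :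
    IsQAlt q n fun p r => (g.val p * g.val r) • φ p r := by
  intro c P R hc hcn h
  have e1 : g.val R = g.val P := g.val_congr _ _ h.symm
  have e2 : g.val (R + c) = g.val (P + c) := g.val_congr _ _ (by push_cast; rw [h])
  have h1 := congrArg ((g.val P * g.val (P + c)) • ·) (hφ c P R hc hcn h)
  dsimp only at h1 ⊢
  rw [smul_zero] at h1
  rw [e1, e2, ← h1]
  module

theorem State.cons_set_zero_set_one (x z p r : ℤ) (t : State m) :
    ((State.cons x (State.cons z t)).set 0 p).set (0 + 1) r = State.cons p (State.cons r t) :=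
  State.ext fun k => by rcases k with _ | _ | k <;> simp [State.set_apply]

theorem isQAlt_cons (hq0 : q ≠ 0) (hn : 0 < n) (t : State m) :
    IsQAlt q n fun p r => ket q n (State.cons p (State.cons r t)) := by
  simpa only [State.cons_set_zero_set_one] using
    isQAlt_ket hq0 hn 0 (State.cons 0 (State.cons 0 t))

theorem isQAlt_wedge (hq0 : q ≠ 0) (hn : 0 < n) (w : Fock q n m) :
    IsQAlt q n fun p r => wedge q n (m + 1) (u K p) (wedge q n m (u K r) w) := by
  intro c P R hc hcn h
  have : ((wedge q n (m + 1) (u K (P + c)) ∘ₗ wedge q n m (u K R)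
      + wedge q n (m + 1) (u K (R + c)) ∘ₗ wedge q n m (u K P))
      + q⁻¹ • (wedge q n (m + 1) (u K P) ∘ₗ wedge q n m (u K (R + c))
      + wedge q n (m + 1) (u K R) ∘ₗ wedge q n m (u K (P + c)))) = 0 := by
    refine linearMap_ext_ket fun s => ?_
    have := isQAlt_cons hq0 hn s c P R hc hcn h
    simpa [wedge_ket] using this
  simpa using LinearMap.congr_fun this w

theorem State.exists_cons (s : State (m + 1)) : ∃ (p : ℤ) (t : State m), s = State.cons p t :=
  ⟨_, _, s.cons_tail.symm⟩

theorem State.exists_eq_add_one (m : ℤ) : ∃ m' : ℤ, m = m' + 1 := ⟨m - 1, by ring⟩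

/-- Group-like operators respect the relations of the Fock space. -/
theorem isQAlt_tot (hq0 : q ≠ 0) (hn : 0 < n) (g : Weight K n) (i : ℕ) (s : State m) :
    IsQAlt q n fun p r =>
      g.tot ((s.set i p).set (i + 1) r) • ket q n ((s.set i p).set (i + 1) r) := by
  induction i generalizing m s with
  | zero =>
    obtain ⟨m, rfl⟩ := State.exists_eq_add_one m
    obtain ⟨m, rfl⟩ := State.exists_eq_add_one m
    obtain ⟨x, s, rfl⟩ := s.exists_cons
    obtain ⟨z, s, rfl⟩ := s.exists_cons
    simp only [State.cons_set_zero_set_one, g.tot_cons]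
    have := ((isQAlt_cons hq0 hn s).mul_val g).const_smul (g.tot s)
    convert this using 3
    rw [smul_smul]
    congr 1
    ring
  | succ i ih =>
    obtain ⟨m, rfl⟩ := State.exists_eq_add_one m
    obtain ⟨x, s, rfl⟩ := s.exists_cons
    have := (ih s).map (g.val x • wedge q n m (u K x))
    simp only [State.cons_set_set, g.tot_cons]
    convert this using 3
    rw [map_smul, LinearMap.smul_apply, wedge_ket, smul_smul, mul_comm]

/-- The diagonal operator on `U_(m)` followed by the projection to `F_(m)`. -/
def Weight.diagU (q : K) (g : Weight K n) (m : ℤ) : U K m →ₗ[K] Fock q n m :=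
  Finsupp.linearCombination K fun s => g.tot s • ket q n s

open Classical in
/-- The diagonal operator on `F_(m)`. (The junk value `0` is taken if it is not well defined.) -/
def Weight.diag (q : K) (g : Weight K n) (m : ℤ) : Module.End K (Fock q n m) :=
  if h : kerSum q n m ≤ LinearMap.ker (g.diagU q m) then
    Submodule.liftQ _ (g.diagU q m) h else 0

/-- The condition that `A ⊗ R + L ⊗ A` preserves the kernel of `T + 1` in `V(z) ⊗ V(z)`, where `L`
and `R` are diagonal and `A u_p = α p • u_{p+d}`. -/
def PreservesQAlt (q : K) (n : ℕ) (L R : Weight K n) (d : ℤ) (α : ℤ → K) : Prop :=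
  ∀ {m : ℤ} {φ : ℤ → ℤ → Fock q n m}, IsQAlt q n φ →
    IsQAlt q n fun p r => (α p * R.val r) • φ (p + d) r + (L.val p * α r) • φ p (r + d)

/-- The coefficient of the sequence with the `k`-th entry moved in the action of
`∑ k, L ⊗ ⋯ ⊗ L ⊗ A ⊗ R ⊗ R ⊗ ⋯` on a pure tensor. The eigenvalue of `R` on the part behind the
`k`-th factor is written as a quotient. -/
def opCoef (L R : Weight K n) (α : ℤ → K) (s : State m) (k : ℕ) : K :=
  (∏ j ∈ Finset.range k, L.val (s.1 j) / R.val (s.1 j)) * (α (s.1 k) / R.val (s.1 k)) * R.tot s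

/-- The operator `∑ k, L ⊗ ⋯ ⊗ L ⊗ A ⊗ R ⊗ R ⊗ ⋯` on `U_(m)`, followed by the projection to
`F_(m)`, where `A u_p = α p • u_{p+d}`. Only after the projection is the sum finite. -/
def opU (q : K) (L R : Weight K n) (d : ℤ) (α : ℤ → K) (m : ℤ) : U K m →ₗ[K] Fock q n m :=
  Finsupp.linearCombination K fun s => ∑ᶠ k : ℕ, opCoef L R α s k • ket q n (s.move k d)

theorem opCoef_cons_zero (L R : Weight K n) (α : ℤ → K) (p : ℤ) (s : State m) :
    opCoef L R α (State.cons p s) 0 = α p * R.tot s := by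
  have := R.val_ne_zero p
  simp [opCoef, R.tot_cons]
  field_simp

theorem opCoef_cons_succ (L R : Weight K n) (α : ℤ → K) (p : ℤ) (s : State m) (k : ℕ) :
    opCoef L R α (State.cons p s) (k + 1) = L.val p * opCoef L R α s k := by
  have := R.val_ne_zero p
  simp only [opCoef, R.tot_cons, Finset.prod_range_succ', State.cons_zero, State.cons_succ]
  field_simp

open Classical in
/-- The operator `∑ k, L ⊗ ⋯ ⊗ L ⊗ A ⊗ R ⊗ R ⊗ ⋯` on `F_(m)`, where `A u_p = α p • u_{p+d}`. (The
junk value `0` is taken if it is not well defined.) -/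
def op (q : K) (L R : Weight K n) (d : ℤ) (α : ℤ → K) (m : ℤ) : Module.End K (Fock q n m) :=
  if h : kerSum q n m ≤ LinearMap.ker (opU q L R d α m) then
    Submodule.liftQ _ (opU q L R d α m) h else 0

variable [CharZero K] (hq0 : q ≠ 0) (hq1 : q + 1 ≠ 0) (hn : 0 < n)
include hq0 hq1 hn

theorem Weight.diag_ket (g : Weight K n) (s : State m) :
    g.diag q m (ket q n s) = g.tot s • ket q n s := by
  have h : kerSum q n m ≤ LinearMap.ker (g.diagU q m) :=
    kerSum_le_ker hq0 hq1 hn _ fun i s => by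
      simpa [Weight.diagU] using isQAlt_tot hq0 hn g i s
  rw [Weight.diag, dif_pos h]
  simp [ket, toFock, Weight.diagU]

theorem Weight.diag_wedge (g : Weight K n) (p : ℤ) (w : Fock q n m) :
    g.diag q (m + 1) (wedge q n m (u K p) w)
      = g.val p • wedge q n m (u K p) (g.diag q m w) := by
  have : g.diag q (m + 1) ∘ₗ wedge q n m (u K p)
      = g.val p • (wedge q n m (u K p) ∘ₗ g.diag q m) := by
    refine linearMap_ext_ket fun s => ?_
    simp [wedge_ket, g.diag_ket hq0 hq1 hn, g.tot_cons, smul_smul]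
  exact LinearMap.congr_fun this w

theorem opU_support_finite (L R : Weight K n) {d : ℤ} (hd : d ≠ 0) (α : ℤ → K) (s : State m) :
    (Function.support fun k : ℕ => opCoef L R α s k • ket q n (s.move k d)).Finite :=
  (ket_move_finite hq0 hq1 hn s hd).subset fun _ hk h => hk (by simp only [h, smul_zero])

theorem opU_cons (L R : Weight K n) {d : ℤ} (hd : d ≠ 0) (α : ℤ → K) (p : ℤ) (s : State m) :
    opU q L R d α (m + 1) (Finsupp.single (State.cons p s) 1)
      = (α p * R.tot s) • ket q n (State.cons (p + d) s)
        + L.val p • wedge q n m (u K p) (opU q L R d α m (Finsupp.single s 1)) := by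
  simp only [opU, Finsupp.linearCombination_single, one_smul]
  rw [finsum_nat_succ _ (opU_support_finite hq0 hq1 hn L R hd α _), opCoef_cons_zero,
    State.move_cons_zero, ← LinearMap.smul_apply,
    map_finsum _ (opU_support_finite hq0 hq1 hn L R hd α s)]
  congr 1
  refine finsum_congr fun k => ?_
  rw [opCoef_cons_succ, State.move_cons_succ, LinearMap.smul_apply, map_smul, wedge_ket, smul_smul]

/-- If `A ⊗ R + L ⊗ A` respects the relations in two factors, then `∑ k, L ⊗ ⋯ ⊗ L ⊗ A ⊗ R ⊗ ⋯`
respects the relations of the Fock space. -/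
theorem isQAlt_opU (L R : Weight K n) {d : ℤ} (hd : d ≠ 0) {α : ℤ → K}
    (hA : PreservesQAlt q n L R d α) (i : ℕ) (s : State m) :
    IsQAlt q n fun p r =>
      opU q L R d α m (Finsupp.single ((s.set i p).set (i + 1) r) 1) := by
  induction i generalizing m s with
  | zero =>
    obtain ⟨m, rfl⟩ := State.exists_eq_add_one m
    obtain ⟨m, rfl⟩ := State.exists_eq_add_one m
    obtain ⟨x, s, rfl⟩ := s.exists_cons
    obtain ⟨z, s, rfl⟩ := s.exists_cons
    simp only [State.cons_set_zero_set_one, opU_cons hq0 hq1 hn L R hd, R.tot_cons]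
    have h1 := (hA (isQAlt_cons hq0 hn s)).const_smul (R.tot s)
    have h2 := (isQAlt_wedge hq0 hn (opU q L R d α m (Finsupp.single s 1))).mul_val L
    convert h1.add h2 using 3
    simp only [map_add, map_smul, wedge_ket]
    module
  | succ i ih =>
    obtain ⟨m, rfl⟩ := State.exists_eq_add_one m
    obtain ⟨x, s, rfl⟩ := s.exists_cons
    simp only [State.cons_set_set, opU_cons hq0 hq1 hn L R hd]
    have h1 := (isQAlt_tot hq0 hn R i s).map (α x • wedge q n m (u K (x + d)))
    have h2 := (ih s).map (L.val x • wedge q n m (u K x))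
    convert h1.add h2 using 3
    simp only [map_smul, LinearMap.smul_apply, wedge_ket]
    module

theorem op_toFock (L R : Weight K n) {d : ℤ} (hd : d ≠ 0) {α : ℤ → K}
    (hA : PreservesQAlt q n L R d α) (w : U K m) :
    op q L R d α m (toFock q n m w) = opU q L R d α m w := by
  have h : kerSum q n m ≤ LinearMap.ker (opU q L R d α m) :=
    kerSum_le_ker hq0 hq1 hn _ fun i s => isQAlt_opU hq0 hq1 hn L R hd hA i s
  rw [op, dif_pos h]
  simp [toFock]

theorem op_ket (L R : Weight K n) {d : ℤ} (hd : d ≠ 0) {α : ℤ → K}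
    (hA : PreservesQAlt q n L R d α) (s : State m) :
    op q L R d α m (ket q n s) = ∑ᶠ k : ℕ, opCoef L R α s k • ket q n (s.move k d) := by
  rw [ket, op_toFock hq0 hq1 hn L R hd hA]
  simp [opU]

theorem op_wedge (L R : Weight K n) {d : ℤ} (hd : d ≠ 0) {α : ℤ → K}
    (hA : PreservesQAlt q n L R d α) (p : ℤ) (w : Fock q n m) :
    op q L R d α (m + 1) (wedge q n m (u K p) w)
      = α p • wedge q n m (u K (p + d)) (R.diag q m w)
        + L.val p • wedge q n m (u K p) (op q L R d α m w) := by
  have : op q L R d α (m + 1) ∘ₗ wedge q n m (u K p)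
      = α p • (wedge q n m (u K (p + d)) ∘ₗ R.diag q m)
        + L.val p • (wedge q n m (u K p) ∘ₗ op q L R d α m) := by
    refine linearMap_ext_ket fun s => ?_
    simp only [LinearMap.comp_apply, LinearMap.add_apply, LinearMap.smul_apply, wedge_ket,
      R.diag_ket hq0 hq1 hn, map_smul]
    simp only [ket]
    rw [op_toFock hq0 hq1 hn L R hd hA, op_toFock hq0 hq1 hn L R hd hA,
      opU_cons hq0 hq1 hn L R hd, smul_smul]
    rfl
  exact LinearMap.congr_fun this w

end Operators

/-! ### The operators `E_i`, `F_i`, `B_a` are compatible with the relations -/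

section Preserves

variable {K : Type*} [Field K] {q : K} {n : ℕ}

/-- The coefficient of `E_i` on `u_p`. -/
def coefE (K : Type*) [Field K] (n : ℕ) (i : ZMod n) (p : ℤ) : K :=
  if (p : ZMod n) = i + 1 then 1 else 0

/-- The coefficient of `F_i` on `u_p`. -/
def coefF (K : Type*) [Field K] (n : ℕ) (i : ZMod n) (p : ℤ) : K :=
  if (p : ZMod n) = i then 1 else 0

theorem one_ne_zero_of_two_le (hn : 2 ≤ n) : (1 : ZMod n) ≠ 0 := by
  have : Fact (1 < n) := ⟨hn⟩
  exact one_ne_zero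

theorem intCast_eq_zero_of_lt {c : ℤ} (h0 : 0 ≤ c) (h1 : c < n) (h : (c : ZMod n) = 0) :
    c = 0 := by
  rw [ZMod.intCast_zmod_eq_zero_iff_dvd] at h
  exact Int.eq_zero_of_dvd_of_nonneg_of_lt h0 h1 h

theorem intCast_eq_one_iff (hn : 2 ≤ n) {c : ℤ} (h0 : 0 ≤ c) (h1 : c < n) :
    (c : ZMod n) = 1 ↔ c = 1 := by
  refine ⟨fun h => ?_, fun h => by rw [h, Int.cast_one]⟩
  have h2 : ((c - 1 : ℤ) : ZMod n) = 0 := by push_cast; rw [h, sub_self]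
  rcases h0.eq_or_lt with rfl | h0
  · rw [Int.cast_zero] at h
    exact absurd h.symm (one_ne_zero_of_two_le hn)
  · have := intCast_eq_zero_of_lt (by omega) (by omega) h2
    omega

theorem intCast_add_one_eq_zero_iff {c : ℤ} (h0 : 0 ≤ c) (h1 : c < n) :
    (c : ZMod n) + 1 = 0 ↔ c + 1 = n := by
  refine ⟨fun h => ?_, fun h => ?_⟩
  · rcases (show c + 1 ≤ n from h1).eq_or_lt with h2 | h2
    · exact h2
    · have := intCast_eq_zero_of_lt (by omega) h2 (by push_cast; exact h)
      omega
  · have : ((c + 1 : ℤ) : ZMod n) = 0 := by rw [h]; simp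
    simpa using this

variable (hq0 : q ≠ 0) (hq1 : q + 1 ≠ 0) (hn : 2 ≤ n)
include hq0 hq1 hn

theorem preservesQAlt_E (i : ZMod n) :
    PreservesQAlt q n (Weight.one K n) (Weight.kpow hq0 i 1) (-1) (coefE K n i) := by
  intro m φ hφ c P R hc hcn hPR
  have h1 := one_ne_zero_of_two_le hn
  have eR : coefE K n i R = coefE K n i P := by unfold coefE; rw [hPR]
  have eRc : coefE K n i (R + c) = coefE K n i (P + c) := by unfold coefE; push_cast; rw [hPR]
  have wR : wt n i R = wt n i P := wt_congr i hPR.symm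
  have wRc : wt n i (R + c) = wt n i (P + c) := wt_congr i (by push_cast; rw [hPR])
  simp only [Weight.one, Weight.kpow, eR, eRc, wR, wRc, one_mul, ← sub_eq_add_neg]
  rcases hc.eq_or_lt with rfl | hc
  · simp only [add_zero]
    by_cases hp : (P : ZMod n) = i + 1
    · -- The result is `1 + q⁻¹` times the relation for `c = 1`.
      have w : wt n i P = -1 := by simp [wt, hp, h1]
      have key := hφ 1 (P - 1) (R - 1) (by omega) (by omega) (by push_cast; rw [hPR])
      simp only [sub_add_cancel] at key
      have key' := congrArg ((1 + q⁻¹) • ·) key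
      simp only [smul_zero] at key'
      rw [← key', w, coefE, if_pos hp, zpow_neg_one]
      module
    · simp [coefE, hp]
  -- `e1` and `e2` collect the terms in which `E_i` acts on an index congruent to `P + c` and to
  -- `P`: they are relations for `c - 1` and `c + 1`, or cancel in pairs by `IsQAlt.swap`.
  have e1 : ((P + c : ℤ) : ZMod n) = i + 1 → coefE K n i (P + c) • (q ^ wt n i P •
      (φ (P + c - 1) R + φ (R + c - 1) P) + q⁻¹ • (φ P (R + c - 1) + φ R (P + c - 1))) = 0 := by
    intro h
    push_cast at h
    by_cases hc1 : c = 1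
    · subst hc1
      have hp : (P : ZMod n) = i := by simpa using h
      have := hφ.swap hq0 hq1 (by omega) hPR
      simp only [add_sub_cancel_right]
      rw [this]
      module
    · have hp : (P : ZMod n) ≠ i := by
        rintro rfl
        exact hc1 ((intCast_eq_one_iff hn hc.le hcn).1 (by simpa using h))
      have hp' : (P : ZMod n) ≠ i + 1 := by
        intro hp
        rw [hp] at h
        have := intCast_eq_zero_of_lt hc.le hcn (by simpa using h)
        omega
      have w : wt n i P = 0 := by simp [wt, hp, hp']
      rw [w, zpow_zero, one_smul]
      have := hφ (c - 1) P R (by omega) (by omega) hPR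
      simp only [← add_sub_assoc] at this
      rw [this, smul_zero]
  have e2 : (P : ZMod n) = i + 1 → coefE K n i P • (φ (P + c) (R - 1) + φ (R + c) (P - 1)
      + (q⁻¹ * q ^ wt n i (P + c)) • (φ (P - 1) (R + c) + φ (R - 1) (P + c))) = 0 := by
    intro h
    have hpc : ((P + c : ℤ) : ZMod n) ≠ i + 1 := by
      intro h'
      push_cast at h'
      rw [h] at h'
      have := intCast_eq_zero_of_lt hc.le hcn (by simpa using h')
      omega
    by_cases hc1 : c + 1 = n
    · have hz := (intCast_add_one_eq_zero_iff hc.le hcn).2 hc1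
      have hpi : ((P + c : ℤ) : ZMod n) = i := by
        push_cast
        rw [h]
        linear_combination hz
      have w : wt n i (P + c) = 1 := by simp only [wt, if_pos hpi, if_neg hpc]; rfl
      rw [w, zpow_one, inv_mul_cancel₀ hq0, one_smul]
      have s1 := hφ.swap hq0 hq1 (by omega) (P := P + c) (R := R - 1)
        (by rw [hpi]; push_cast; rw [← hPR, h]; ring)
      have s2 := hφ.swap hq0 hq1 (by omega) (P := R + c) (R := P - 1)
        (by push_cast at hpi ⊢; rw [← hPR, hpi, h]; ring)
      rw [s1, s2]
      module
    · have hpi : ((P + c : ℤ) : ZMod n) ≠ i := by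
        intro h'
        push_cast at h'
        rw [h] at h'
        exact hc1 ((intCast_add_one_eq_zero_iff hc.le hcn).1 (by linear_combination h'))
      have w : wt n i (P + c) = 0 := by simp only [wt, if_neg hpi, if_neg hpc]; rfl
      have := hφ (c + 1) (P - 1) (R - 1) (by omega) (by omega) (by push_cast; rw [hPR])
      rw [show P - 1 + (c + 1) = P + c by ring, show R - 1 + (c + 1) = R + c by ring] at this
      rw [w, zpow_zero, mul_one, this, smul_zero]
  by_cases h1 : ((P + c : ℤ) : ZMod n) = i + 1
  · by_cases h2 : (P : ZMod n) = i + 1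
    · have := congrArg₂ (· + ·) (e1 h1) (e2 h2)
      simp only [add_zero] at this
      rw [← this]
      module
    · have h2' : coefE K n i P = 0 := if_neg h2
      rw [← e1 h1, h2']
      module
  · have h1' : coefE K n i (P + c) = 0 := if_neg h1
    by_cases h2 : (P : ZMod n) = i + 1
    · rw [← e2 h2, h1']
      module
    · have h2' : coefE K n i P = 0 := if_neg h2
      rw [h1', h2']
      module

theorem preservesQAlt_F (i : ZMod n) :
    PreservesQAlt q n (Weight.kpow hq0 i (-1)) (Weight.one K n) 1 (coefF K n i) := by
  intro m φ hφ c P R hc hcn hPR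
  have h1 := one_ne_zero_of_two_le hn
  have eR : coefF K n i R = coefF K n i P := by unfold coefF; rw [hPR]
  have eRc : coefF K n i (R + c) = coefF K n i (P + c) := by unfold coefF; push_cast; rw [hPR]
  have wR : wt n i R = wt n i P := wt_congr i hPR.symm
  have wRc : wt n i (R + c) = wt n i (P + c) := wt_congr i (by push_cast; rw [hPR])
  simp only [Weight.one, Weight.kpow, eR, eRc, wR, wRc, mul_one, neg_one_mul]
  rcases hc.eq_or_lt with rfl | hc
  · simp only [add_zero]
    by_cases hp : (P : ZMod n) = i
    · -- The result is `1 + q⁻¹` times the relation for `c = 1`.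
      have w : wt n i P = 1 := by simp [wt, hp, h1]
      have key := hφ 1 P R (by omega) (by omega) hPR
      have key' := congrArg ((1 + q⁻¹) • ·) key
      simp only [smul_zero] at key'
      rw [← key', w, coefF, if_pos hp, zpow_neg_one]
      module
    · simp [coefF, hp]
  -- `e1` and `e2` collect the terms in which `F_i` acts on an index congruent to `P + c` and to
  -- `P`: they are relations for `c + 1` and `c - 1`, or cancel in pairs by `IsQAlt.swap`.
  have e1 : ((P + c : ℤ) : ZMod n) = i → coefF K n i (P + c) •
      (φ (P + c + 1) R + φ (R + c + 1) P
        + (q⁻¹ * q ^ (-wt n i P)) • (φ P (R + c + 1) + φ R (P + c + 1))) = 0 := by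
    intro h
    have hp : (P : ZMod n) ≠ i := by
      rintro rfl
      push_cast at h
      have := intCast_eq_zero_of_lt hc.le hcn (by simpa using h)
      omega
    by_cases hc1 : c + 1 = n
    · have hz := (intCast_add_one_eq_zero_iff hc.le hcn).2 hc1
      have hp' : (P : ZMod n) = i + 1 := by
        push_cast at h
        linear_combination h - hz
      have w : wt n i P = -1 := by simp only [wt, if_pos hp', if_neg hp]; rfl
      rw [w, neg_neg, zpow_one, inv_mul_cancel₀ hq0, one_smul]
      have s1 := hφ.swap hq0 hq1 (by omega) (P := P + c + 1) (R := R)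
        (by push_cast; rw [← hPR]; linear_combination hz)
      have s2 := hφ.swap hq0 hq1 (by omega) (P := R + c + 1) (R := P)
        (by push_cast; rw [← hPR]; linear_combination hz)
      rw [s1, s2]
      module
    · have hp' : (P : ZMod n) ≠ i + 1 := by
        intro h'
        push_cast at h
        exact hc1 ((intCast_add_one_eq_zero_iff hc.le hcn).1 (by linear_combination h - h'))
      have w : wt n i P = 0 := by simp only [wt, if_neg hp', if_neg hp]; rfl
      have := hφ (c + 1) P R (by omega) (by omega) hPR
      simp only [← add_assoc] at this
      rw [w, neg_zero, zpow_zero, mul_one, this, smul_zero]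
  have e2 : (P : ZMod n) = i → coefF K n i P • (q ^ (-wt n i (P + c)) •
      (φ (P + c) (R + 1) + φ (R + c) (P + 1))
        + q⁻¹ • (φ (P + 1) (R + c) + φ (R + 1) (P + c))) = 0 := by
    intro h
    have hpc : ((P + c : ℤ) : ZMod n) ≠ i := by
      intro h'
      push_cast at h'
      rw [h] at h'
      have := intCast_eq_zero_of_lt hc.le hcn (by simpa using h')
      omega
    by_cases hc1 : c = 1
    · subst hc1
      have := hφ.swap hq0 hq1 (by omega) (P := P + 1) (R := R + 1) (by push_cast; rw [hPR])
      rw [this]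
      module
    · have hpc' : ((P + c : ℤ) : ZMod n) ≠ i + 1 := by
        intro h'
        push_cast at h'
        exact hc1 ((intCast_eq_one_iff hn hc.le hcn).1 (by linear_combination h' - h))
      have w : wt n i (P + c) = 0 := by simp only [wt, if_neg hpc', if_neg hpc]; rfl
      have := hφ (c - 1) (P + 1) (R + 1) (by omega) (by omega) (by push_cast; rw [hPR])
      rw [show P + 1 + (c - 1) = P + c by ring, show R + 1 + (c - 1) = R + c by ring] at this
      rw [w, neg_zero, zpow_zero, one_smul, this, smul_zero]
  by_cases h1 : ((P + c : ℤ) : ZMod n) = i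
  · by_cases h2 : (P : ZMod n) = i
    · have := congrArg₂ (· + ·) (e1 h1) (e2 h2)
      simp only [add_zero] at this
      rw [← this]
      module
    · have h2' : coefF K n i P = 0 := if_neg h2
      rw [← e1 h1, h2']
      module
  · have h1' : coefF K n i (P + c) = 0 := if_neg h1
    by_cases h2 : (P : ZMod n) = i
    · rw [← e2 h2, h1']
      module
    · have h2' : coefF K n i P = 0 := if_neg h2
      rw [h1', h2']
      module

omit hq0 hq1 hn in
theorem preservesQAlt_B {d : ℤ} (hd : (d : ZMod n) = 0) :
    PreservesQAlt q n (Weight.one K n) (Weight.one K n) d fun _ => 1 := by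
  intro m φ hφ c P R hc hcn hPR
  have h1 := hφ c (P + d) R hc hcn (by push_cast; rw [hd, add_zero, hPR])
  have h2 := hφ c P (R + d) hc hcn (by push_cast; rw [hd, add_zero, hPR])
  have := congrArg₂ (· + ·) h1 h2
  simp only [add_zero] at this
  simp only [Weight.one]
  rw [← this, show P + d + c = P + c + d by ring, show R + d + c = R + c + d by ring]
  module

end Preserves

open TensorProduct

/-! ### Coproducts -/

section Coproduct

variable {K : Type*} [Field K] {F : ℤ → Type*} [∀ m, AddCommGroup (F m)] [∀ m, Module K (F m)]

/-- The family `A ⊗ X` of operators on the spaces `V(z) ⊗ F m`. -/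
def tmap (A : Module.End K (Vz K)) (X : ∀ m, Module.End K (F m)) :
    ∀ m, Module.End K (Vz K ⊗[K] F m) :=
  fun m => TensorProduct.map A (X m)

theorem tmap_mul (A B : Module.End K (Vz K)) (X Y : ∀ m, Module.End K (F m)) :
    tmap A X * tmap B Y = tmap (A * B) (X * Y) :=
  funext fun m => (TensorProduct.map_mul A B (X m) (Y m)).symm

theorem tmap_smul_left (c : K) (A : Module.End K (Vz K)) (X : ∀ m, Module.End K (F m)) :
    tmap (c • A) X = c • tmap A X := funext fun m => TensorProduct.map_smul_left c A (X m)

theorem tmap_smul_right (c : K) (A : Module.End K (Vz K)) (X : ∀ m, Module.End K (F m)) :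
    tmap A (c • X) = c • tmap A X := funext fun m => TensorProduct.map_smul_right c A (X m)

theorem tmap_add_left (A B : Module.End K (Vz K)) (X : ∀ m, Module.End K (F m)) :
    tmap (A + B) X = tmap A X + tmap B X :=
  funext fun m => TensorProduct.map_add_left A B (X m)

theorem tmap_add_right (A : Module.End K (Vz K)) (X Y : ∀ m, Module.End K (F m)) :
    tmap A (X + Y) = tmap A X + tmap A Y :=
  funext fun m => TensorProduct.map_add_right A (X m) (Y m)

theorem tmap_zero_left (X : ∀ m, Module.End K (F m)) : tmap 0 X = 0 :=
  funext fun m => TensorProduct.map_zero_left (X m)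

/-- The family `D` of operators on the spaces `V(z) ⊗ F m` describes the action of `X` on wedges
`v ∧ w`: it is the image of `X` under a coproduct. -/
def IsCoproduct (W : ∀ m, Vz K ⊗[K] F m →ₗ[K] F (m + 1)) (X : ∀ m, Module.End K (F m))
    (D : ∀ m, Module.End K (Vz K ⊗[K] F m)) : Prop :=
  ∀ m, X (m + 1) ∘ₗ W m = W m ∘ₗ D m

variable {W : ∀ m, Vz K ⊗[K] F m →ₗ[K] F (m + 1)} {X Y : ∀ m, Module.End K (F m)}
  {D D' : ∀ m, Module.End K (Vz K ⊗[K] F m)}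

theorem IsCoproduct.mul (h : IsCoproduct W X D) (h' : IsCoproduct W Y D') :
    IsCoproduct W (X * Y) (D * D') := fun m => by
  have e1 : (X * Y) (m + 1) = X (m + 1) ∘ₗ Y (m + 1) := rfl
  have e2 : (D * D') m = D m ∘ₗ D' m := rfl
  rw [e1, e2, LinearMap.comp_assoc, h' m, ← LinearMap.comp_assoc, h m, LinearMap.comp_assoc]

theorem IsCoproduct.add (h : IsCoproduct W X D) (h' : IsCoproduct W Y D') :
    IsCoproduct W (X + Y) (D + D') := fun m => by
  simp only [Pi.add_apply, LinearMap.add_comp, LinearMap.comp_add, h m, h' m]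

theorem IsCoproduct.smul (h : IsCoproduct W X D) (c : K) :
    IsCoproduct W (c • X) (c • D) := fun m => by
  simp only [Pi.smul_apply, LinearMap.smul_comp, LinearMap.comp_smul, h m]

theorem IsCoproduct.one : IsCoproduct W 1 1 := fun _ => rfl

theorem IsCoproduct.pow (h : IsCoproduct W X D) (k : ℕ) : IsCoproduct W (X ^ k) (D ^ k) := by
  induction k with
  | zero => simpa using IsCoproduct.one
  | succ k ih => rw [pow_succ, pow_succ]; exact ih.mul h

theorem IsCoproduct.apply (h : IsCoproduct W X D) {m : ℤ} (v : Vz K) (w : F m) :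
    X (m + 1) (W m (v ⊗ₜ w)) = W m (D m (v ⊗ₜ w)) := LinearMap.congr_fun (h m) (v ⊗ₜ w)

theorem isCoproduct_of_forall
    (h : ∀ m p w, X (m + 1) (W m (u K p ⊗ₜ w)) = W m (D m (u K p ⊗ₜ w))) :
    IsCoproduct W X D := fun m =>
  TensorProduct.ext (Finsupp.lhom_ext' fun p => LinearMap.ext_ring (LinearMap.ext fun w =>
    h m p w))

end Coproduct

/-! ### Identities on the evaluation module -/

section Evaluation

variable {K : Type*} [Field K] {q : K} {n : ℕ}

theorem vz_ext {f g : Module.End K (Vz K)} (h : ∀ p, f (u K p) = g (u K p)) : f = g :=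
  Finsupp.lhom_ext' fun p => LinearMap.ext_ring (h p)

theorem evE_u (i : ZMod n) (p : ℤ) : evE K n i (u K p) = coefE K n i p • u K (p - 1) := by
  have : (((p - 1 : ℤ) : ZMod n) = i) ↔ ((p : ZMod n) = i + 1) := by
    push_cast
    exact sub_eq_iff_eq_add
  simp [evE, u, coefE, sub_eq_iff_eq_add]

theorem evF_u (i : ZMod n) (p : ℤ) : evF K n i (u K p) = coefF K n i p • u K (p + 1) := by
  simp [evF, u, coefF]

theorem evK_u (i : ZMod n) (p : ℤ) : evK q n i (u K p) = q ^ wt n i p • u K p := by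
  simp [evK, u]

theorem evKinv_u (i : ZMod n) (p : ℤ) : evKinv q n i (u K p) = q ^ (-wt n i p) • u K p := by
  simp [evKinv, u]

theorem coefF_of_ne {i : ZMod n} {p : ℤ} (h : (p : ZMod n) ≠ i) :
    coefF K n i p = 0 := if_neg h

theorem coefF_of_eq {i : ZMod n} {p : ℤ} (h : (p : ZMod n) = i) :
    coefF K n i p = 1 := if_pos h

theorem evKinv_comm (i j : ZMod n) :
    evKinv q n i * evKinv q n j = evKinv q n j * evKinv q n i := by
  refine vz_ext fun p => ?_
  simp only [Module.End.mul_apply, evKinv_u, map_smul]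
  rw [smul_comm]

/-- The formula covers `n = 2`, where `j + 1 = j - 1`. -/
theorem cartan_eq (hn : 2 ≤ n) (i j : ZMod n) : cartan n i j =
    2 * (if i = j then 1 else 0) - (if i = j + 1 then 1 else 0)
      - (if i = j - 1 then 1 else 0) := by
  have h1 := one_ne_zero_of_two_le hn
  have h2 : j + 1 = j - 1 ↔ n = 2 := by
    have e : j + 1 = j - 1 ↔ ((2 : ℕ) : ZMod n) = 0 := by
      constructor <;> intro h <;> push_cast at h ⊢ <;> linear_combination h
    rw [e, ZMod.natCast_eq_zero_iff]
    exact ⟨fun h => le_antisymm (Nat.le_of_dvd (by norm_num) h) hn, fun h => by rw [h]⟩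
  unfold cartan
  by_cases h : i = j
  · subst h
    have h3 : i ≠ i - 1 := fun h => h1 (by linear_combination h)
    simp [h1, h3]
  · by_cases hn2 : n = 2
    · simp only [if_neg h, ← h2.2 hn2, or_self, if_pos hn2]
      split_ifs <;> rfl
    · have h3 : j + 1 ≠ j - 1 := fun h' => hn2 (h2.1 h')
      rw [if_neg h, if_neg h, if_neg hn2]
      by_cases h4 : i = j + 1
      · rw [if_pos (Or.inl h4), if_pos h4, if_neg (h4 ▸ h3)]
        rfl
      · by_cases h5 : i = j - 1
        · rw [if_pos (Or.inr h5), if_neg h4, if_pos h5]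
          rfl
        · rw [if_neg (by tauto), if_neg h4, if_neg h5]
          rfl

theorem cartan_symm (hn : 2 ≤ n) (i j : ZMod n) : cartan n i j = cartan n j i := by
  have h1 : (i = j) ↔ (j = i) := eq_comm
  have h2 : (i = j + 1) ↔ (j = i - 1) := ⟨fun h => by rw [h]; ring, fun h => by rw [h]; ring⟩
  have h3 : (i = j - 1) ↔ (j = i + 1) := ⟨fun h => by rw [h]; ring, fun h => by rw [h]; ring⟩
  rw [cartan_eq hn, cartan_eq hn]
  simp only [h1, h2, h3]
  ring

theorem cartan_self (i : ZMod n) : cartan n i i = 2 := if_pos rfl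

theorem cartan_adjacent (hn : 2 ≤ n) {i j : ZMod n} (h : j = i + 1 ∨ j = i - 1) :
    cartan n i j = if n = 2 then -2 else -1 := by
  have h1 := one_ne_zero_of_two_le hn
  unfold cartan
  rw [if_neg, if_pos]
  · rcases h with rfl | rfl
    · exact Or.inr (by ring)
    · exact Or.inl (by ring)
  · rcases h with rfl | rfl
    · exact fun h => h1 (by linear_combination -h)
    · exact fun h => h1 (by linear_combination h)

theorem wt_add_one (hn : 2 ≤ n) (i : ZMod n) (p : ℤ) :
    wt n i (p + 1) = wt n i p - cartan n i p := by
  have h1 : (i = (p : ZMod n)) ↔ ((p : ZMod n) = i) := eq_comm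
  have h2 : (i = (p : ZMod n) + 1) ↔ ((p : ZMod n) + 1 = i) := eq_comm
  have h3 : (i = (p : ZMod n) - 1) ↔ ((p : ZMod n) = i + 1) :=
    ⟨fun h => by rw [h]; ring, fun h => by rw [h]; ring⟩
  rw [cartan_eq hn]
  unfold wt
  push_cast
  simp only [h1, h2, h3, add_left_inj]
  ring

theorem coefF_smul_congr {i : ZMod n} {p : ℤ} {M : Type*} [AddCommGroup M] [Module K M] {x y : M}
    (h : (p : ZMod n) = i → x = y) : coefF K n i p • x = coefF K n i p • y := by
  unfold coefF
  split_ifs with hp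
  · rw [h hp]
  · simp

theorem coefE_smul_congr {i : ZMod n} {p : ℤ} {M : Type*} [AddCommGroup M] [Module K M] {x y : M}
    (h : (p : ZMod n) = i + 1 → x = y) : coefE K n i p • x = coefE K n i p • y := by
  unfold coefE
  split_ifs with hp
  · rw [h hp]
  · simp

section

variable (hq0 : q ≠ 0) (hn : 2 ≤ n)
include hq0 hn

theorem evK_mul_evF (i j : ZMod n) :
    evK q n i * evF K n j = q ^ (-cartan n i j) • (evF K n j * evK q n i) := by
  refine vz_ext fun p => ?_
  simp only [Module.End.mul_apply, LinearMap.smul_apply, evF_u, evK_u, map_smul]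
  rw [smul_comm (q ^ wt n i p), smul_comm (q ^ (-cartan n i j))]
  refine coefF_smul_congr fun hp => ?_
  rw [smul_smul, ← zpow_add₀ hq0, wt_add_one hn, hp]
  congr 2
  ring

theorem evKinv_mul_evF (i j : ZMod n) :
    evKinv q n i * evF K n j = q ^ cartan n i j • (evF K n j * evKinv q n i) := by
  refine vz_ext fun p => ?_
  simp only [Module.End.mul_apply, LinearMap.smul_apply, evF_u, evKinv_u, map_smul]
  rw [smul_comm (q ^ (-wt n i p)), smul_comm (q ^ (cartan n i j))]
  refine coefF_smul_congr fun hp => ?_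
  rw [smul_smul, ← zpow_add₀ hq0, wt_add_one hn, hp]
  congr 2
  ring

theorem evK_mul_evE (i j : ZMod n) :
    evK q n i * evE K n j = q ^ cartan n i j • (evE K n j * evK q n i) := by
  refine vz_ext fun p => ?_
  simp only [Module.End.mul_apply, LinearMap.smul_apply, evE_u, evK_u, map_smul]
  rw [smul_comm (q ^ wt n i p), smul_comm (q ^ (cartan n i j))]
  refine coefE_smul_congr fun hp => ?_
  have h := wt_add_one hn i (p - 1)
  rw [sub_add_cancel, Int.cast_sub, hp, Int.cast_one, add_sub_cancel_right] at h
  rw [smul_smul, ← zpow_add₀ hq0, h]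
  congr 2
  ring

theorem evE_mul_evKinv (i j : ZMod n) :
    evE K n i * evKinv q n j = q ^ cartan n i j • (evKinv q n j * evE K n i) := by
  refine vz_ext fun p => ?_
  simp only [Module.End.mul_apply, LinearMap.smul_apply, evE_u, evKinv_u, map_smul]
  rw [smul_comm (q ^ (-wt n j p)), smul_comm (q ^ (cartan n i j))]
  refine coefE_smul_congr fun hp => ?_
  have h := wt_add_one hn j (p - 1)
  rw [sub_add_cancel, Int.cast_sub, hp, Int.cast_one, add_sub_cancel_right, cartan_symm hn] at h
  rw [smul_smul, ← zpow_add₀ hq0, h]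
  congr 2
  ring

omit hq0 in
theorem evE_mul_evF_same (hq2 : q - q⁻¹ ≠ 0) (i : ZMod n) :
    evE K n i * evF K n i
      = evF K n i * evE K n i + (q - q⁻¹)⁻¹ • (evK q n i + (-1 : K) • evKinv q n i) := by
  have h1 := one_ne_zero_of_two_le hn
  refine vz_ext fun p => ?_
  simp only [Module.End.mul_apply, LinearMap.smul_apply, LinearMap.add_apply, evE_u, evF_u, evK_u,
    evKinv_u, map_smul, add_sub_cancel_right, sub_add_cancel, smul_smul, ← add_smul]
  congr 1
  simp only [coefE, coefF, wt]
  push_cast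
  simp only [add_left_inj, sub_eq_iff_eq_add]
  by_cases hp : (p : ZMod n) = i
  · simp [hp, h1, ← sub_eq_add_neg, inv_mul_cancel₀ hq2]
  · by_cases hp' : (p : ZMod n) = i + 1
    · have e : (q - q⁻¹)⁻¹ * (q⁻¹ - q) = -1 := by
        rw [← neg_sub q q⁻¹, mul_neg, inv_mul_cancel₀ hq2]
      simp [hp', h1, ← sub_eq_add_neg, e]
    · simp [hp, hp']

end

theorem evE_mul_evF_of_ne {i j : ZMod n} (h : i ≠ j) : evE K n i * evF K n j = 0 := by
  refine vz_ext fun p => ?_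
  simp only [Module.End.mul_apply, evE_u, evF_u, map_smul, LinearMap.zero_apply]
  rw [coefF_smul_congr (y := 0), smul_zero]
  intro hp
  rw [coefE, if_neg, zero_smul]
  push_cast
  rw [hp, add_left_inj]
  exact h.symm

theorem evF_mul_evE_of_ne {i j : ZMod n} (h : i ≠ j) : evF K n j * evE K n i = 0 := by
  refine vz_ext fun p => ?_
  simp only [Module.End.mul_apply, evE_u, evF_u, map_smul, LinearMap.zero_apply]
  rw [coefE_smul_congr (y := 0), smul_zero]
  intro hp
  rw [coefF, if_neg, zero_smul]
  push_cast
  rw [hp, add_sub_cancel_right]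
  exact h

theorem evF_mul_evF_of_ne {i j : ZMod n} (h : i ≠ j + 1) : evF K n i * evF K n j = 0 := by
  refine vz_ext fun p => ?_
  simp only [Module.End.mul_apply, evF_u, map_smul, LinearMap.zero_apply]
  rw [coefF_smul_congr (y := 0), smul_zero]
  intro hp
  rw [coefF, if_neg, zero_smul]
  push_cast
  rw [hp]
  exact h.symm

theorem evE_mul_evE_of_ne {i j : ZMod n} (h : i ≠ j - 1) : evE K n i * evE K n j = 0 := by
  refine vz_ext fun p => ?_
  simp only [Module.End.mul_apply, evE_u, map_smul, LinearMap.zero_apply]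
  rw [coefE_smul_congr (y := 0), smul_zero]
  intro hp
  rw [coefE, if_neg, zero_smul]
  push_cast
  rw [hp, add_sub_cancel_right]
  exact fun h' => h (by rw [h']; ring)

theorem evF_mul_self (hn : 2 ≤ n) (i : ZMod n) : evF K n i * evF K n i = 0 :=
  evF_mul_evF_of_ne fun h => one_ne_zero_of_two_le hn (by linear_combination -h)

theorem evE_mul_self (hn : 2 ≤ n) (i : ZMod n) : evE K n i * evE K n i = 0 :=
  evE_mul_evE_of_ne fun h => one_ne_zero_of_two_le hn (by linear_combination h)

theorem add_one_ne_sub_one (hn : 2 < n) (i : ZMod n) : i + 1 ≠ i - 1 := by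
  intro h
  have : ((2 : ℕ) : ZMod n) = 0 := by push_cast; linear_combination h
  rw [ZMod.natCast_eq_zero_iff] at this
  exact absurd (Nat.le_of_dvd (by norm_num) this) (by omega)

theorem evF_mul_evF_mul_evF (hn : 2 < n) (i j : ZMod n) :
    evF K n i * (evF K n j * evF K n i) = 0 := by
  by_cases h : j = i + 1
  · rw [← mul_assoc, evF_mul_evF_of_ne, zero_mul]
    rw [h]
    exact fun h' => add_one_ne_sub_one hn i (by linear_combination -h')
  · rw [evF_mul_evF_of_ne h, mul_zero]

theorem evE_mul_evE_mul_evE (hn : 2 < n) (i j : ZMod n) :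
    evE K n i * (evE K n j * evE K n i) = 0 := by
  by_cases h : j = i - 1
  · rw [← mul_assoc, evE_mul_evE_of_ne, zero_mul]
    rw [h]
    exact fun h' => add_one_ne_sub_one hn i (by linear_combination h')
  · rw [evE_mul_evE_of_ne h, mul_zero]

end Evaluation

/-! ### `q`-commuting summands and the Serre relations -/

section Serre

variable {K : Type*} [Field K] {R : Type*} [Semiring R] [Algebra K R]

/-- The quadratic `q`-Serre expression. -/
def serre (q : K) (X Y : R) : R := X ^ 2 * Y + (-(q + q⁻¹)) • (X * Y * X) + Y * X ^ 2

/-- The cubic `q`-Serre expression. -/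
def serre₃ (q : K) (X Y : R) : R :=
  X ^ 3 * Y + (-qInt q 3) • (X ^ 2 * Y * X) + qInt q 3 • (X * Y * X ^ 2)
    + (-1 : K) • (Y * X ^ 3)

/-- If `X'`, `Y'` `q`-commute with `X`, `Y` as the two summands of a coproduct do, the mixed terms
of the Serre expression cancel. -/
theorem serre_add {q : K} (hq0 : q ≠ 0) {X X' Y Y' : R} (hX : X' * X = q ^ (2 : ℤ) • (X * X'))
    (hXY : X' * Y = q ^ (-1 : ℤ) • (Y * X')) (hYX : Y' * X = q ^ (-1 : ℤ) • (X * Y')) :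
    serre q (X + X') (Y + Y') = serre q X Y + serre q X' Y' := by
  have hX' : ∀ Z, X' * (X * Z) = q ^ (2 : ℤ) • (X * (X' * Z)) := fun Z => by
    rw [← mul_assoc, hX, smul_mul_assoc, mul_assoc]
  have hXY' : ∀ Z, X' * (Y * Z) = q ^ (-1 : ℤ) • (Y * (X' * Z)) := fun Z => by
    rw [← mul_assoc, hXY, smul_mul_assoc, mul_assoc]
  have hYX' : ∀ Z, Y' * (X * Z) = q ^ (-1 : ℤ) • (X * (Y' * Z)) := fun Z => by
    rw [← mul_assoc, hYX, smul_mul_assoc, mul_assoc]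
  simp only [serre, pow_two, add_mul, mul_add, mul_assoc, hX, hXY, hYX, hX', hXY', hYX',
    mul_smul_comm, smul_mul_assoc]
  match_scalars <;> field_simp <;> ring

theorem qInt_three {q : K} (hq0 : q ≠ 0) (hq2 : q - q⁻¹ ≠ 0) :
    qInt q 3 = q ^ 2 + 1 + q⁻¹ ^ 2 := by
  rw [qInt, div_eq_iff hq2]
  field_simp
  ring

/-- The analogue of `serre_add` for the cubic Serre expression. -/
theorem serre₃_add {q : K} (hq0 : q ≠ 0) (hq2 : q - q⁻¹ ≠ 0) {X X' Y Y' : R}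
    (hX : X' * X = q ^ (2 : ℤ) • (X * X')) (hXY : X' * Y = q ^ (-2 : ℤ) • (Y * X'))
    (hYX : Y' * X = q ^ (-2 : ℤ) • (X * Y')) :
    serre₃ q (X + X') (Y + Y') = serre₃ q X Y + serre₃ q X' Y' := by
  have hX' : ∀ Z, X' * (X * Z) = q ^ (2 : ℤ) • (X * (X' * Z)) := fun Z => by
    rw [← mul_assoc, hX, smul_mul_assoc, mul_assoc]
  have hXY' : ∀ Z, X' * (Y * Z) = q ^ (-2 : ℤ) • (Y * (X' * Z)) := fun Z => by
    rw [← mul_assoc, hXY, smul_mul_assoc, mul_assoc]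
  have hYX' : ∀ Z, Y' * (X * Z) = q ^ (-2 : ℤ) • (X * (Y' * Z)) := fun Z => by
    rw [← mul_assoc, hYX, smul_mul_assoc, mul_assoc]
  simp only [serre₃, qInt_three hq0 hq2, pow_succ, pow_zero, one_mul, add_mul, mul_add, mul_assoc,
    hX, hXY, hYX, hX', hXY', hYX', mul_smul_comm, smul_mul_assoc]
  match_scalars <;> field_simp <;> ring

variable {F : ℤ → Type*} [∀ m, AddCommGroup (F m)] [∀ m, Module K (F m)]
  {W : ∀ m, Vz K ⊗[K] F m →ₗ[K] F (m + 1)}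

theorem IsCoproduct.serre {X Y : ∀ m, Module.End K (F m)}
    {D D' : ∀ m, Module.End K (Vz K ⊗[K] F m)} (h : IsCoproduct W X D) (h' : IsCoproduct W Y D')
    (q : K) : IsCoproduct W (serre q X Y) (serre q D D') :=
  (((h.pow 2).mul h').add (((h.mul h').mul h).smul _)).add (h'.mul (h.pow 2))

theorem IsCoproduct.serre₃ {X Y : ∀ m, Module.End K (F m)}
    {D D' : ∀ m, Module.End K (Vz K ⊗[K] F m)} (h : IsCoproduct W X D) (h' : IsCoproduct W Y D')
    (q : K) : IsCoproduct W (serre₃ q X Y) (serre₃ q D D') :=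
  ((((h.pow 3).mul h').add ((((h.pow 2).mul h').mul h).smul _)).add
    (((h.mul h').mul (h.pow 2)).smul _)).add ((h'.mul (h.pow 3)).smul _)

end Serre

/-! ### The defining relations -/

theorem eq_smul_of_add_neg_smul {K M : Type*} [Field K] [AddCommGroup M] [Module K M] {x y : M}
    {c : K} (h : x + (-c) • y = 0) : x = c • y := by
  rw [eq_neg_of_add_eq_zero_left h, neg_smul, neg_neg]

/-- Operators `e i`, `f i`, `k i`, `kinv i` on spaces `F m` with vacua and wedge products, which
act on wedges through the coproduct and on the vacua by the highest weight formulas. The field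
`eq_zero` encodes that the `F m` are spanned by wedges of vectors of `V(z)` with a vacuum. -/
structure FockOps {K : Type*} [Field K] (q : K) (n : ℕ) {F : ℤ → Type*} [∀ m, AddCommGroup (F m)]
    [∀ m, Module K (F m)] (W : ∀ m, Vz K ⊗[K] F m →ₗ[K] F (m + 1)) (vac : ∀ m, F m) where
  /-- The action of `E_i`. -/
  e : ZMod n → ∀ m, Module.End K (F m)
  /-- The action of `F_i`. -/
  f : ZMod n → ∀ m, Module.End K (F m)
  /-- The action of `K_i`. -/
  k : ZMod n → ∀ m, Module.End K (F m)
  /-- The action of `K_i⁻¹`. -/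
  kinv : ZMod n → ∀ m, Module.End K (F m)
  k_mul_kinv : ∀ i, k i * kinv i = 1
  kinv_mul_k : ∀ i, kinv i * k i = 1
  k_comm : ∀ i j, k i * k j = k j * k i
  cop_e : ∀ i, IsCoproduct W (e i) (tmap (evE K n i) (k i) + tmap 1 (e i))
  cop_f : ∀ i, IsCoproduct W (f i) (tmap (evF K n i) 1 + tmap (evKinv q n i) (f i))
  cop_k : ∀ i, IsCoproduct W (k i) (tmap (evK q n i) (k i))
  cop_kinv : ∀ i, IsCoproduct W (kinv i) (tmap (evKinv q n i) (kinv i))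
  e_vac : ∀ i m, e i m (vac m) = 0
  f_vac : ∀ i m, f i (m + 1) (vac (m + 1))
    = coefF K n i (m + 1) • W m (u K (m + 1 + 1) ⊗ₜ vac m)
  k_vac : ∀ i m, k i m (vac m) = q ^ (if (m : ZMod n) = i then 1 else 0 : ℤ) • vac m
  kinv_vac : ∀ i m, kinv i m (vac m) = q ^ (-(if (m : ZMod n) = i then 1 else 0 : ℤ)) • vac m
  wedge_vac : ∀ m, W m (u K (m + 1) ⊗ₜ vac m) = vac (m + 1)
  wedge_self : ∀ m p w, W (m + 1) (u K p ⊗ₜ W m (u K p ⊗ₜ w)) = 0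
  eq_zero : ∀ (X : ∀ m, Module.End K (F m)) (A : Module.End K (Vz K)),
    IsCoproduct W X (tmap A X) → (∀ m, X (m + 1) (vac (m + 1)) = 0) → X = 0

namespace FockOps

variable {K : Type*} [Field K] {q : K} {n : ℕ} {F : ℤ → Type*} [∀ m, AddCommGroup (F m)]
  [∀ m, Module K (F m)] {W : ∀ m, Vz K ⊗[K] F m →ₗ[K] F (m + 1)} {vac : ∀ m, F m}
  (S : FockOps q n W vac)

theorem k_wedge (i : ZMod n) (m p : ℤ) (w : F m) : S.k i (m + 1) (W m (u K p ⊗ₜ w))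
    = q ^ wt n i p • W m (u K p ⊗ₜ S.k i m w) := by
  rw [(S.cop_k i).apply, tmap, TensorProduct.map_tmul, evK_u, ← smul_tmul', map_smul]

theorem e_wedge (i : ZMod n) (m p : ℤ) (w : F m) : S.e i (m + 1) (W m (u K p ⊗ₜ w))
    = coefE K n i p • W m (u K (p - 1) ⊗ₜ S.k i m w) + W m (u K p ⊗ₜ S.e i m w) := by
  rw [(S.cop_e i).apply, Pi.add_apply, LinearMap.add_apply, tmap, tmap, TensorProduct.map_tmul,
    TensorProduct.map_tmul, evE_u, ← smul_tmul', map_add, map_smul, Module.End.one_apply]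

theorem f_wedge (i : ZMod n) (m p : ℤ) (w : F m) : S.f i (m + 1) (W m (u K p ⊗ₜ w))
    = coefF K n i p • W m (u K (p + 1) ⊗ₜ w)
      + q ^ (-wt n i p) • W m (u K p ⊗ₜ S.f i m w) := by
  rw [(S.cop_f i).apply, Pi.add_apply, LinearMap.add_apply, tmap, tmap, TensorProduct.map_tmul,
    TensorProduct.map_tmul, evF_u, evKinv_u, ← smul_tmul', ← smul_tmul', map_add, map_smul,
    map_smul, Pi.one_apply, Module.End.one_apply]

section

variable (hq0 : q ≠ 0) (hn : 2 ≤ n)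
include hq0 hn

/-- The difference of the two sides acts on wedges through a single term `A ⊗ X` and kills the
vacua, so it vanishes. The other relations hold for the same reason. -/
theorem k_mul_e (i j : ZMod n) : S.k i * S.e j = q ^ cartan n i j • (S.e j * S.k i) := by
  refine eq_smul_of_add_neg_smul (S.eq_zero _ (evK q n i) ?_ fun m => ?_)
  · have h := ((S.cop_k i).mul (S.cop_e j)).add
      (((S.cop_e j).mul (S.cop_k i)).smul (-q ^ cartan n i j))
    convert h using 1
    simp only [mul_add, add_mul, tmap_mul, mul_one, one_mul, tmap_add_right, tmap_smul_right,
      tmap_smul_left, evK_mul_evE hq0 hn, S.k_comm i j]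
    module
  · simp only [Pi.add_apply, Pi.smul_apply, Pi.mul_apply, LinearMap.add_apply,
      LinearMap.smul_apply, Module.End.mul_apply, S.e_vac, S.k_vac, map_smul, map_zero, smul_zero,
      add_zero]

theorem k_mul_f (i j : ZMod n) : S.k i * S.f j = q ^ (-cartan n i j) • (S.f j * S.k i) := by
  refine eq_smul_of_add_neg_smul (S.eq_zero _ (evK q n i * evKinv q n j) ?_ fun m => ?_)
  · have h := ((S.cop_k i).mul (S.cop_f j)).add
      (((S.cop_f j).mul (S.cop_k i)).smul (-q ^ (-cartan n i j)))
    have hk : evKinv q n j * evK q n i = evK q n i * evKinv q n j := by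
      refine vz_ext fun p => ?_
      simp only [Module.End.mul_apply, evK_u, evKinv_u, map_smul]
      rw [smul_comm]
    convert h using 1
    simp only [mul_add, add_mul, tmap_mul, mul_one, one_mul, tmap_add_right, tmap_smul_right,
      tmap_smul_left, evK_mul_evF hq0 hn, hk]
    module
  · have hc : q ^ wt n i (m + 1 + 1) * q ^ (if (m : ZMod n) = i then 1 else 0 : ℤ)
        = q ^ (-cartan n i (m + 1 : ℤ))
          * q ^ (if ((m + 1 : ℤ) : ZMod n) = i then 1 else 0 : ℤ) := by
      rw [← zpow_add₀ hq0, ← zpow_add₀ hq0, wt_add_one hn]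
      have : wt n i (m + 1) = (if ((m + 1 : ℤ) : ZMod n) = i then 1 else 0)
        - (if (m : ZMod n) = i then 1 else 0) := by simp [wt]
      rw [this]
      congr 1
      ring
    simp only [Pi.add_apply, Pi.smul_apply, Pi.mul_apply, LinearMap.add_apply,
      LinearMap.smul_apply, Module.End.mul_apply, S.f_vac, S.k_vac, map_smul, S.k_wedge,
      tmul_smul]
    rw [smul_comm _ (coefF K n j (m + 1)), smul_comm _ (coefF K n j (m + 1)), ← smul_add]
    rw [coefF_smul_congr (y := 0), smul_zero]
    intro hj
    rw [smul_smul, smul_smul, hc, hj]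
    module

theorem e_mul_f_of_ne {i j : ZMod n} (hij : i ≠ j) : S.e i * S.f j - S.f j * S.e i = 0 := by
  have key : S.e i * S.f j + (-1 : K) • (S.f j * S.e i) = 0 := by
    refine S.eq_zero _ (evKinv q n j) ?_ fun m => ?_
    · have h := ((S.cop_e i).mul (S.cop_f j)).add
        (((S.cop_f j).mul (S.cop_e i)).smul (-1 : K))
      convert h using 1
      simp only [mul_add, add_mul, tmap_mul, mul_one, one_mul, tmap_add_right, tmap_smul_right,
        tmap_smul_left, evE_mul_evF_of_ne hij, evF_mul_evE_of_ne hij, tmap_zero_left,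
        evE_mul_evKinv hq0 hn, S.k_mul_f hq0 hn, smul_smul]
      rw [← zpow_add₀ hq0, neg_add_cancel, zpow_zero]
      module
    · simp only [Pi.add_apply, Pi.smul_apply, Pi.mul_apply, LinearMap.add_apply,
        LinearMap.smul_apply, Module.End.mul_apply, S.f_vac, S.e_vac, map_smul, S.e_wedge,
        map_zero, tmul_zero, smul_zero, add_zero]
      refine (coefF_smul_congr (y := 0) fun hj => ?_).trans (smul_zero _)
      rw [coefE, if_neg, zero_smul]
      rw [Int.cast_add, hj, Int.cast_one, add_left_inj]
      exact hij.symm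
  rw [eq_smul_of_add_neg_smul key, one_smul, sub_self]

theorem e_mul_f_same (hq2 : q - q⁻¹ ≠ 0) (i : ZMod n) :
    S.e i * S.f i - S.f i * S.e i = (q - q⁻¹)⁻¹ • (S.k i - S.kinv i) := by
  have h1 := one_ne_zero_of_two_le hn
  have key : (S.e i * S.f i + (-1 : K) • (S.f i * S.e i))
      + (-(q - q⁻¹)⁻¹) • (S.k i + (-1 : K) • S.kinv i) = 0 := by
    refine S.eq_zero _ (evKinv q n i) ?_ fun m => ?_
    · have h := (((S.cop_e i).mul (S.cop_f i)).add
        (((S.cop_f i).mul (S.cop_e i)).smul (-1 : K))).add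
        (((S.cop_k i).add ((S.cop_kinv i).smul (-1 : K))).smul (-(q - q⁻¹)⁻¹))
      convert h using 1
      simp only [mul_add, add_mul, tmap_mul, mul_one, one_mul, tmap_add_right, tmap_smul_right,
        tmap_smul_left, evE_mul_evF_same hn hq2, tmap_add_left, evE_mul_evKinv hq0 hn,
        S.k_mul_f hq0 hn, smul_smul]
      rw [← zpow_add₀ hq0, neg_add_cancel, zpow_zero]
      module
    · simp only [Pi.add_apply, Pi.smul_apply, Pi.mul_apply, LinearMap.add_apply,
        LinearMap.smul_apply, Module.End.mul_apply, S.f_vac, S.e_vac, map_smul, S.e_wedge,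
        map_zero, tmul_zero, smul_zero, add_zero, S.k_vac, S.kinv_vac, tmul_smul,
        add_sub_cancel_right, S.wedge_vac, smul_smul, ← add_smul]
      convert zero_smul K (vac (m + 1))
      by_cases h : ((m + 1 : ℤ) : ZMod n) = i
      · have h2 : (m : ZMod n) ≠ i := by
          rw [← h]
          push_cast
          intro h3
          exact h1 (by linear_combination -h3)
        have h3 : ((m + 1 + 1 : ℤ) : ZMod n) = i + 1 := by rw [Int.cast_add, h, Int.cast_one]
        rw [coefF, coefE, if_pos h, if_pos h3, if_neg h2, if_pos h]
        simp only [zpow_zero, zpow_one, zpow_neg]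
        linear_combination -(inv_mul_cancel₀ hq2)
      · rw [coefF, if_neg h, if_neg h]
        simp
  have h2 := eq_smul_of_add_neg_smul key
  rw [neg_one_smul, neg_one_smul, ← sub_eq_add_neg, ← sub_eq_add_neg] at h2
  exact h2

theorem e_comm {i j : ZMod n} (h₁ : i ≠ j + 1) (h₂ : i ≠ j - 1) :
    S.e i * S.e j = S.e j * S.e i := by
  by_cases hij : i = j
  · rw [hij]
  have hc : cartan n i j = 0 := by rw [cartan_eq hn, if_neg hij, if_neg h₁, if_neg h₂]; rfl
  have h₃ : j ≠ i - 1 := fun h => h₁ (by rw [h]; ring)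
  have key : S.e i * S.e j + (-1 : K) • (S.e j * S.e i) = 0 := by
    refine S.eq_zero _ 1 ?_ fun m => ?_
    · have h := ((S.cop_e i).mul (S.cop_e j)).add
        (((S.cop_e j).mul (S.cop_e i)).smul (-1 : K))
      convert h using 1
      have e1 := S.k_mul_e hq0 hn i j
      have e2 := S.k_mul_e hq0 hn j i
      rw [hc, zpow_zero, one_smul] at e1
      rw [cartan_symm hn, hc, zpow_zero, one_smul] at e2
      simp only [mul_add, add_mul, tmap_mul, mul_one, one_mul, tmap_add_right, tmap_smul_right,
        evE_mul_evE_of_ne h₂, evE_mul_evE_of_ne h₃, tmap_zero_left, e1, e2]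
      module
    · simp [S.e_vac]
  rw [eq_smul_of_add_neg_smul key, one_smul]

theorem f_comm {i j : ZMod n} (h₁ : i ≠ j + 1) (h₂ : i ≠ j - 1) :
    S.f i * S.f j = S.f j * S.f i := by
  by_cases hij : i = j
  · rw [hij]
  have h1 := one_ne_zero_of_two_le hn
  have hc : cartan n i j = 0 := by rw [cartan_eq hn, if_neg hij, if_neg h₁, if_neg h₂]; rfl
  have h₃ : j ≠ i + 1 := fun h => h₂ (by rw [h]; ring)
  have key : S.f i * S.f j + (-1 : K) • (S.f j * S.f i) = 0 := by
    refine S.eq_zero _ (evKinv q n i * evKinv q n j) ?_ fun m => ?_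
    · have h := ((S.cop_f i).mul (S.cop_f j)).add
        (((S.cop_f j).mul (S.cop_f i)).smul (-1 : K))
      convert h using 1
      have e1 := evKinv_mul_evF hq0 hn i j
      have e2 := evKinv_mul_evF hq0 hn j i
      rw [hc, zpow_zero, one_smul] at e1
      rw [cartan_symm hn, hc, zpow_zero, one_smul] at e2
      simp only [mul_add, add_mul, tmap_mul, mul_one, one_mul, tmap_add_right, tmap_smul_right,
        evF_mul_evF_of_ne h₁, evF_mul_evF_of_ne h₃, tmap_zero_left, e1, e2, evKinv_comm j i]
      module
    · obtain ⟨m, rfl⟩ := State.exists_eq_add_one m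
      have aux : ∀ i j : ZMod n, i ≠ j + 1 → i ≠ j - 1 →
          S.f i (m + 1 + 1) (S.f j (m + 1 + 1) (vac (m + 1 + 1))) = 0 := by
        intro i j h₁ h₂
        simp only [S.f_vac, map_smul, S.f_wedge, tmul_smul]
        refine (coefF_smul_congr (y := 0) fun hj => ?_).trans (smul_zero _)
        rw [coefF, if_neg, coefF, if_neg]
        · simp
        · rw [Int.cast_add, Int.cast_one] at hj
          exact fun h => h₂ (by rw [← h, ← hj]; ring)
        · rw [Int.cast_add, hj, Int.cast_one]
          exact h₁.symm
      have h₄ : j ≠ i - 1 := fun h => h₁ (by rw [h]; ring)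
      simp [aux i j h₁ h₂, aux j i h₃ h₄]
  rw [eq_smul_of_add_neg_smul key, one_smul]

end

theorem serre_e (hq0 : q ≠ 0) (hn : 2 < n) {i j : ZMod n} (h : j = i + 1 ∨ j = i - 1) :
    serre q (S.e i) (S.e j) = 0 := by
  have hc := cartan_adjacent hn.le h
  rw [if_neg (by omega)] at hc
  have hc' : cartan n j i = -1 := by rw [cartan_symm hn.le, hc]
  refine S.eq_zero _ 1 ?_ fun m => ?_
  · convert (S.cop_e i).serre (S.cop_e j) q using 1
    rw [add_comm (tmap (evE K n i) (S.k i)), add_comm (tmap (evE K n j) (S.k j)),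
      serre_add hq0 (X := tmap 1 (S.e i)) (X' := tmap (evE K n i) (S.k i))]
    · simp only [serre, pow_two, tmap_mul, mul_assoc, mul_one, evE_mul_self hn.le,
        evE_mul_evE_mul_evE hn, mul_zero, zero_mul, tmap_zero_left, smul_zero, add_zero,
        tmap_add_right, tmap_smul_right]
    · rw [tmap_mul, tmap_mul, S.k_mul_e hq0 hn.le, tmap_smul_right, cartan_self, mul_one, one_mul]
    · rw [tmap_mul, tmap_mul, S.k_mul_e hq0 hn.le, tmap_smul_right, hc, mul_one, one_mul]
    · rw [tmap_mul, tmap_mul, S.k_mul_e hq0 hn.le, tmap_smul_right, hc', mul_one, one_mul]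
  · simp [serre, pow_two, S.e_vac]

theorem serre₃_e (hq0 : q ≠ 0) (hq2 : q - q⁻¹ ≠ 0) (hn : n = 2) {i j : ZMod n}
    (h : j = i + 1 ∨ j = i - 1) : serre₃ q (S.e i) (S.e j) = 0 := by
  have hc := cartan_adjacent hn.ge h
  rw [if_pos hn] at hc
  have hc' : cartan n j i = -2 := by rw [cartan_symm hn.ge, hc]
  refine S.eq_zero _ 1 ?_ fun m => ?_
  · convert (S.cop_e i).serre₃ (S.cop_e j) q using 1
    rw [add_comm (tmap (evE K n i) (S.k i)), add_comm (tmap (evE K n j) (S.k j)),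
      serre₃_add hq0 hq2 (X := tmap 1 (S.e i)) (X' := tmap (evE K n i) (S.k i))]
    · simp only [serre₃, pow_succ, pow_zero, one_mul, tmap_mul, mul_assoc, mul_one,
        evE_mul_self hn.ge, mul_zero, zero_mul, tmap_zero_left, smul_zero, add_zero, tmap_add_right,
        tmap_smul_right]
    · rw [tmap_mul, tmap_mul, S.k_mul_e hq0 hn.ge, tmap_smul_right, cartan_self, mul_one, one_mul]
    · rw [tmap_mul, tmap_mul, S.k_mul_e hq0 hn.ge, tmap_smul_right, hc, mul_one, one_mul]
    · rw [tmap_mul, tmap_mul, S.k_mul_e hq0 hn.ge, tmap_smul_right, hc', mul_one, one_mul]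
  · simp [serre₃, pow_succ, S.e_vac]

end FockOps

/-! ### The Serre relations for the `F_i` -/

namespace FockOps

variable {K : Type*} [Field K] {q : K} {n : ℕ} {F : ℤ → Type*} [∀ m, AddCommGroup (F m)]
  [∀ m, Module K (F m)] {W : ∀ m, Vz K ⊗[K] F m →ₗ[K] F (m + 1)} {vac : ∀ m, F m}
  (S : FockOps q n W vac)

theorem f_vac_of_ne {i : ZMod n} {m : ℤ} (h : (m : ZMod n) ≠ i) : S.f i m (vac m) = 0 := by
  obtain ⟨m, rfl⟩ := State.exists_eq_add_one m
  rw [S.f_vac, coefF_of_ne h, zero_smul]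

theorem serre_f_vac (hn : 2 < n) {i j : ZMod n} (h : j = i + 1 ∨ j = i - 1) (m : ℤ) :
    serre q (S.f i) (S.f j) m (vac m) = 0 := by
  have h1 := one_ne_zero_of_two_le hn.le
  have h2 : (2 : ZMod n) ≠ 0 := fun h2 => add_one_ne_sub_one hn (0 : ZMod n) (by
    linear_combination h2)
  obtain ⟨m, rfl⟩ := State.exists_eq_add_one m
  obtain ⟨m, rfl⟩ := State.exists_eq_add_one m
  obtain ⟨m, rfl⟩ := State.exists_eq_add_one m
  have hij : i ≠ j := by
    rcases h with rfl | rfl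
    · exact fun h => h1 (by linear_combination -h)
    · exact fun h => h1 (by linear_combination h)
  have hs : ∀ (X Y : ∀ m, Module.End K (F m)) (m : ℤ) (v : F m), serre q X Y m v
      = X m (X m (Y m v)) + (-(q + q⁻¹)) • X m (Y m (X m v)) + Y m (X m (X m v)) :=
    fun X Y m v => by simp [serre, pow_two]
  -- On the vacuum, `F` with index congruent to `m + 3` raises the first factor, and all later
  -- factors contribute zero; the residues of the few indices that occur decide each case.
  rw [hs]
  by_cases hi : ((m + 1 + 1 + 1 : ℤ) : ZMod n) = i
  · have hj : ((m + 1 + 1 + 1 : ℤ) : ZMod n) ≠ j := hi ▸ hij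
    push_cast at hi
    have a0 : coefF K n i (m + 1) = 0 := coefF_of_ne fun h => h2 (by
      push_cast at h; linear_combination hi - h)
    have a1 : coefF K n i (m + 1 + 1) = 0 := coefF_of_ne fun h => h1 (by
      push_cast at h; linear_combination hi - h)
    have a2 : coefF K n i (m + 1 + 1 + 1) = 1 := coefF_of_eq (by push_cast; exact hi)
    have a3 : coefF K n i (m + 1 + 1 + 1 + 1) = 0 := coefF_of_ne fun h => h1 (by
      push_cast at h; linear_combination h - hi)
    have a4 : coefF K n i (m + 1 + 1 + 1 + 1 + 1) = 0 := coefF_of_ne fun h => h2 (by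
      push_cast at h; linear_combination h - hi)
    simp only [S.f_vac_of_ne hj, S.f_vac, S.f_wedge, map_add, map_smul, tmul_smul,
      tmul_zero, a0, a1, a2, a3, a4, zero_smul, smul_zero, add_zero, map_zero, one_smul,
      S.wedge_self]
  · by_cases hj : ((m + 1 + 1 + 1 : ℤ) : ZMod n) = j
    · push_cast at hj
      rcases h with rfl | rfl
      · have a1 : coefF K n i (m + 1 + 1) = 1 := coefF_of_eq (by
          push_cast; linear_combination hj)
        have a0 : coefF K n i (m + 1) = 0 := coefF_of_ne fun h => h1 (by
          push_cast at h; linear_combination hj - h)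
        have a2 : coefF K n i (m + 1 + 1 + 1) = 0 := coefF_of_ne hi
        have a3 : coefF K n i (m + 1 + 1 + 1 + 1) = 0 := coefF_of_ne fun h => h2 (by
          push_cast at h; linear_combination h - hj)
        simp only [S.f_vac_of_ne hi, S.f_vac, S.f_wedge, map_smul,
          tmul_zero, a0, a1, a2, a3, zero_smul, smul_zero, add_zero, map_zero, one_smul, zero_add]
      · have a3 : coefF K n i (m + 1 + 1 + 1 + 1) = 1 := coefF_of_eq (by
          push_cast; linear_combination hj)
        have a1 : coefF K n i (m + 1 + 1) = 0 := coefF_of_ne fun h => h2 (by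
          push_cast at h; linear_combination hj - h)
        have a4 : coefF K n i (m + 1 + 1 + 1 + 1 + 1) = 0 := coefF_of_ne fun h => h1 (by
          push_cast at h; linear_combination h - hj)
        simp only [S.f_vac_of_ne hi, S.f_vac, S.f_wedge, map_smul,
          tmul_zero, a1, a3, a4, zero_smul, smul_zero, add_zero, map_zero, one_smul]
    · simp only [S.f_vac_of_ne hi, S.f_vac_of_ne hj, map_zero, smul_zero, add_zero]

theorem serre₃_f_vac (hn : n = 2) {i j : ZMod n} (h : j = i + 1 ∨ j = i - 1) (m : ℤ) :
    serre₃ q (S.f i) (S.f j) m (vac m) = 0 := by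
  have h1 := one_ne_zero_of_two_le hn.ge
  have h2 : (2 : ZMod n) = 0 := by subst hn; rfl
  obtain rfl : j = i + 1 := by
    rcases h with rfl | rfl
    · rfl
    · linear_combination -h2
  obtain ⟨m, rfl⟩ := State.exists_eq_add_one m
  obtain ⟨m, rfl⟩ := State.exists_eq_add_one m
  obtain ⟨m, rfl⟩ := State.exists_eq_add_one m
  obtain ⟨m, rfl⟩ := State.exists_eq_add_one m
  have hs : ∀ (X Y : ∀ m, Module.End K (F m)) (m : ℤ) (v : F m), serre₃ q X Y m v
      = X m (X m (X m (Y m v))) + (-qInt q 3) • X m (X m (Y m (X m v)))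
        + qInt q 3 • X m (Y m (X m (X m v))) + (-1 : K) • Y m (X m (X m (X m v))) :=
    fun X Y m v => by simp [serre₃, pow_succ]
  have hodd : ∀ x : ℤ, (x : ZMod n) ≠ i → (x : ZMod n) = i + 1 := by
    subst hn
    intro x
    generalize (x : ZMod 2) = y
    revert y i
    decide
  have hne : ∀ x : ℤ, (x : ZMod n) = i → ((x + 1 : ℤ) : ZMod n) ≠ i := fun x hx h => h1 (by
    push_cast at h; linear_combination h - hx)
  have heq : ∀ x : ℤ, (x : ZMod n) ≠ i → ((x + 1 : ℤ) : ZMod n) = i := fun x hx => by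
    push_cast; linear_combination hodd x hx + h2
  -- The residues of the indices alternate between `i` and `i + 1`, which decides each case.
  rw [hs]
  by_cases h0 : (m : ZMod n) = i
  · have g1 := hne _ h0
    have g2 := heq _ g1
    have g3 := hne _ g2
    have g4 := heq _ g3
    have g5 := hne _ g4
    have g6 := heq _ g5
    have hj : ((m + 1 + 1 + 1 + 1 : ℤ) : ZMod n) ≠ i + 1 := fun h => h1 (by
      rw [g4] at h
      linear_combination -h)
    have g7 := hne _ g6
    simp only [S.f_vac_of_ne hj, S.f_vac, S.f_wedge, map_add, map_smul, tmul_add, tmul_smul,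
      tmul_zero, coefF_of_ne g1, coefF_of_eq g2, coefF_of_ne g3, coefF_of_eq g4, coefF_of_ne g5,
      coefF_of_eq g6, coefF_of_ne g7, zero_smul, smul_zero,
      add_zero, map_zero, one_smul, zero_add, S.wedge_self]
  · have g1 := heq _ h0
    have g2 := hne _ g1
    have g3 := heq _ g2
    have g4 := hne _ g3
    have g5 := heq _ g4
    have g6 := hne _ g5
    simp only [S.f_vac_of_ne g4, S.f_vac, S.f_wedge, map_add, map_smul,
      tmul_zero, coefF_of_ne g2, coefF_of_eq g3, coefF_of_ne g4, coefF_of_eq g5,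
      coefF_of_ne g6, zero_smul, smul_zero,
      add_zero, map_zero, one_smul, zero_add]

theorem serre_f (hq0 : q ≠ 0) (hn : 2 < n) {i j : ZMod n} (h : j = i + 1 ∨ j = i - 1) :
    serre q (S.f i) (S.f j) = 0 := by
  have hc := cartan_adjacent hn.le h
  rw [if_neg (by omega)] at hc
  have hc' : cartan n j i = -1 := by rw [cartan_symm hn.le, hc]
  refine S.eq_zero _ (evKinv q n i * (evKinv q n i * evKinv q n j)) ?_
    fun m => S.serre_f_vac hn h _
  convert (S.cop_f i).serre (S.cop_f j) q using 1
  rw [serre_add hq0 (X := tmap (evF K n i) 1) (X' := tmap (evKinv q n i) (S.f i))]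
  · have hk : ∀ Z : Module.End K (Vz K), evKinv q n j * (evKinv q n i * Z)
        = evKinv q n i * (evKinv q n j * Z) := fun Z => by
      rw [← mul_assoc, evKinv_comm j i, mul_assoc]
    simp only [serre, pow_two, tmap_mul, mul_assoc, mul_one, evF_mul_self hn.le,
      evF_mul_evF_mul_evF hn, mul_zero, tmap_zero_left, smul_zero, zero_add, tmap_add_right,
      tmap_smul_right, evKinv_comm j i, hk, zero_mul]
  · rw [tmap_mul, tmap_mul, evKinv_mul_evF hq0 hn.le, tmap_smul_left, cartan_self, mul_one,
      one_mul]
  · rw [tmap_mul, tmap_mul, evKinv_mul_evF hq0 hn.le, tmap_smul_left, hc, mul_one, one_mul]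
  · rw [tmap_mul, tmap_mul, evKinv_mul_evF hq0 hn.le, tmap_smul_left, hc', mul_one, one_mul]

theorem serre₃_f (hq0 : q ≠ 0) (hq2 : q - q⁻¹ ≠ 0) (hn : n = 2) {i j : ZMod n}
    (h : j = i + 1 ∨ j = i - 1) : serre₃ q (S.f i) (S.f j) = 0 := by
  have hc := cartan_adjacent hn.ge h
  rw [if_pos hn] at hc
  have hc' : cartan n j i = -2 := by rw [cartan_symm hn.ge, hc]
  refine S.eq_zero _ (evKinv q n i * (evKinv q n i * (evKinv q n i * evKinv q n j))) ?_
    fun m => S.serre₃_f_vac hn h _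
  convert (S.cop_f i).serre₃ (S.cop_f j) q using 1
  rw [serre₃_add hq0 hq2 (X := tmap (evF K n i) 1) (X' := tmap (evKinv q n i) (S.f i))]
  · have hk : ∀ Z : Module.End K (Vz K), evKinv q n j * (evKinv q n i * Z)
        = evKinv q n i * (evKinv q n j * Z) := fun Z => by
      rw [← mul_assoc, evKinv_comm j i, mul_assoc]
    simp only [serre₃, pow_succ, pow_zero, one_mul, tmap_mul, mul_assoc, mul_one,
      evF_mul_self hn.ge, mul_zero, tmap_zero_left, smul_zero, zero_add, tmap_add_right,
      tmap_smul_right, evKinv_comm j i, hk, zero_mul]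
  · rw [tmap_mul, tmap_mul, evKinv_mul_evF hq0 hn.ge, tmap_smul_left, cartan_self, mul_one,
      one_mul]
  · rw [tmap_mul, tmap_mul, evKinv_mul_evF hq0 hn.ge, tmap_smul_left, hc, mul_one, one_mul]
  · rw [tmap_mul, tmap_mul, evKinv_mul_evF hq0 hn.ge, tmap_smul_left, hc', mul_one, one_mul]

end FockOps

/-! ### The action on the Fock spaces -/

namespace FockOps

variable {K : Type*} [Field K] {q : K} {n : ℕ} {F : ℤ → Type*} [∀ m, AddCommGroup (F m)]
  [∀ m, Module K (F m)] {W : ∀ m, Vz K ⊗[K] F m →ₗ[K] F (m + 1)} {vac : ∀ m, F m}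
  (S : FockOps q n W vac)

/-- The operator by which a generator acts. -/
def gen (m : ℤ) : Gen n → Module.End K (F m)
  | Gen.E i => S.e i m
  | Gen.F i => S.f i m
  | Gen.K i => S.k i m
  | Gen.Kinv i => S.kinv i m

theorem lift_gen_eq (hq0 : q ≠ 0) (hq2 : q - q⁻¹ ≠ 0) (hn : 2 ≤ n) (m : ℤ)
    {x y : FreeAlgebra K (Gen n)} (h : Rel q n x y) :
    FreeAlgebra.lift K (S.gen m) x = FreeAlgebra.lift K (S.gen m) y := by
  have hserre : ∀ X Y : ∀ m, Module.End K (F m), serre q X Y = 0 →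
      X m ^ 2 * Y m - (q + q⁻¹) • (X m * Y m * X m) + Y m * X m ^ 2 = 0 := fun X Y h => by
    rw [sub_eq_add_neg, ← neg_smul]
    exact congrFun h m
  have hserre₃ : ∀ X Y : ∀ m, Module.End K (F m), serre₃ q X Y = 0 →
      X m ^ 3 * Y m - qInt q 3 • (X m ^ 2 * Y m * X m) + qInt q 3 • (X m * Y m * X m ^ 2)
        - Y m * X m ^ 3 = 0 := fun X Y h => by
    rw [sub_eq_add_neg, sub_eq_add_neg, ← neg_smul, ← neg_one_smul K (Y m * X m ^ 3)]
    exact congrFun h m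
  induction h with
  | K_mul_Kinv i => simpa [gen] using congrFun (S.k_mul_kinv i) m
  | Kinv_mul_K i => simpa [gen] using congrFun (S.kinv_mul_k i) m
  | K_comm i j => simpa [gen] using congrFun (S.k_comm i j) m
  | K_E i j => simpa [gen] using congrFun (S.k_mul_e hq0 hn i j) m
  | K_F i j => simpa [gen] using congrFun (S.k_mul_f hq0 hn i j) m
  | E_F_same i => simpa [gen] using congrFun (S.e_mul_f_same hq0 hn hq2 i) m
  | E_F_ne i j h => simpa [gen] using congrFun (S.e_mul_f_of_ne hq0 hn h) m
  | E_E i j h₁ h₂ => simpa [gen] using congrFun (S.e_comm hq0 hn h₁ h₂) m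
  | F_F i j h₁ h₂ => simpa [gen] using congrFun (S.f_comm hq0 hn h₁ h₂) m
  | serre_E hn2 i j h =>
    simpa [gen] using hserre _ _ (S.serre_e hq0 (lt_of_le_of_ne hn hn2.symm) h)
  | serre_F hn2 i j h =>
    simpa [gen] using hserre _ _ (S.serre_f hq0 (lt_of_le_of_ne hn hn2.symm) h)
  | serre_E_two hn2 i j h => simpa [gen] using hserre₃ _ _ (S.serre₃_e hq0 hq2 hn2 h)
  | serre_F_two hn2 i j h => simpa [gen] using hserre₃ _ _ (S.serre₃_f hq0 hq2 hn2 h)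

/-- The representation of `U'_q(sl_n^)`. -/
def action (hq0 : q ≠ 0) (hq2 : q - q⁻¹ ≠ 0) (hn : 2 ≤ n) (m : ℤ) :
    Uq q n →ₐ[K] Module.End K (F m) :=
  RingQuot.liftAlgHom K ⟨FreeAlgebra.lift K (S.gen m), fun _ _ h => S.lift_gen_eq hq0 hq2 hn m h⟩

theorem action_gen (hq0 : q ≠ 0) (hq2 : q - q⁻¹ ≠ 0) (hn : 2 ≤ n) (m : ℤ) (g : Gen n) :
    S.action hq0 hq2 hn m (Uq.gen q n g) = S.gen m g := by
  rw [action, Uq.gen, RingQuot.liftAlgHom_mkAlgHom_apply, FreeAlgebra.lift_ι_apply]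

end FockOps

section Fock

variable {K : Type*} [Field K] {q : K} {n : ℕ} {m : ℤ}

theorem wedge_toFock (v : Vz K) (w : U K m) :
    wedge q n m v (toFock q n m w) = toFock q n (m + 1) (tensor v w) := rfl

/-- The map `v ⊗ w ↦ v ∧ w`. -/
def wedgeMap (q : K) (n : ℕ) (m : ℤ) : Vz K ⊗[K] Fock q n m →ₗ[K] Fock q n (m + 1) :=
  TensorProduct.lift
    { toFun := wedge q n m
      map_add' := fun v v' => Submodule.linearMap_qext _ (LinearMap.ext fun w => by
        change wedge q n m (v + v') (toFock q n m w)
          = wedge q n m v (toFock q n m w) + wedge q n m v' (toFock q n m w)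
        simp only [wedge_toFock, map_add, LinearMap.add_apply])
      map_smul' := fun c v => Submodule.linearMap_qext _ (LinearMap.ext fun w => by
        change wedge q n m (c • v) (toFock q n m w) = c • wedge q n m v (toFock q n m w)
        simp only [wedge_toFock, map_smul, LinearMap.smul_apply]) }

theorem wedgeMap_tmul (v : Vz K) (w : Fock q n m) :
    wedgeMap q n m (v ⊗ₜ w) = wedge q n m v w := rfl

theorem wedge_smul_left (c : K) (v : Vz K) (w : Fock q n m) :
    wedge q n m (c • v) w = c • wedge q n m v w := by
  rw [← wedgeMap_tmul, ← wedgeMap_tmul, ← smul_tmul', map_smul]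

theorem ket_move_vac_neg_one [CharZero K] (hq0 : q ≠ 0) (hq1 : q + 1 ≠ 0) (hn : 0 < n) (k : ℕ) :
    ket q n ((State.vac m).move k (-1)) = 0 :=
  ket_eq_zero_of_eq hq0 hq1 hn _ k (by
    simp only [State.move_apply, State.vac_apply, if_pos, if_neg (Nat.succ_ne_self k)]
    push_cast
    ring)

theorem ket_move_vac_one [CharZero K] (hq0 : q ≠ 0) (hq1 : q + 1 ≠ 0) (hn : 0 < n) (k : ℕ) :
    ket q n ((State.vac m).move (k + 1) 1) = 0 :=
  ket_eq_zero_of_eq hq0 hq1 hn _ k (by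
    simp only [State.move_apply, State.vac_apply, if_pos, if_neg (Nat.succ_ne_self k).symm]
    push_cast
    ring)

theorem diag_one [CharZero K] (hq0 : q ≠ 0) (hq1 : q + 1 ≠ 0) (hn : 0 < n) :
    (Weight.one K n).diag q m = 1 :=
  linearMap_ext_ket fun s => by
    rw [Weight.diag_ket hq0 hq1 hn]
    exact one_smul _ _

variable [CharZero K] (hq0 : q ≠ 0) (hq1 : q + 1 ≠ 0) (hn : 2 ≤ n)

/-- The operators `E_i`, `F_i`, `K_i`, `K_i⁻¹` on the Fock spaces. -/
def fockOps : FockOps q n (wedgeMap q n) (vac q n) where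
  e i m := op q (Weight.one K n) (Weight.kpow hq0 i 1) (-1) (coefE K n i) m
  f i m := op q (Weight.kpow hq0 i (-1)) (Weight.one K n) 1 (coefF K n i) m
  k i m := (Weight.kpow hq0 i 1).diag q m
  kinv i m := (Weight.kpow hq0 i (-1)).diag q m
  k_mul_kinv i := funext fun m => linearMap_ext_ket fun s => by
    have hn' : 0 < n := by omega
    simp only [Pi.mul_apply, Module.End.mul_apply, Weight.diag_ket hq0 hq1 hn', map_smul,
      smul_smul, Weight.kpow, ← zpow_add₀ hq0]
    simp
  kinv_mul_k i := funext fun m => linearMap_ext_ket fun s => by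
    have hn' : 0 < n := by omega
    simp only [Pi.mul_apply, Module.End.mul_apply, Weight.diag_ket hq0 hq1 hn', map_smul,
      smul_smul, Weight.kpow, ← zpow_add₀ hq0]
    simp
  k_comm i j := funext fun m => linearMap_ext_ket fun s => by
    have hn' : 0 < n := by omega
    simp only [Pi.mul_apply, Module.End.mul_apply, Weight.diag_ket hq0 hq1 hn', map_smul,
      smul_smul]
    rw [mul_comm]
  cop_e i := isCoproduct_of_forall fun m p w => by
    have hn' : 0 < n := by omega
    simp only [Pi.add_apply, LinearMap.add_apply, tmap, TensorProduct.map_tmul, map_add,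
      wedgeMap_tmul]
    rw [op_wedge hq0 hq1 hn' _ _ (by norm_num) (preservesQAlt_E hq0 hq1 hn i), evE_u,
      wedge_smul_left, sub_eq_add_neg]
    simp [Weight.one]
  cop_f i := isCoproduct_of_forall fun m p w => by
    have hn' : 0 < n := by omega
    simp only [Pi.add_apply, LinearMap.add_apply, tmap, TensorProduct.map_tmul, map_add,
      wedgeMap_tmul]
    rw [op_wedge hq0 hq1 hn' _ _ (by norm_num) (preservesQAlt_F hq0 hq1 hn i), evF_u, evKinv_u,
      wedge_smul_left, wedge_smul_left, diag_one hq0 hq1 hn']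
    simp [Weight.kpow]
  cop_k i := isCoproduct_of_forall fun m p w => by
    have hn' : 0 < n := by omega
    simp only [tmap, TensorProduct.map_tmul, wedgeMap_tmul]
    rw [Weight.diag_wedge hq0 hq1 hn', evK_u, wedge_smul_left]
    simp [Weight.kpow]
  cop_kinv i := isCoproduct_of_forall fun m p w => by
    have hn' : 0 < n := by omega
    simp only [tmap, TensorProduct.map_tmul, wedgeMap_tmul]
    rw [Weight.diag_wedge hq0 hq1 hn', evKinv_u, wedge_smul_left]
    simp [Weight.kpow]
  e_vac i m := by
    have hn' : 0 < n := by omega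
    rw [← ket_vac, op_ket hq0 hq1 hn' _ _ (by norm_num) (preservesQAlt_E hq0 hq1 hn i)]
    simp [ket_move_vac_neg_one hq0 hq1 hn']
  f_vac i m := by
    have hn' : 0 < n := by omega
    rw [← ket_vac, op_ket hq0 hq1 hn' _ _ (by norm_num) (preservesQAlt_F hq0 hq1 hn i),
      finsum_eq_single _ 0]
    · rw [← State.cons_vac, opCoef_cons_zero, State.move_cons_zero, wedgeMap_tmul, ← ket_vac,
        wedge_ket]
      simp [Weight.one]
    · intro k hk
      obtain ⟨k, rfl⟩ := Nat.exists_eq_succ_of_ne_zero hk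
      rw [Nat.succ_eq_add_one, ket_move_vac_one hq0 hq1 hn', smul_zero]
  k_vac i m := by
    have hn' : 0 < n := by omega
    rw [← ket_vac, Weight.diag_ket hq0 hq1 hn']
    simp only [Weight.kpow, totalWt_vac, one_mul]
  kinv_vac i m := by
    have hn' : 0 < n := by omega
    rw [← ket_vac, Weight.diag_ket hq0 hq1 hn']
    simp only [Weight.kpow, totalWt_vac, neg_one_mul]
  wedge_vac m := wedge_vac m
  wedge_self m p w := (isQAlt_wedge hq0 (by omega) w).self hq0 hq1 (by omega) p
  eq_zero X A h hvac := by
    refine fock_ext (fun m => ?_) (fun m p w hw => ?_)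
    · obtain ⟨m, rfl⟩ := State.exists_eq_add_one m
      exact hvac m
    · have h2 := h.apply (u K p) w
      rw [wedgeMap_tmul, tmap, TensorProduct.map_tmul, hw] at h2
      simpa using h2

end Fock

/-! ### Uniqueness of the action -/

section Uniqueness

variable {K : Type*} [Field K] {q : K} {n : ℕ}

theorem isFockAction_action [CharZero K] (hq0 : q ≠ 0) (hq1 : q + 1 ≠ 0) (hq2 : q - q⁻¹ ≠ 0)
    (hn : 2 ≤ n) :
    IsFockAction q n fun m => (fockOps hq0 hq1 hn).action hq0 hq2 hn m where
  E_vac i m := by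
    rw [FockOps.action_gen]
    exact (fockOps hq0 hq1 hn).e_vac i m
  F_vac i m := by
    rw [FockOps.action_gen]
    refine ((fockOps hq0 hq1 hn).f_vac i m).trans ?_
    rw [wedgeMap_tmul, coefF, ite_smul, one_smul, zero_smul, add_assoc, one_add_one_eq_two]
  K_vac i m := by
    rw [FockOps.action_gen]
    refine ((fockOps hq0 hq1 hn).k_vac i m).trans ?_
    split_ifs <;> simp
  E_wedge i m v w := by
    simp only [FockOps.action_gen]
    exact ((fockOps hq0 hq1 hn).cop_e i).apply v w
  F_wedge i m v w := by
    simp only [FockOps.action_gen]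
    exact ((fockOps hq0 hq1 hn).cop_f i).apply v w
  K_wedge i m v w := by
    simp only [FockOps.action_gen]
    exact ((fockOps hq0 hq1 hn).cop_k i).apply v w

theorem Uq.gen_K_mul_Kinv (i : ZMod n) : Uq.gen q n (Gen.K i) * Uq.gen q n (Gen.Kinv i) = 1 := by
  have h := RingQuot.mkAlgHom_rel K (Rel.K_mul_Kinv (q := q) i)
  rw [map_mul, map_one] at h
  exact h

theorem Uq.gen_Kinv_mul_K (i : ZMod n) : Uq.gen q n (Gen.Kinv i) * Uq.gen q n (Gen.K i) = 1 := by
  have h := RingQuot.mkAlgHom_rel K (Rel.Kinv_mul_K (q := q) i)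
  rw [map_mul, map_one] at h
  exact h

theorem IsFockAction.unique {ρ ρ' : ∀ m : ℤ, Uq q n →ₐ[K] Module.End K (Fock q n m)}
    (h : IsFockAction q n ρ) (h' : IsFockAction q n ρ') : ρ = ρ' := by
  have hK : ∀ i, (fun m => ρ m (Uq.gen q n (Gen.K i))) = fun m => ρ' m (Uq.gen q n (Gen.K i)) :=
    fun i => fock_ext (fun m => by rw [h.K_vac, h'.K_vac])
      (fun m p w hw => by rw [h.K_wedge, h'.K_wedge, hw])
  have hE : ∀ i, (fun m => ρ m (Uq.gen q n (Gen.E i))) = fun m => ρ' m (Uq.gen q n (Gen.E i)) :=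
    fun i => fock_ext (fun m => by rw [h.E_vac, h'.E_vac])
      (fun m p w hw => by rw [h.E_wedge, h'.E_wedge, hw, congrFun (hK i) m])
  have hF : ∀ i, (fun m => ρ m (Uq.gen q n (Gen.F i))) = fun m => ρ' m (Uq.gen q n (Gen.F i)) :=
    fun i => fock_ext
      (fun m => by
        obtain ⟨m, rfl⟩ := State.exists_eq_add_one m
        rw [h.F_vac, h'.F_vac])
      (fun m p w hw => by rw [h.F_wedge, h'.F_wedge, hw])
  funext m
  refine RingQuot.ringQuot_ext' _ _ _ (FreeAlgebra.hom_ext (funext fun g => ?_))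
  change ρ m (Uq.gen q n g) = ρ' m (Uq.gen q n g)
  cases g with
  | E i => exact congrFun (hE i) m
  | F i => exact congrFun (hF i) m
  | K i => exact congrFun (hK i) m
  | Kinv i =>
    refine left_inv_eq_right_inv (a := ρ m (Uq.gen q n (Gen.K i))) ?_ ?_
    · rw [← map_mul, Uq.gen_Kinv_mul_K, map_one]
    · rw [congrFun (hK i) m, ← map_mul, Uq.gen_K_mul_Kinv, map_one]

end Uniqueness

/-! ### The operators `B_a` -/

section Heisenberg

variable {K : Type*} [Field K] {q : K} {n : ℕ} {m : ℤ}

/-- The operator `∑ k, y_k ^ z` on `F_(m)`, where `d = z n`: it sends `u_{p_0} ∧ u_{p_1} ∧ ⋯` to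
the sum over `k` of the wedges with `p_k` replaced by `p_k + d`. -/
def heis (q : K) (n : ℕ) (d m : ℤ) : Module.End K (Fock q n m) :=
  op q (Weight.one K n) (Weight.one K n) d (fun _ => 1) m

theorem y_zpow_single (k : ℕ) (z : ℤ) (s : State m) (x : K) :
    (y K n m k ^ z) (Finsupp.single s x) = Finsupp.single (s.move k (z * n)) x := by
  have h1 : ∀ s : State m, y K n m k (Finsupp.single s x) = Finsupp.single (s.move k n) x :=
    fun s => Finsupp.domLCongr_single (yPerm n m k) s x
  have h2 : ∀ s : State m, (y K n m k)⁻¹ (Finsupp.single s x)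
      = Finsupp.single (s.move k (-n)) x := fun s => by
    change (y K n m k).symm _ = _
    rw [LinearEquiv.symm_apply_eq, h1]
    congr 1
    exact State.ext fun j => by simp only [State.move_apply]; split_ifs <;> ring
  induction z using Int.induction_on generalizing s with
  | zero =>
    rw [zpow_zero, zero_mul, LinearEquiv.coe_one, id]
    congr 1
    exact State.ext fun j => by simp only [State.move_apply]; split_ifs <;> ring
  | succ z ih =>
    rw [zpow_add_one, LinearEquiv.mul_apply, h1, ih]
    congr 1
    exact State.ext fun j => by simp only [State.move_apply]; split_ifs <;> ring
  | pred z ih =>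
    rw [zpow_sub_one, LinearEquiv.mul_apply, h2, ih]
    congr 1
    exact State.ext fun j => by simp only [State.move_apply]; split_ifs <;> ring

theorem opCoef_one (s : State m) (k : ℕ) :
    opCoef (Weight.one K n) (Weight.one K n) (fun _ => 1) s k = 1 := by
  simp [opCoef, Weight.one]

theorem coefE_add {d : ℤ} (hdn : (d : ZMod n) = 0) (i : ZMod n) (p : ℤ) :
    coefE K n i (p + d) = coefE K n i p := by
  rw [coefE, coefE, Int.cast_add, hdn, add_zero]

theorem coefF_add {d : ℤ} (hdn : (d : ZMod n) = 0) (i : ZMod n) (p : ℤ) :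
    coefF K n i (p + d) = coefF K n i p := by
  rw [coefF, coefF, Int.cast_add, hdn, add_zero]

theorem wt_add {d : ℤ} (hdn : (d : ZMod n) = 0) (i : ZMod n) (p : ℤ) :
    wt n i (p + d) = wt n i p :=
  wt_congr i (by rw [Int.cast_add, hdn, add_zero])

variable [CharZero K] (hq0 : q ≠ 0) (hq1 : q + 1 ≠ 0) (hn : 0 < n)
include hq0 hq1 hn

omit hq0 hq1 hn [CharZero K] in
theorem toFock_single (s : State m) (x : K) :
    toFock q n m (Finsupp.single s x) = x • ket q n s := by
  rw [ket, ← map_smul, Finsupp.smul_single, smul_eq_mul, mul_one]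

theorem toFock_y_zpow_finite {z : ℤ} (hz : z ≠ 0) (w : U K m) :
    {k : ℕ | toFock q n m ((y K n m k ^ z) w) ≠ 0}.Finite := by
  have hd : z * n ≠ 0 := mul_ne_zero hz (by exact_mod_cast hn.ne')
  induction w using Finsupp.induction_linear with
  | zero => simp
  | add a b ha hb =>
    refine (ha.union hb).subset fun k hk => ?_
    by_contra h
    simp only [Set.mem_union, Set.mem_ofPred_eq, not_or, not_not] at h
    exact hk (by rw [map_add, map_add, h.1, h.2, add_zero])
  | single s x =>
    refine (ket_move_finite hq0 hq1 hn s hd).subset fun k hk h => hk ?_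
    rw [y_zpow_single, toFock_single, h, smul_zero]

theorem heis_toFock {z : ℤ} (hz : z ≠ 0) (w : U K m) :
    heis q n (z * n) m (toFock q n m w) = ∑ᶠ k : ℕ, toFock q n m ((y K n m k ^ z) w) := by
  have hd : z * n ≠ 0 := mul_ne_zero hz (by exact_mod_cast hn.ne')
  have hdn : ((z * n : ℤ) : ZMod n) = 0 := by simp
  induction w using Finsupp.induction_linear with
  | zero => simp
  | add a b ha hb =>
    simp only [map_add, ha, hb]
    exact (finsum_add_distrib (toFock_y_zpow_finite hq0 hq1 hn hz a)
      (toFock_y_zpow_finite hq0 hq1 hn hz b)).symm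
  | single s x =>
    simp only [y_zpow_single, toFock_single, map_smul]
    rw [heis, op_ket hq0 hq1 hn _ _ hd (preservesQAlt_B hdn),
      smul_finsum' _ (opU_support_finite hq0 hq1 hn _ _ hd _ s)]
    simp only [opCoef_one, one_smul]

theorem heis_wedge {d : ℤ} (hd : d ≠ 0) (hdn : (d : ZMod n) = 0) (p : ℤ) (w : Fock q n m) :
    heis q n d (m + 1) (wedge q n m (u K p) w)
      = wedge q n m (u K (p + d)) w + wedge q n m (u K p) (heis q n d m w) := by
  rw [heis, op_wedge hq0 hq1 hn _ _ hd (preservesQAlt_B hdn), diag_one hq0 hq1 hn]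
  simp [Weight.one, heis]

theorem op_ket_mem_span (L R : Weight K n) {d : ℤ} (hd : d ≠ 0) {α : ℤ → K}
    (hA : PreservesQAlt q n L R d α) (s : State m) :
    op q L R d α m (ket q n s) ∈ Submodule.span K (Set.range fun k => ket q n (s.move k d)) := by
  rw [op_ket hq0 hq1 hn L R hd hA]
  exact finsum_induction (· ∈ Submodule.span K _) (Submodule.zero_mem _)
    (fun _ _ => Submodule.add_mem _)
    fun k => Submodule.smul_mem _ _ (Submodule.subset_span ⟨k, rfl⟩)

omit hq0 hq1 hn [CharZero K] in
theorem State.vac_move_move_apply (k j : ℕ) (d ε : ℤ) (i : ℕ) :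
    (((State.vac m).move k d).move j ε).1 i
      = m - i + (if i = k then d else 0) + (if i = j then ε else 0) := by
  simp only [State.move_apply, State.vac_apply]
  split_ifs <;> ring

/-- Far out, moving one factor of the vacuum by a large multiple of `n` and another one by at most
`1` gives zero. -/
theorem ket_vac_move_move_eq_zero {d ε : ℤ} (hd : 2 ≤ d.natAbs) (hdn : (d : ZMod n) = 0)
    (hε : ε = -1 ∨ ε = 0 ∨ ε = 1) {k j : ℕ} (hk : d.natAbs < k) (hj : d.natAbs < j) :
    ket q n (((State.vac m).move k d).move j ε) = 0 := by
  have hs := State.vac_move_move_apply (m := m) k j d ε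
  generalize ((State.vac m).move k d).move j ε = s at hs ⊢
  rcases lt_or_ge 0 d with hd0 | hd0
  · by_cases hjk : k < j ∨ ε = 0
    · refine ket_eq_zero_of_pos hq0 hq1 hn s k d hd0 (by omega) ?_ fun i hi _ => ?_
      · rw [hs]; split_ifs <;> omega
      · rw [hs]; split_ifs <;> omega
    by_cases hjk' : j = k
    · refine ket_eq_zero_of_pos hq0 hq1 hn s k (d + ε) (by omega) (by omega) ?_ fun i hi _ => ?_
      · rw [hs]; split_ifs <;> omega
      · rw [hs]; split_ifs <;> omega
    -- Now `j < k`: the `j`-th factor repeats a neighbour, unless that neighbour is the `k`-th one.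
    rcases hε with rfl | rfl | rfl
    · by_cases hkj : k = j + 1
      · subst hkj
        have h0 : s.1 j = m - j - 1 := by rw [hs]; split_ifs <;> omega
        have h1 : s.1 (j + 1) = m - j - 1 + d := by rw [hs]; split_ifs <;> omega
        rw [ket_eq_neg_swap hq0 hq1 hn s j (by rw [h0, h1, Int.cast_add, hdn, add_zero]),
          neg_eq_zero]
        refine ket_eq_zero_of_pos hq0 hq1 hn _ j (d - 1) (by omega) (by omega) ?_
          fun i hi _ => ?_
        · rw [State.set_apply, State.set_apply, if_neg (by omega), if_pos rfl, h1]; ring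
        · rw [State.set_apply, State.set_apply, if_neg (by omega), if_neg (by omega), hs]
          split_ifs <;> omega
      · refine ket_eq_zero_of_eq hq0 hq1 hn s j ?_
        rw [hs, hs]; split_ifs <;> omega
    · omega
    · obtain ⟨j, rfl⟩ : ∃ j', j = j' + 1 := ⟨j - 1, by omega⟩
      refine ket_eq_zero_of_eq hq0 hq1 hn s j ?_
      rw [hs, hs]; split_ifs <;> omega
  · by_cases hjk : j ≤ k ∨ ε = 0
    · refine ket_eq_zero_of_neg hq0 hq1 hn s k (d + if k = j then ε else 0) ?_ ?_ fun i hi => ?_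
      · split_ifs <;> omega
      · rw [hs, if_pos rfl]; ring
      · rw [hs]; split_ifs <;> omega
    -- Now `k < j`: the `j`-th factor repeats a neighbour, unless that neighbour is the `k`-th one.
    rcases hε with rfl | rfl | rfl
    · refine ket_eq_zero_of_eq hq0 hq1 hn s j ?_
      rw [hs, hs]; split_ifs <;> omega
    · omega
    · obtain ⟨j, rfl⟩ : ∃ j', j = j' + 1 := ⟨j - 1, by omega⟩
      by_cases hkj : j = k
      · subst hkj
        have h0 : s.1 j = m - j + d := by rw [hs]; split_ifs <;> omega
        have h1 : s.1 (j + 1) = m - j := by rw [hs]; split_ifs <;> omega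
        rw [ket_eq_neg_swap hq0 hq1 hn s j (by rw [h0, h1, Int.cast_add, hdn, add_zero]),
          neg_eq_zero]
        refine ket_eq_zero_of_neg hq0 hq1 hn _ (j + 1) (d + 1) (by omega) ?_ fun i hi => ?_
        · rw [State.set_apply, if_pos rfl, h0]; push_cast; ring
        · rw [State.set_apply, State.set_apply, if_neg (by omega), if_neg (by omega), hs]
          split_ifs <;> omega
      · refine ket_eq_zero_of_eq hq0 hq1 hn s j ?_
        rw [hs, hs]; split_ifs <;> omega

/-- An operator that moves one factor by `ε` commutes with `B_a` as soon as the commutator commutes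
with wedge multiplications up to scalars: the commutator then sends the vacuum to a
combination of vectors that differ from the vacuum arbitrarily far out only. -/
theorem commute_heis {d ε : ℤ} (hd : 2 ≤ d.natAbs) (hdn : (d : ZMod n) = 0)
    (hε : ε = -1 ∨ ε = 0 ∨ ε = 1) (X : ∀ m, Module.End K (Fock q n m))
    (hX : ∀ (m : ℤ) (s : State m),
      X m (ket q n s) ∈ Submodule.span K (Set.range fun k => ket q n (s.move k ε)))
    (c : ℤ → K)
    (hc : ∀ (m p : ℤ) (w : Fock q n m),
      (X (m + 1) * heis q n d (m + 1) - heis q n d (m + 1) * X (m + 1)) (wedge q n m (u K p) w)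
        = c p • wedge q n m (u K p) ((X m * heis q n d m - heis q n d m * X m) w)) (m : ℤ) :
    Commute (heis q n d m) (X m) := by
  have hd0 : d ≠ 0 := by omega
  -- `P m L`: the vacuum with two factors behind the first `L` ones moved by `d` and by `ε`.
  let P : ∀ m : ℤ, ℕ → Submodule K (Fock q n m) := fun m L => Submodule.span K
    {x | ∃ k j : ℕ, L ≤ k ∧ L ≤ j ∧ x = ket q n (((State.vac m).move k d).move j ε)}
  have hB : ∀ (m : ℤ) (s : State m), heis q n d m (ket q n s)
      ∈ Submodule.span K (Set.range fun k => ket q n (s.move k d)) := fun m s =>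
    op_ket_mem_span hq0 hq1 hn _ _ hd0 (preservesQAlt_B hdn) s
  have key : ∀ (L : ℕ) (m : ℤ),
      (X m * heis q n d m - heis q n d m * X m) (vac q n m) ∈ P m L := by
    intro L
    induction L with
    | zero =>
      intro m
      rw [LinearMap.sub_apply, Module.End.mul_apply, Module.End.mul_apply, ← ket_vac]
      refine Submodule.sub_mem _ ?_ ?_
      · refine (Submodule.map_span_le (X m) _ (P m 0)).2 ?_
          (Submodule.mem_map_of_mem (hB m (State.vac m)))
        rintro _ ⟨k, rfl⟩
        refine Submodule.span_mono ?_ (hX m _)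
        rintro _ ⟨j, rfl⟩
        exact ⟨k, j, k.zero_le, j.zero_le, rfl⟩
      · refine (Submodule.map_span_le (heis q n d m) _ (P m 0)).2 ?_
          (Submodule.mem_map_of_mem (hX m (State.vac m)))
        rintro _ ⟨j, rfl⟩
        refine Submodule.span_mono ?_ (hB m _)
        rintro _ ⟨k, rfl⟩
        exact ⟨k, j, k.zero_le, j.zero_le, by dsimp only; rw [State.move_comm]⟩
    | succ L ih =>
      intro m
      obtain ⟨m, rfl⟩ := State.exists_eq_add_one m
      rw [← wedge_vac, hc]
      refine Submodule.smul_mem _ _ ?_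
      refine (Submodule.map_span_le (wedge q n m (u K (m + 1))) _ (P (m + 1) (L + 1))).2 ?_
        (Submodule.mem_map_of_mem (ih m))
      rintro _ ⟨k, j, hk, hj, rfl⟩
      refine Submodule.subset_span ⟨k + 1, j + 1, by omega, by omega, ?_⟩
      rw [wedge_ket, ← State.cons_vac, State.move_cons_succ, State.move_cons_succ]
  have hvac : ∀ m, (X m * heis q n d m - heis q n d m * X m) (vac q n m) = 0 := fun m => by
    have hP : P m (d.natAbs + 1) ≤ ⊥ := Submodule.span_le.2 (by
      rintro _ ⟨k, j, hk, hj, rfl⟩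
      exact ket_vac_move_move_eq_zero hq0 hq1 hn hd hdn hε hk hj)
    exact (Submodule.mem_bot K).1 (hP (key _ m))
  have h0 : (fun m => X m * heis q n d m - heis q n d m * X m) = fun m => 0 :=
    fock_ext hvac fun m p w hw => by
      rw [hc, hw, LinearMap.zero_apply, LinearMap.zero_apply, map_zero, smul_zero]
  exact (sub_eq_zero.1 (congrFun h0 m)).symm

omit hn in
/-- The operators `B_a` commute with the generators. Since `d` is a multiple of `n`, moving a factor
by `d` commutes with the action on `V(z)`, so that `commute_heis` applies. -/
theorem commute_heis_gen {d : ℤ} (hd : d ≠ 0) (hdn : (d : ZMod n) = 0) (hn : 2 ≤ n) (m : ℤ)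
    (g : Gen n) : Commute (heis q n d m) ((fockOps hq0 hq1 hn).gen m g) := by
  have hn' : 0 < n := by omega
  have hd2 : 2 ≤ d.natAbs := by
    have := Nat.le_of_dvd (Int.natAbs_pos.2 hd)
      (Int.natCast_dvd.1 ((ZMod.intCast_zmod_eq_zero_iff_dvd d n).1 hdn))
    omega
  set S := fockOps hq0 hq1 hn with hS
  have hK : ∀ i m, Commute (heis q n d m) (S.k i m) := fun i => by
    refine commute_heis hq0 hq1 hn' hd2 hdn (Or.inr (Or.inl rfl)) (S.k i) (fun m s => ?_)
      (fun p => q ^ wt n i p) fun m p w => ?_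
    · -- `K_i` moves a factor by `0`.
      have e : s.move 0 0 = s := State.ext fun j => by rw [State.move_apply, add_zero, ite_self]
      have : S.k i m (ket q n s) = (Weight.kpow hq0 i 1).tot s • ket q n (s.move 0 0) := by
        rw [e]
        exact Weight.diag_ket hq0 hq1 hn' _ s
      rw [this]
      exact Submodule.smul_mem _ _ (Submodule.subset_span ⟨0, rfl⟩)
    · have hkw : ∀ p (w : Fock q n m), S.k i (m + 1) (wedge q n m (u K p) w)
          = q ^ wt n i p • wedge q n m (u K p) (S.k i m w) := S.k_wedge i m
      simp only [LinearMap.sub_apply, Module.End.mul_apply, heis_wedge hq0 hq1 hn' hd hdn, hkw,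
        map_add, map_sub, map_smul, wt_add hdn]
      module
  cases g with
  | E i =>
    refine commute_heis hq0 hq1 hn' hd2 hdn (Or.inl rfl) (S.e i)
      (fun m s => op_ket_mem_span hq0 hq1 hn' _ _ (by norm_num) (preservesQAlt_E hq0 hq1 hn i) s)
      (fun _ => 1) (fun m p w => ?_) m
    have hew : ∀ p (w : Fock q n m), S.e i (m + 1) (wedge q n m (u K p) w)
        = coefE K n i p • wedge q n m (u K (p - 1)) (S.k i m w)
          + wedge q n m (u K p) (S.e i m w) := S.e_wedge i m
    have hk : S.k i m (heis q n d m w) = heis q n d m (S.k i m w) :=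
      (LinearMap.congr_fun (hK i m) w).symm
    simp only [LinearMap.sub_apply, Module.End.mul_apply, heis_wedge hq0 hq1 hn' hd hdn, hew,
      map_add, map_sub, map_smul, coefE_add hdn, hk]
    rw [show p + d - 1 = p - 1 + d by ring]
    module
  | F i =>
    refine commute_heis hq0 hq1 hn' hd2 hdn (Or.inr (Or.inr rfl)) (S.f i)
      (fun m s => op_ket_mem_span hq0 hq1 hn' _ _ (by norm_num) (preservesQAlt_F hq0 hq1 hn i) s)
      (fun p => q ^ (-wt n i p)) (fun m p w => ?_) m
    have hfw : ∀ p (w : Fock q n m), S.f i (m + 1) (wedge q n m (u K p) w)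
        = coefF K n i p • wedge q n m (u K (p + 1)) w
          + q ^ (-wt n i p) • wedge q n m (u K p) (S.f i m w) := S.f_wedge i m
    simp only [LinearMap.sub_apply, Module.End.mul_apply, heis_wedge hq0 hq1 hn' hd hdn, hfw,
      map_add, map_sub, map_smul, coefF_add hdn, wt_add hdn]
    rw [show p + d + 1 = p + 1 + d by ring]
    module
  | K i => exact hK i m
  | Kinv i =>
    have h1 : S.k i m * S.kinv i m = 1 := congrFun (S.k_mul_kinv i) m
    have h2 : S.kinv i m * S.k i m = 1 := congrFun (S.kinv_mul_k i) m
    exact Commute.units_inv_right (u := ⟨S.k i m, S.kinv i m, h1, h2⟩) (hK i m)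

omit hn in
theorem commute_heis_action (hq2 : q - q⁻¹ ≠ 0) {d : ℤ} (hd : d ≠ 0) (hdn : (d : ZMod n) = 0)
    (hn : 2 ≤ n) (m : ℤ) (x : Uq q n) :
    Commute (heis q n d m) ((fockOps hq0 hq1 hn).action hq0 hq2 hn m x) := by
  obtain ⟨x, rfl⟩ := RingQuot.mkAlgHom_surjective K (Rel q n) x
  induction x using FreeAlgebra.induction with
  | grade0 r =>
    rw [AlgHom.commutes, AlgHom.commutes]
    exact Algebra.commute_algebraMap_right r _
  | grade1 g =>
    change Commute _ (((fockOps hq0 hq1 hn).action hq0 hq2 hn m) (Uq.gen q n g))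
    rw [FockOps.action_gen]
    exact commute_heis_gen hq0 hq1 hd hdn hn m g
  | mul a b ha hb => rw [map_mul, map_mul]; exact ha.mul_right hb
  | add a b ha hb => rw [map_add, map_add]; exact ha.add_right hb

end Heisenberg

end QFock
end

theorem proposition2p1 {K : Type*} [Field K] [CharZero K] (q : K) (hq0 : q ≠ 0)
    (hq : ∀ k : ℕ, 0 < k → q ^ k ≠ 1) (n : ℕ) (hn : 2 ≤ n) :
    (∃! ρ : ∀ m : ℤ, QFock.Uq q n →ₐ[K] Module.End K (QFock.Fock q n m),
      QFock.IsFockAction q n ρ) ∧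
    ∀ a : ℤ, a ≠ 0 → ∀ m : ℤ,
      (∀ w : QFock.U K m,
        {k : ℕ | QFock.toFock q n m ((QFock.y K n m k ^ (-a)) w) ≠ 0}.Finite) ∧
      ∃ B : Module.End K (QFock.Fock q n m),
        (∀ w : QFock.U K m,
          B (QFock.toFock q n m w) =
            ∑ᶠ k : ℕ, QFock.toFock q n m ((QFock.y K n m k ^ (-a)) w)) ∧
        ∀ ρ : ∀ m : ℤ, QFock.Uq q n →ₐ[K] Module.End K (QFock.Fock q n m),
          QFock.IsFockAction q n ρ → ∀ x : QFock.Uq q n, Commute B (ρ m x) := by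
  have hsq : q ^ 2 ≠ 1 := hq 2 two_pos
  have hq1 : q + 1 ≠ 0 := fun h => hsq (by linear_combination (q - 1) * h)
  have hq2 : q - q⁻¹ ≠ 0 := fun h => hsq (by
    have := mul_inv_cancel₀ hq0
    linear_combination q * h + this)
  have hρ := QFock.isFockAction_action hq0 hq1 hq2 hn
  have hn' : 0 < n := by omega
  refine ⟨⟨_, hρ, fun ρ h => h.unique hρ⟩, fun a ha m => ?_⟩
  refine ⟨QFock.toFock_y_zpow_finite hq0 hq1 hn' (neg_ne_zero.2 ha),
    QFock.heis q n (-a * n) m, QFock.heis_toFock hq0 hq1 hn' (neg_ne_zero.2 ha), ?_⟩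
  intro ρ h x
  rw [h.unique hρ]
  exact QFock.commute_heis_action hq0 hq1 hq2
    (mul_ne_zero (neg_ne_zero.2 ha) (by exact_mod_cast hn'.ne')) (by simp) hn m x
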